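/- Let $X$ be a complex Banach space, $p\in(1,\infty)$, $\gamma\in(-1,p-1)$, and $w_\gamma(x)=|x|^\gamma$ on $\mathbb{R}$. For $s\in\mathbb{R}$ let $H^{s,p}(\mathbb{R},w_\gamma;X)$ be the space of all $f\in\mathcal{S}'(\mathbb{R};X)$ with $(1-\Delta)^{s/2}f\in L^p(\mathbb{R},w_\gamma;X)$, normed by $\|f\|=\|(1-\Delta)^{s/2}f\|_{L^p(\mathbb{R},w_\gamma;X)}$, and let $H^{s,p}_0(\mathbb{R},w_\gamma;X)$ be the closure of $C^\infty_c(\mathbb{R}\setminus\{0\};X)$ in it. Let $\mathbb{R}_+=(0,\infty)$, let $H^{s,p}(\mathbb{R}_+,w_\gamma;X)$ be the space of restrictions $g|_{\mathbb{R}_+}\in\mathcal{D}'(\mathbb{R}_+;X)$ of elements $g$ of $H^{s,p}(\mathbb{R},w_\gamma;X)$, with the norm $\|f\|=\inf\{\|g\|: g|_{\mathbb{R}_+}=f\}$, and let $H^{s,p}_0(\mathbb{R}_+,w_\gamma;X)$ be the closure of $C^\infty_c((0,\infty);X)$ in it. Let $k\ge -1$ be an integer and let $s\in\mathbb{R}$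 satisfy $$k+\frac{1+\gamma}{p}<s<k+1+\frac{1+\gamma}{p}.$$ Then the following hold. (a) The map $f\mapsto(f(0),f'(0),\dots,f^{(k)}(0))$ on $H^{s,p}(\mathbb{R},w_\gamma;X)\cap C^k(\mathbb{R};X)$ extends uniquely to a bounded linear map $\mathrm{Tr}_k: H^{s,p}(\mathbb{R},w_\gamma;X)\to X^{k+1}$, and $$H^{s,p}_0(\mathbb{R},w_\gamma;X)=\{f\in H^{s,p}(\mathbb{R},w_\gamma;X):\mathrm{Tr}_k f=0\}.$$ (b) There is a well-defined bounded linear map $\mathrm{Tr}_{k,+}:H^{s,p}(\mathbb{R}_+,w_\gamma;X)\to X^{k+1}$ with $\mathrm{Tr}_{k,+}f=\mathrm{Tr}_k g$ whenever $g\in H^{s,p}(\mathbb{R},w_\gamma;X)$ and $g|_{\mathbb{R}_+}=f$, and $$H^{s,p}_0(\mathbb{R}_+,w_\gamma;X)=\{f\in H^{s,p}(\mathbb{R}_+,w_\gamma;X):\mathrm{Tr}_{k,+} f=0\}.$$ For $k=-1$ the space $X^{k+1}$ is trivial, so the conditions $\mathrm{Tr}_kf=0$ and $\mathrm{Tr}_{k,+}f=0$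 are empty and the two equalities say that the test functions are dense. -/

import Mathlib

open MeasureTheory TemperedDistribution TopologicalSpace
open scoped SchwartzMap Distributions ContDiff ENNReal

noncomputable section

set_option linter.unusedSectionVars false

namespace WeightedBessel

/-! ### Power weights -/

/-- The measure `w_γ(x) dx` on `ℝ`, where `w_γ(x) = |x| ^ γ`. The space `L^p(ℝ, w_γ; X)` is
`Lp X (ENNReal.ofReal p) (powerMeasure γ)`. -/
def powerMeasure (γ : ℝ) : Measure ℝ :=
  (volume : Measure ℝ).withDensity fun x => ENNReal.ofReal (|x| ^ γ)

theorem volume_absolutelyContinuous_powerMeasure (γ : ℝ) :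
    (volume : Measure ℝ) ≪ powerMeasure γ := by
  refine withDensity_absolutelyContinuous' ?_ ?_
  · exact (ENNReal.measurable_ofReal.comp
      ((measurable_norm (α := ℝ)).pow_const γ)).aemeasurable
  · have h : ∀ᵐ x : ℝ, x ≠ 0 := by simp [ae_iff]
    filter_upwards [h] with x hx
    simpa using Real.rpow_pos_of_pos (abs_pos.mpr hx) γ

theorem powerMeasure_absolutelyContinuous_volume (γ : ℝ) :
    powerMeasure γ ≪ (volume : Measure ℝ) :=
  withDensity_absolutelyContinuous _ _

instance fact_one_le_ofReal (p : ℝ) [hp : Fact (1 < p)] : Fact (1 ≤ ENNReal.ofReal p) :=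
  ⟨by simpa using hp.out.le⟩

variable (X : Type*) [NormedAddCommGroup X] [NormedSpace ℂ X]

/-! ### The operators `(1 - Δ) ^ (s / 2)` -/

/-- The symbol of `(1 - Δ) ^ (s / 2)`. With the normalisation
`𝓕 f ξ = ∫ exp (- 2 π i x ξ) f x dx` used here, `-Δ` has the symbol `(2 π ξ) ^ 2`. -/
def besselSymbol (s : ℝ) (ξ : ℝ) : ℂ :=
  (((1 + (2 * Real.pi * ξ) ^ 2) ^ (s / 2) : ℝ) : ℂ)

theorem besselSymbol_hasTemperateGrowth (s : ℝ) :
    (besselSymbol s).HasTemperateGrowth := by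
  have h1 : (fun x : ℝ => (1 + ‖x‖ ^ 2) ^ (s / 2)).HasTemperateGrowth :=
    Function.hasTemperateGrowth_one_add_norm_sq_rpow ℝ (s / 2)
  have h2 : (fun ξ : ℝ => 2 * Real.pi * ξ).HasTemperateGrowth :=
    ((2 * Real.pi) • ContinuousLinearMap.id ℝ ℝ).hasTemperateGrowth
  have h3 := Function.Complex.hasTemperateGrowth_ofReal.comp (h1.comp h2)
  have h4 : besselSymbol s =
      Complex.ofReal ∘ ((fun x : ℝ => (1 + ‖x‖ ^ 2) ^ (s / 2)) ∘
        (fun ξ : ℝ => 2 * Real.pi * ξ)) := by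
    funext ξ
    simp [besselSymbol]
  rw [h4]
  exact h3

/-- The Bessel potential operator `𝒥_s f = (1 - Δ) ^ (s / 2) f` on `X`-valued tempered
distributions. -/
def bessel (s : ℝ) : 𝓢'(ℝ, X) →L[ℂ] 𝓢'(ℝ, X) :=
  fourierMultiplierCLM X (besselSymbol s)

variable {X}

theorem bessel_bessel (s t : ℝ) (f : 𝓢'(ℝ, X)) :
    bessel X t (bessel X s f) = bessel X (s + t) f := by
  simp only [bessel]
  rw [fourierMultiplierCLM_fourierMultiplierCLM_apply (besselSymbol_hasTemperateGrowth s)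
    (besselSymbol_hasTemperateGrowth t)]
  congr 2
  funext ξ
  simp only [besselSymbol, Pi.mul_apply]
  norm_cast
  rw [← Real.rpow_add (by positivity)]
  congr 1
  ring

theorem bessel_zero (f : 𝓢'(ℝ, X)) : bessel X 0 f = f := by
  have h : besselSymbol 0 = fun _ => (1 : ℂ) := by
    funext ξ
    simp [besselSymbol]
  simp [bessel, h]

theorem bessel_injective (s : ℝ) : Function.Injective (bessel X s) := by
  intro f g h
  have := congrArg (bessel X (-s)) h
  simpa [bessel_bessel, bessel_zero] using this

/-! ### Functions as distributions -/

/-- The tempered distribution `f` is (integration against) the function `g`. -/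
def IsInducedBy (f : 𝓢'(ℝ, X)) (g : ℝ → X) : Prop :=
  ∀ φ : 𝓢(ℝ, ℂ), Integrable (fun x => φ x • g x) ∧ f φ = ∫ x, φ x • g x

/-- The tempered distribution `f` coincides, as an element of `𝓓'(ℝ; X)`, with the locally
integrable function `g`. -/
def IsLocallyInducedBy (f : 𝓢'(ℝ, X)) (g : ℝ → X) : Prop :=
  LocallyIntegrable g ∧
    ∀ φ : 𝓢(ℝ, ℂ), HasCompactSupport φ → f φ = ∫ x, φ x • g x

theorem IsInducedBy.add {f₁ f₂ : 𝓢'(ℝ, X)} {g₁ g₂ g : ℝ → X} (h₁ : IsInducedBy f₁ g₁)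
    (h₂ : IsInducedBy f₂ g₂) (hg : g =ᵐ[volume] g₁ + g₂) : IsInducedBy (f₁ + f₂) g := by
  intro φ
  have e : (fun x => φ x • g x) =ᵐ[volume] fun x => φ x • g₁ x + φ x • g₂ x := by
    filter_upwards [hg] with x hx
    simp [hx]
  refine ⟨((h₁ φ).1.add (h₂ φ).1).congr e.symm, ?_⟩
  rw [integral_congr_ae e, integral_add (h₁ φ).1 (h₂ φ).1, ← (h₁ φ).2, ← (h₂ φ).2]
  rfl

theorem IsInducedBy.smul {f : 𝓢'(ℝ, X)} {g₁ g : ℝ → X} (c : ℂ) (h : IsInducedBy f g₁)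
    (hg : g =ᵐ[volume] c • g₁) : IsInducedBy (c • f) g := by
  intro φ
  have e : (fun x => φ x • g x) =ᵐ[volume] fun x => c • (φ x • g₁ x) := by
    filter_upwards [hg] with x hx
    rw [hx, Pi.smul_apply, smul_comm]
  refine ⟨((h φ).1.smul c).congr e.symm, ?_⟩
  rw [integral_congr_ae e, integral_smul, ← (h φ).2]
  rfl

theorem IsInducedBy.zero {g : ℝ → X} (hg : g =ᵐ[volume] 0) :
    IsInducedBy (0 : 𝓢'(ℝ, X)) g := by
  intro φ
  have e : (fun x => φ x • g x) =ᵐ[volume] fun _ => (0 : X) := by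
    filter_upwards [hg] with x hx
    simp [hx]
  refine ⟨(integrable_zero _ _ _).congr e.symm, ?_⟩
  rw [integral_congr_ae e]
  simp

theorem IsInducedBy.ae_eq_zero [CompleteSpace X] {g : ℝ → X}
    (h : IsInducedBy (0 : 𝓢'(ℝ, X)) g) : g =ᵐ[volume] 0 := by
  have real_test : ∀ ψ : ℝ → ℝ, ContDiff ℝ ∞ ψ → HasCompactSupport ψ →
      Integrable (fun x => ψ x • g x) ∧ ∫ x, ψ x • g x = 0 := by
    intro ψ h1 h2
    have h3 : HasCompactSupport (fun x => (ψ x : ℂ)) :=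
      h2.comp_left (g := Complex.ofReal) Complex.ofReal_zero
    have h4 : ContDiff ℝ ∞ (fun x => (ψ x : ℂ)) := Complex.ofRealCLM.contDiff.comp h1
    have h5 := h (h3.toSchwartzMap h4)
    have h6 : (fun x => (h3.toSchwartzMap h4) x • g x) = fun x => ψ x • g x := by
      funext x
      change ((ψ x : ℂ)) • g x = _
      simp
    rw [h6] at h5
    exact ⟨h5.1, h5.2.symm⟩
  refine ae_eq_zero_of_integral_contDiff_smul_eq_zero ?_ fun ψ h1 h2 => (real_test ψ h1 h2).2
  intro x
  let ψ : ContDiffBump x := ⟨1, 2, one_pos, one_lt_two⟩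
  refine ⟨Metric.closedBall x 1, Metric.closedBall_mem_nhds x one_pos, ?_⟩
  refine ((real_test ψ ψ.contDiff ψ.hasCompactSupport).1.integrableOn).congr_fun ?_
    measurableSet_closedBall
  intro y hy
  simp [ψ.one_of_mem_closedBall hy]

/-! ### The spaces `H^{s,p}(ℝ, w_γ; X)` -/

variable (X) in
/-- The tempered distributions `f` such that `𝒥_s f` belongs to `L^p(ℝ, w_γ; X)`. (For
`-1 < γ < p - 1`, the range in which `w_γ` is an `A_p` weight, every element of
`L^p(ℝ, w_γ; X)` is integrable against Schwartz functions.) -/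
def besselSubmodule (s p γ : ℝ) [Fact (1 < p)] : Submodule ℂ 𝓢'(ℝ, X) where
  carrier := {f | ∃ g : Lp X (ENNReal.ofReal p) (powerMeasure γ), IsInducedBy (bessel X s f) g}
  add_mem' := by
    rintro f₁ f₂ ⟨g₁, h₁⟩ ⟨g₂, h₂⟩
    refine ⟨g₁ + g₂, ?_⟩
    rw [map_add]
    exact h₁.add h₂ ((volume_absolutelyContinuous_powerMeasure γ).ae_le (Lp.coeFn_add g₁ g₂))
  zero_mem' := by
    refine ⟨0, ?_⟩
    rw [map_zero]
    exact IsInducedBy.zero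
      ((volume_absolutelyContinuous_powerMeasure γ).ae_le (Lp.coeFn_zero X _ _))
  smul_mem' := by
    rintro c f ⟨g, h⟩
    refine ⟨c • g, ?_⟩
    rw [map_smul]
    exact h.smul c ((volume_absolutelyContinuous_powerMeasure γ).ae_le (Lp.coeFn_smul c g))

variable (X) in
/-- The weighted Bessel potential space `H^{s,p}(ℝ, w_γ; X)`; it carries the norm
`‖f‖ = ‖𝒥_s f‖` of `L^p(ℝ, w_γ; X)`, see `BesselSpace.norm_eq`. -/
def BesselSpace (s p γ : ℝ) [Fact (1 < p)] : Type _ := ↥(besselSubmodule X s p γ)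

namespace BesselSpace

variable {s p γ : ℝ} [Fact (1 < p)]

instance : AddCommGroup (BesselSpace X s p γ) :=
  inferInstanceAs (AddCommGroup ↥(besselSubmodule X s p γ))

instance : Module ℂ (BesselSpace X s p γ) :=
  inferInstanceAs (Module ℂ ↥(besselSubmodule X s p γ))

/-- The inclusion of `H^{s,p}(ℝ, w_γ; X)` in the tempered distributions. -/
def toTempered : BesselSpace X s p γ →ₗ[ℂ] 𝓢'(ℝ, X) := (besselSubmodule X s p γ).subtype

theorem toTempered_injective :
    Function.Injective (toTempered : BesselSpace X s p γ →ₗ[ℂ] 𝓢'(ℝ, X)) :=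
  Subtype.val_injective

theorem exists_lp (f : BesselSpace X s p γ) :
    ∃ g : Lp X (ENNReal.ofReal p) (powerMeasure γ), IsInducedBy (bessel X s f.toTempered) g :=
  f.2

variable [CompleteSpace X]

theorem lp_unique {f : 𝓢'(ℝ, X)} {g₁ g₂ : Lp X (ENNReal.ofReal p) (powerMeasure γ)}
    (h₁ : IsInducedBy f g₁) (h₂ : IsInducedBy f g₂) : g₁ = g₂ := by
  have hac := volume_absolutelyContinuous_powerMeasure γ
  have h : IsInducedBy (f + (-1 : ℂ) • f) (fun x => g₁ x + (-1 : ℂ) • g₂ x) :=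
    h₁.add (h₂.smul (-1) (g := fun x => (-1 : ℂ) • g₂ x) (by rfl)) (by rfl)
  have h0 : f + (-1 : ℂ) • f = 0 := by simp
  rw [h0] at h
  refine Lp.ext ((powerMeasure_absolutelyContinuous_volume γ).ae_le ?_)
  filter_upwards [h.ae_eq_zero] with x hx
  have hx' : g₁ x + (-1 : ℂ) • g₂ x = 0 := hx
  simpa [add_neg_eq_zero] using hx'

/-- The linear map `f ↦ 𝒥_s f`, from `H^{s,p}(ℝ, w_γ; X)` to `L^p(ℝ, w_γ; X)`. -/
def toLp : BesselSpace X s p γ →ₗ[ℂ] Lp X (ENNReal.ofReal p) (powerMeasure γ) where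
  toFun f := f.exists_lp.choose
  map_add' f₁ f₂ := by
    refine lp_unique (f₁ + f₂).exists_lp.choose_spec ?_
    rw [map_add, map_add]
    exact f₁.exists_lp.choose_spec.add f₂.exists_lp.choose_spec
      ((volume_absolutelyContinuous_powerMeasure γ).ae_le (Lp.coeFn_add _ _))
  map_smul' c f := by
    refine lp_unique (c • f).exists_lp.choose_spec ?_
    rw [map_smul, map_smul]
    exact f.exists_lp.choose_spec.smul c
      ((volume_absolutelyContinuous_powerMeasure γ).ae_le (Lp.coeFn_smul c _))

theorem toLp_spec (f : BesselSpace X s p γ) :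
    IsInducedBy (bessel X s f.toTempered) f.toLp :=
  f.exists_lp.choose_spec

theorem toLp_injective : Function.Injective
    (toLp : BesselSpace X s p γ →ₗ[ℂ] Lp X (ENNReal.ofReal p) (powerMeasure γ)) := by
  intro f₁ f₂ h
  have h₁ := f₁.toLp_spec
  have h₂ := f₂.toLp_spec
  rw [h] at h₁
  refine toTempered_injective (bessel_injective s ?_)
  ext φ
  rw [(h₁ φ).2, (h₂ φ).2]

instance : NormedAddCommGroup (BesselSpace X s p γ) :=
  NormedAddCommGroup.induced _ _ toLp toLp_injective

instance : NormedSpace ℂ (BesselSpace X s p γ) :=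
  NormedSpace.induced ℂ _ _ (toLp : BesselSpace X s p γ →ₗ[ℂ] _)

theorem norm_eq (f : BesselSpace X s p γ) : ‖f‖ = ‖f.toLp‖ := rfl

end BesselSpace

/-! ### Restriction to an open set -/

/-- A real test function on the open set `Ω` as a (complex-valued) Schwartz function on `ℝ`. -/
def extendTestFun (Ω : Opens ℝ) (φ : 𝓓(Ω, ℝ)) : 𝓢(ℝ, ℂ) :=
  (show HasCompactSupport (fun x => (φ x : ℂ)) from
    φ.hasCompactSupport.comp_left (g := Complex.ofReal) Complex.ofReal_zero).toSchwartzMap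
      (Complex.ofRealCLM.contDiff.comp φ.contDiff)

theorem extendTestFun_apply (Ω : Opens ℝ) (φ : 𝓓(Ω, ℝ)) (x : ℝ) :
    extendTestFun Ω φ x = (φ x : ℂ) := rfl

/-- The inclusion of the test functions on the open set `Ω` in the Schwartz functions on `ℝ`. -/
def extendTest (Ω : Opens ℝ) : 𝓓(Ω, ℝ) →L[ℝ] 𝓢(ℝ, ℂ) :=
  TestFunction.mkCLM ℝ (extendTestFun Ω)
    (fun φ ψ => by
      ext x
      change ((φ x + ψ x : ℝ) : ℂ) = (φ x : ℂ) + (ψ x : ℂ)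
      push_cast
      rfl)
    (fun c φ => by
      ext x
      change ((c • φ x : ℝ) : ℂ) = c • (φ x : ℂ)
      simp)
    (fun K hK => by
      let Φ : 𝓓_{K}(ℝ, ℝ) →ₗ[ℝ] 𝓢(ℝ, ℂ) :=
        { toFun := extendTestFun Ω ∘ TestFunction.ofSupportedIn hK
          map_add' := fun φ ψ => by
            ext x
            change ((φ x + ψ x : ℝ) : ℂ) = (φ x : ℂ) + (ψ x : ℂ)
            push_cast
            rfl
          map_smul' := fun c φ => by
            ext x
            change ((c • φ x : ℝ) : ℂ) = c • (φ x : ℂ)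
            simp }
      change Continuous Φ
      obtain ⟨R, hR0, hR⟩ : ∃ R : ℝ, 0 ≤ R ∧ ∀ x ∈ (K : Set ℝ), ‖x‖ ≤ R := by
        obtain ⟨R, hR⟩ := K.isCompact.isBounded.exists_norm_le
        exact ⟨max R 0, le_max_right _ _, fun x hx => (hR x hx).trans (le_max_left _ _)⟩
      refine (ContDiffMapSupportedIn.withSeminorms ℝ ℝ ℝ ⊤ K).continuous_of_isBounded
        (schwartz_withSeminorms ℝ ℝ ℂ) Φ (.of_real fun n => ?_)
      refine ⟨{n.2}, R ^ n.1, fun φ => ?_⟩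
      rw [Finset.sup_singleton]
      change SchwartzMap.seminorm ℝ n.1 n.2 (Φ φ) ≤ R ^ n.1 * _
      refine SchwartzMap.seminorm_le_bound ℝ n.1 n.2 _
        (mul_nonneg (pow_nonneg hR0 _) (apply_nonneg _ _)) fun x => ?_
      have e : ‖iteratedFDeriv ℝ n.2 (Φ φ) x‖ = ‖iteratedFDeriv ℝ n.2 φ x‖ :=
        Complex.ofRealLI.norm_iteratedFDeriv_comp_left (f := φ) φ.contDiff.contDiffAt
          (mod_cast le_top)
      rw [e]
      by_cases hx : x ∈ K
      · gcongr
        · exact hR x hx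
        · exact ContDiffMapSupportedIn.norm_iteratedFDeriv_apply_le_seminorm_top ℝ
      · rw [φ.iteratedFDeriv_zero_on_compl hx]
        simp only [Pi.zero_apply, norm_zero, mul_zero]
        exact mul_nonneg (pow_nonneg hR0 _) (apply_nonneg _ _))

variable (X) in
/-- The restriction `f ↦ f|_Ω` of tempered distributions to the open set `Ω`:
`(f|_Ω) φ = f φ` for all test functions `φ` on `Ω`. -/
def restrictTo (Ω : Opens ℝ) : 𝓢'(ℝ, X) →ₗ[ℂ] 𝓓'(Ω, X) where
  toFun f :=
    { toFun := fun φ => f (extendTest Ω φ)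
      map_add' := fun φ ψ => by simp
      map_smul' := fun c φ => by
        have h : extendTest Ω (c • φ) = (c : ℂ) • extendTest Ω φ := by
          rw [map_smul]
          ext x
          simp
        rw [h, map_smul]
        simp
      cont := f.continuous.comp (extendTest Ω).continuous }
  map_add' f g := rfl
  map_smul' c f := rfl

theorem restrictTo_apply (Ω : Opens ℝ) (f : 𝓢'(ℝ, X)) (φ : 𝓓(Ω, ℝ)) :
    restrictTo X Ω f φ = f (extendTest Ω φ) := rfl

/-! ### The spaces `H^{s,p}(ℝ₊, w_γ; X)` -/

/-- The half line `ℝ₊ = (0, ∞)`. -/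
def halfLine : Opens ℝ := ⟨Set.Ioi 0, isOpen_Ioi⟩

variable (X) in
/-- The restriction map `f ↦ f|_{ℝ₊}` from `H^{s,p}(ℝ, w_γ; X)` to `𝓓'(ℝ₊; X)`. -/
def restrictHalfLine (s p γ : ℝ) [Fact (1 < p)] : BesselSpace X s p γ →ₗ[ℂ] 𝓓'(halfLine, X) :=
  restrictTo X halfLine ∘ₗ BesselSpace.toTempered

variable (X) in
/-- The space `H^{s,p}(ℝ₊, w_γ; X)` of the distributions on `ℝ₊` that are the restriction of an
element of `H^{s,p}(ℝ, w_γ; X)`; its norm is the infimum of the norms of the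
extensions, see `BesselSpaceHalf.norm_eq`. -/
def BesselSpaceHalf (s p γ : ℝ) [Fact (1 < p)] : Type _ :=
  ↥(LinearMap.range (restrictHalfLine X s p γ))

namespace BesselSpaceHalf

variable {s p γ : ℝ} [Fact (1 < p)]

instance : AddCommGroup (BesselSpaceHalf X s p γ) :=
  inferInstanceAs (AddCommGroup ↥(LinearMap.range (restrictHalfLine X s p γ)))

instance : Module ℂ (BesselSpaceHalf X s p γ) :=
  inferInstanceAs (Module ℂ ↥(LinearMap.range (restrictHalfLine X s p γ)))

/-- The inclusion of `H^{s,p}(ℝ₊, w_γ; X)` in the distributions on `ℝ₊`. -/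
def toDistribution : BesselSpaceHalf X s p γ →ₗ[ℂ] 𝓓'(halfLine, X) :=
  (LinearMap.range (restrictHalfLine X s p γ)).subtype

/-- The restriction map from `H^{s,p}(ℝ, w_γ; X)` onto `H^{s,p}(ℝ₊, w_γ; X)`. -/
def restrict : BesselSpace X s p γ →ₗ[ℂ] BesselSpaceHalf X s p γ :=
  (restrictHalfLine X s p γ).rangeRestrict

theorem restrict_surjective :
    Function.Surjective (restrict : BesselSpace X s p γ →ₗ[ℂ] BesselSpaceHalf X s p γ) :=
  LinearMap.surjective_rangeRestrict _

variable [CompleteSpace X]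

/-- The canonical isomorphism with the quotient by the kernel of the restriction map. -/
def toQuotient : BesselSpaceHalf X s p γ →ₗ[ℂ]
    BesselSpace X s p γ ⧸ LinearMap.ker (restrictHalfLine X s p γ) :=
  (restrictHalfLine X s p γ).quotKerEquivRange.symm.toLinearMap

theorem toQuotient_restrict (g : BesselSpace X s p γ) :
    (restrict g).toQuotient = Submodule.Quotient.mk g :=
  (LinearEquiv.symm_apply_eq _).mpr rfl

instance : SeminormedAddCommGroup (BesselSpaceHalf X s p γ) :=
  SeminormedAddCommGroup.induced _ _ (toQuotient (X := X) (s := s) (p := p) (γ := γ))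

instance : NormedSpace ℂ (BesselSpaceHalf X s p γ) :=
  NormedSpace.induced ℂ _ _ (toQuotient (X := X) (s := s) (p := p) (γ := γ))

theorem norm_eq (f : BesselSpaceHalf X s p γ) :
    ‖f‖ = sInf ((fun g : BesselSpace X s p γ => ‖g‖) '' {g | restrict g = f}) := by
  have h : {g : BesselSpace X s p γ | restrict g = f} =
      {g | (Submodule.Quotient.mk g : _ ⧸ LinearMap.ker (restrictHalfLine X s p γ)) =
        f.toQuotient} := by
    ext g
    simp only [Set.mem_ofPred_eq, ← toQuotient_restrict]
    exact (restrictHalfLine X s p γ).quotKerEquivRange.symm.injective.eq_iff.symm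
  have h' : ‖f‖ = Metric.infDist 0 {g : BesselSpace X s p γ |
      (Submodule.Quotient.mk g : _ ⧸ LinearMap.ker (restrictHalfLine X s p γ)) =
        f.toQuotient} := rfl
  rw [h', ← h, Metric.infDist_eq_iInf, sInf_image']
  simp

end BesselSpaceHalf

/-! ### Closures of the test functions -/

variable [CompleteSpace X]

variable (X) in
/-- `H^{s,p}_0(ℝ, w_γ; X)`: the closure of `C_c^∞(ℝ \ {0}; X)` in `H^{s,p}(ℝ, w_γ; X)`. -/
def besselZero (s p γ : ℝ) [Fact (1 < p)] : Set (BesselSpace X s p γ) :=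
  closure {f | ∃ φ : 𝓢(ℝ, X), HasCompactSupport φ ∧ tsupport φ ⊆ {0}ᶜ ∧
    f.toTempered = (φ : 𝓢'(ℝ, X))}

variable (X) in
/-- `H^{s,p}_0(ℝ₊, w_γ; X)`: the closure of `C_c^∞((0, ∞); X)` in `H^{s,p}(ℝ₊, w_γ; X)`. -/
def besselZeroHalf (s p γ : ℝ) [Fact (1 < p)] : Set (BesselSpaceHalf X s p γ) :=
  closure {f | ∃ φ : 𝓢(ℝ, X), HasCompactSupport φ ∧ tsupport φ ⊆ Set.Ioi 0 ∧
    f.toDistribution = restrictTo X halfLine (φ : 𝓢'(ℝ, X))}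

/-! ### Traces -/

/-- `T` is the continuous linear extension `Tr_k : H^{s,p}(ℝ, w_γ; X) → X^{k+1}` of the map
`f ↦ (f(0), f'(0), …, f^{(k)}(0))`, defined on `H^{s,p}(ℝ, w_γ; X) ∩ C^k(ℝ; X)`. For `k = -1` the
target is the trivial space, so that there is exactly one `T` and `T f = 0` always holds. -/
def IsTrace {s p γ : ℝ} [Fact (1 < p)] (k : ℤ)
    (T : BesselSpace X s p γ →L[ℂ] (Fin (k + 1).toNat → X)) : Prop :=
  ∀ (f : BesselSpace X s p γ) (u : ℝ → X), ContDiff ℝ k.toNat u →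
    IsLocallyInducedBy f.toTempered u →
    ∀ j : Fin (k + 1).toNat, T f j = iteratedDeriv j u 0

/-- `TPlus` is the operator `Tr_{k,+}` on `H^{s,p}(ℝ₊, w_γ; X)` that `T = Tr_k` gives rise to:
`Tr_{k,+} f = Tr_k g` whenever `g|_{ℝ₊} = f`. -/
def IsHalfLineTrace {s p γ : ℝ} [Fact (1 < p)] {k : ℤ}
    (T : BesselSpace X s p γ →L[ℂ] (Fin (k + 1).toNat → X))
    (TPlus : BesselSpaceHalf X s p γ →L[ℂ] (Fin (k + 1).toNat → X)) : Prop :=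
  ∀ (f : BesselSpaceHalf X s p γ) (g : BesselSpace X s p γ),
    BesselSpaceHalf.restrict g = f → TPlus f = T g

end WeightedBessel
end

/-!
# Traces on weighted Bessel potential spaces and density of test functions

Write `J_s = (1 - Δ) ^ (s / 2)` and `b = (1 + γ) / p`, so that dilating a function by `R` changes
its norm in `L^p(ℝ, |x| ^ γ; X)` by the factor `R ^ (-b)`. As `X` is an arbitrary Banach space,
only operators with explicit, absolutely integrable kernels can be controlled. All estimates come
from the subordination formula (`schwartzBessel_neg_apply`)
`J_{-σ} v = c_σ ∫₀^∞ r ^ (σ - 1) exp (-r ^ 2 / 2) (k_r ∗ v) dr`, `σ > 0`, where `k_r` is the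
`L¹`-normalised dilation of a Gaussian `k`. Since `-1 < γ < p - 1`, the Schur test with power
weights bounds the convolutions with `k_r` on `L^p(ℝ, |x| ^ γ; X)` uniformly in `r`
(`IsSchurKernel.exists_lintegral_rpow_le`). Three facts follow.

* `J_{-σ}` is bounded for `σ ≥ 0`, so that the spaces decrease in `s`
  (`exists_eLpNorm_schwartzBessel_neg_le`).
* `‖v^{(j)}(0)‖ ≤ C ‖J_s v‖` for Schwartz functions `v` if `s > j + b`: by Hölder's inequality the
  scale `r` contributes a multiple of `r ^ (s - 1 - j - b)`, which is integrable at zero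
  (`exists_enorm_iterate_schwartzDeriv_zero_le`).
* Splitting the integral at `r = τ` gives, for `0 < σ < 2`, the moment inequality
  `‖J_{2-σ} v‖ ≤ C (τ ^ σ ‖J_2 v‖ + τ ^ (σ - 2) ‖v‖)`
  (`exists_eLpNorm_schwartzBessel_two_sub_le`).

The Schwartz functions being dense, the second fact yields the trace operator `besselTrace`. That
it agrees with the derivatives of every element that is a `C^k` function is seen by mollification:
the evaluations `f ↦ (-1) ^ j f(ρ_ε^{(j)})` are uniformly bounded, because convolution with `ρ_ε`
commutes with `J_s`, and they converge on Schwartz functions, hence everywhere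
(`exists_norm_mollEval_sub_besselTrace_lt`). The mollifiers are supported in `(0, ∞)`, so the trace
depends on the restriction to `ℝ₊` only (`besselTrace_eq_zero_of_restrict_eq_zero`), and it factors
through `H^{s,p}(ℝ₊, w_γ; X)`.

For the description of the kernel, put `n = k + 1` and let `φ` be a Schwartz function whose
derivatives of order `< n` vanish at the origin. If `χ` is a cutoff function, then
`u_R = χ(R ·) φ` lives on `[-1 / R, 1 / R]` and its `i`-th derivative is `O(R ^ (i - n))`, so that
`‖J_{2m} u_R‖ = O(R ^ (2 m - n - b))`. The moment inequality with `τ = 1 / R` interpolates this to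
`‖J_t u_R‖ = O(R ^ (t - n - b))` for all `t ≥ 0` that are not even integers, and as `s < n + b`,
there is such a `t ≥ s` below `n + b` (`IsConcentrating.tendsto_eLpNorm`). Thus `φ` is a limit of
the functions `φ - u_R`, which vanish near the origin. A general element of the kernel is reached
by subtracting from approximating Schwartz functions a cut off Taylor polynomial with the same
derivatives at the origin (`besselZero_eq_ker_besselTrace`). The statement on the half line
follows, because the restriction to `ℝ₊` of a test function on `ℝ ∖ {0}` is a test function on
`ℝ₊` (`exists_test_halfLine`).
-/

noncomputable section

set_option linter.unusedSectionVars false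

namespace WeightedBessel

open Filter
open scoped NNReal FourierTransform Topology

/-! ### Convolution operators on weighted Lebesgue spaces -/

/-- The power weight `|x| ^ b` with values in `[0, ∞]`. At the origin it takes the value of
`Real.rpow` there, which is irrelevant up to null sets. -/
def powWeight (b x : ℝ) : ℝ≥0∞ := ENNReal.ofReal (|x| ^ b)

@[fun_prop]
theorem measurable_powWeight (b : ℝ) : Measurable (powWeight b) :=
  ENNReal.measurable_ofReal.comp ((measurable_norm (α := ℝ)).pow_const b)

theorem powWeight_neg (b x : ℝ) : powWeight b (-x) = powWeight b x := by simp [powWeight]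

theorem powWeight_ne_top (b x : ℝ) : powWeight b x ≠ ⊤ := ENNReal.ofReal_ne_top

theorem powWeight_mul (b c : ℝ) {x : ℝ} (hx : x ≠ 0) :
    powWeight b x * powWeight c x = powWeight (b + c) x := by
  rw [powWeight, powWeight, powWeight, ← ENNReal.ofReal_mul (by positivity),
    Real.rpow_add (abs_pos.mpr hx)]

theorem powWeight_rpow (b : ℝ) {c : ℝ} (hc : 0 ≤ c) (x : ℝ) :
    powWeight b x ^ c = powWeight (b * c) x := by
  rw [powWeight, powWeight, ENNReal.ofReal_rpow_of_nonneg (by positivity) hc,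
    Real.rpow_mul (abs_nonneg x)]

theorem powWeight_zero (x : ℝ) : powWeight 0 x = 1 := by simp [powWeight]

theorem powWeight_comp_mul (b r x : ℝ) :
    powWeight b (r * x) = ENNReal.ofReal (|r| ^ b) * powWeight b x := by
  rw [powWeight, powWeight, abs_mul, Real.mul_rpow (abs_nonneg _) (abs_nonneg _),
    ENNReal.ofReal_mul (by positivity)]

theorem ae_ne_zero : ∀ᵐ x : ℝ, x ≠ 0 := by simp [ae_iff]

theorem lintegral_powerMeasure {γ : ℝ} {F : ℝ → ℝ≥0∞} (hF : Measurable F) :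
    ∫⁻ x, F x ∂powerMeasure γ = ∫⁻ x, powWeight γ x * F x :=
  lintegral_withDensity_eq_lintegral_mul _ (measurable_powWeight γ) hF

theorem lintegral_comp_mul {f : ℝ → ℝ≥0∞} (hf : Measurable f) {r : ℝ} (hr : 0 < r) :
    ∫⁻ x, f (r * x) = ENNReal.ofReal r⁻¹ * ∫⁻ x, f x := by
  have h := Real.map_volume_mul_left hr.ne'
  rw [← lintegral_map hf (measurable_const_mul r), h, lintegral_smul_measure,
    abs_of_pos (inv_pos.mpr hr), smul_eq_mul]

theorem lintegral_powWeight_unit_lt_top {b : ℝ} (hb : -1 < b) :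
    ∫⁻ x in Set.Ioo (-1 : ℝ) 1, powWeight b x < ⊤ := by
  have h1 : ∫⁻ x in Set.Ioo (0 : ℝ) 1, powWeight b x < ⊤ := by
    have h := (intervalIntegral.intervalIntegrable_rpow' (a := 0) (b := 1) hb).1
    have h2 := h.lintegral_lt_top
    rw [restrict_Ioo_eq_restrict_Ioc]
    refine lt_of_le_of_lt (setLIntegral_mono' measurableSet_Ioc fun x hx => ?_) h2
    rw [powWeight, abs_of_pos hx.1]
  have h2 : ∫⁻ x in Set.Ioo (-1 : ℝ) 0, powWeight b x < ⊤ := by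
    rw [← lintegral_indicator measurableSet_Ioo,
      ← lintegral_neg_eq_self]
    rw [← lintegral_indicator measurableSet_Ioo] at h1
    refine lt_of_le_of_lt (lintegral_mono fun x => ?_) h1
    by_cases hx : x ∈ Set.Ioo (0 : ℝ) 1
    · rw [Set.indicator_of_mem hx]
      exact (Set.indicator_le_self _ _ _).trans (powWeight_neg b x).le
    · rw [Set.indicator_of_notMem hx, Set.indicator_of_notMem]
      intro h
      exact hx ⟨by linarith [h.2], by linarith [h.1]⟩
  have h3 : (Set.Ioo (-1 : ℝ) 1) ⊆ (Set.Ioo (-1 : ℝ) 0 ∪ Set.Ioo (0 : ℝ) 1) ∪ {0} := by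
    intro x hx
    rcases lt_trichotomy x 0 with h | h | h
    · exact Or.inl (Or.inl ⟨hx.1, h⟩)
    · exact Or.inr h
    · exact Or.inl (Or.inr ⟨h, hx.2⟩)
  refine lt_of_le_of_lt ((lintegral_mono_set h3).trans (lintegral_union_le _ _ _)) ?_
  refine ENNReal.add_lt_top.mpr ⟨(lintegral_union_le _ _ _).trans_lt
    (ENNReal.add_lt_top.mpr ⟨h2, h1⟩), ?_⟩
  simp

/-- The weight of an interval scales like a power of its length. -/
theorem lintegral_powWeight_Ioo (b : ℝ) {R : ℝ} (hR : 0 < R) :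
    ∫⁻ x in Set.Ioo (-R) R, powWeight b x =
      ENNReal.ofReal (R ^ (b + 1)) * ∫⁻ x in Set.Ioo (-1 : ℝ) 1, powWeight b x := by
  rw [← lintegral_indicator measurableSet_Ioo, ← lintegral_indicator measurableSet_Ioo]
  have hm := (measurable_powWeight b).indicator (measurableSet_Ioo (a := -R) (b := R))
  have h := lintegral_comp_mul hm hR
  have e : ∀ x, (Set.Ioo (-R) R).indicator (powWeight b) (R * x) =
      ENNReal.ofReal (R ^ b) * (Set.Ioo (-1 : ℝ) 1).indicator (powWeight b) x := by
    intro x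
    have hiff : R * x ∈ Set.Ioo (-R) R ↔ x ∈ Set.Ioo (-1 : ℝ) 1 := by
      simp only [Set.mem_Ioo]
      constructor
      · rintro ⟨h1, h2⟩
        constructor <;> nlinarith
      · rintro ⟨h1, h2⟩
        constructor <;> nlinarith
    by_cases hx : x ∈ Set.Ioo (-1 : ℝ) 1
    · rw [Set.indicator_of_mem (hiff.mpr hx), Set.indicator_of_mem hx, powWeight_comp_mul,
        abs_of_pos hR]
    · rw [Set.indicator_of_notMem (mt hiff.mp hx), Set.indicator_of_notMem hx, mul_zero]
  simp_rw [e] at h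
  rw [lintegral_const_mul _ ((measurable_powWeight b).indicator measurableSet_Ioo)] at h
  have h2 : ENNReal.ofReal R * ENNReal.ofReal R⁻¹ = 1 := by
    rw [← ENNReal.ofReal_mul hR.le, mul_inv_cancel₀ hR.ne', ENNReal.ofReal_one]
  calc ∫⁻ x, (Set.Ioo (-R) R).indicator (powWeight b) x
      = ENNReal.ofReal R * (ENNReal.ofReal R⁻¹ *
          ∫⁻ x, (Set.Ioo (-R) R).indicator (powWeight b) x) := by
        rw [← mul_assoc, h2, one_mul]
    _ = _ := by
        rw [← h, ← mul_assoc, ← ENNReal.ofReal_mul hR.le, Real.rpow_add hR, Real.rpow_one,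
          mul_comm R]

/-- A nonnegative kernel `K` of mass at most `C` with `|z| K(z) ≤ C`. Both conditions are
invariant under the dilations `K ↦ r⁻¹ K(· / r)`. -/
structure IsSchurKernel (C : ℝ≥0) (K : ℝ → ℝ≥0∞) : Prop where
  measurable : Measurable K
  lintegral_le : ∫⁻ z, K z ≤ C
  decay : ∀ z, ‖z‖ₑ * K z ≤ C

theorem IsSchurKernel.comp_neg {C : ℝ≥0} {K : ℝ → ℝ≥0∞} (h : IsSchurKernel C K) :
    IsSchurKernel C fun z => K (-z) where
  measurable := h.measurable.comp measurable_neg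
  lintegral_le := by
    rw [lintegral_neg_eq_self]
    exact h.lintegral_le
  decay z := by simpa using h.decay (-z)

/-- The weights `|x| ^ (-a)`, `0 ≤ a < 1`, are mapped below multiples of themselves by
convolution with Schur kernels (they are `A₁` weights). -/
theorem IsSchurKernel.exists_lintegral_mul_powWeight_le {a : ℝ} (ha : 0 ≤ a) (ha' : a < 1) :
    ∃ Ca : ℝ≥0, ∀ (C : ℝ≥0) (K : ℝ → ℝ≥0∞), IsSchurKernel C K → ∀ x : ℝ, x ≠ 0 →
      ∫⁻ y, K (x - y) * powWeight (-a) y ≤ Ca * C * powWeight (-a) x := by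
  set c := ∫⁻ x in Set.Ioo (-1 : ℝ) 1, powWeight (-a) x with hc
  have hc' : c ≠ ⊤ := (lintegral_powWeight_unit_lt_top (by linarith)).ne
  refine ⟨Real.toNNReal (2 ^ a) * (1 + c.toNNReal), fun C K hK x hx => ?_⟩
  have hx0 : 0 < |x| := abs_pos.mpr hx
  have hR : 0 < |x| / 2 := by positivity
  have key : ∀ y, y ≠ 0 → K (x - y) * powWeight (-a) y ≤
      ENNReal.ofReal (2 ^ a) * powWeight (-a) x * K (x - y) +
        (Set.Ioo (-(|x| / 2)) (|x| / 2)).indicator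
          (fun y => C * ENNReal.ofReal (2 / |x|) * powWeight (-a) y) y := by
    intro y hy
    by_cases hyx : y ∈ Set.Ioo (-(|x| / 2)) (|x| / 2)
    · rw [Set.indicator_of_mem hyx]
      refine le_add_of_nonneg_of_le zero_le ?_
      gcongr
      have h1 : |x| / 2 ≤ |x - y| := by
        have := abs_lt.mpr hyx
        have := abs_sub_abs_le_abs_sub x y
        linarith
      have h2 := hK.decay (x - y)
      have h3 : ENNReal.ofReal (|x| / 2) * K (x - y) ≤ C := by
        refine le_trans ?_ h2
        gcongr
        rw [← ofReal_norm, Real.norm_eq_abs]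
        exact ENNReal.ofReal_le_ofReal h1
      calc K (x - y) = ENNReal.ofReal (|x| / 2) * K (x - y) * ENNReal.ofReal (2 / |x|) := by
            rw [mul_right_comm, ← ENNReal.ofReal_mul hR.le]
            have : |x| / 2 * (2 / |x|) = 1 := by field_simp
            rw [this, ENNReal.ofReal_one, one_mul]
        _ ≤ _ := by gcongr
    · rw [Set.indicator_of_notMem hyx, add_zero, mul_comm (K _)]
      gcongr
      have h1 : |x| / 2 ≤ |y| := by
        rw [Set.mem_Ioo, ← abs_lt] at hyx
        exact not_lt.mp hyx
      rw [powWeight, powWeight, ← ENNReal.ofReal_mul (by positivity)]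
      refine ENNReal.ofReal_le_ofReal ?_
      calc |y| ^ (-a) ≤ (|x| / 2) ^ (-a) :=
            Real.rpow_le_rpow_of_nonpos hR h1 (by linarith)
        _ = 2 ^ a * |x| ^ (-a) := by
            rw [Real.div_rpow hx0.le (by norm_num), Real.rpow_neg (by norm_num : (0 : ℝ) ≤ 2)]
            field_simp
  calc ∫⁻ y, K (x - y) * powWeight (-a) y
      ≤ ∫⁻ y, (ENNReal.ofReal (2 ^ a) * powWeight (-a) x * K (x - y) +
        (Set.Ioo (-(|x| / 2)) (|x| / 2)).indicator
          (fun y => C * ENNReal.ofReal (2 / |x|) * powWeight (-a) y) y) :=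
        lintegral_mono_ae (ae_ne_zero.mono key)
    _ = ENNReal.ofReal (2 ^ a) * powWeight (-a) x * (∫⁻ y, K y) +
        C * ENNReal.ofReal (2 / |x|) * (ENNReal.ofReal ((|x| / 2) ^ (-a + 1)) * c) := by
        have hKm : Measurable fun y => K (x - y) :=
          hK.measurable.comp (measurable_const.sub measurable_id)
        rw [lintegral_add_left (hKm.const_mul _), lintegral_const_mul _ hKm,
          lintegral_sub_left_eq_self K x, lintegral_indicator measurableSet_Ioo,
          lintegral_const_mul _ (measurable_powWeight _), lintegral_powWeight_Ioo _ hR]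
    _ ≤ ENNReal.ofReal (2 ^ a) * powWeight (-a) x * C +
        C * ENNReal.ofReal (2 / |x|) * (ENNReal.ofReal ((|x| / 2) ^ (-a + 1)) * c) := by
        gcongr
        exact hK.lintegral_le
    _ = _ := by
        have e1 : ENNReal.ofReal (2 / |x|) * ENNReal.ofReal ((|x| / 2) ^ (-a + 1)) =
            ENNReal.ofReal (2 ^ a) * powWeight (-a) x := by
          rw [powWeight, ← ENNReal.ofReal_mul (by positivity), ← ENNReal.ofReal_mul (by positivity)]
          congr 1
          rw [Real.rpow_add hR, Real.rpow_one, Real.div_rpow hx0.le (by norm_num),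
            Real.rpow_neg (by norm_num : (0 : ℝ) ≤ 2)]
          field_simp
        calc _ = ENNReal.ofReal (2 ^ a) * powWeight (-a) x * C + C * c *
            (ENNReal.ofReal (2 / |x|) * ENNReal.ofReal ((|x| / 2) ^ (-a + 1))) := by ring
          _ = ENNReal.ofReal (2 ^ a) * powWeight (-a) x * C + C * c *
            (ENNReal.ofReal (2 ^ a) * powWeight (-a) x) := by rw [e1]
          _ = _ := by
            push_cast
            rw [ENNReal.coe_toNNReal hc', ENNReal.ofReal]
            ring

/-- Hölder's inequality for the factorisation `K F = (K^{1/p} F ω^{-1/q}) (K^{1/q} ω^{1/q})`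
with `ω = |y| ^ (-a)`. -/
theorem rpow_lintegral_mul_le {p : ℝ} (hp : 1 < p) (a : ℝ) {K F : ℝ → ℝ≥0∞}
    (hK : Measurable K) (hF : Measurable F) :
    (∫⁻ y, K y * F y) ^ p ≤ (∫⁻ y, K y * powWeight (-a) y) ^ (p - 1) *
      ∫⁻ y, K y * (F y ^ p * powWeight (a * (p - 1)) y) := by
  have hp0 : 0 < p := by linarith
  have hpq := Real.HolderConjugate.conjExponent hp
  set q := Real.conjExponent p with hq
  have hq0 : 0 < q := hpq.symm.pos
  have hpq' : p / q = p - 1 := by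
    have := hpq.div_conj_eq_sub_one
    exact this
  have hqp : 1 / p + 1 / q = 1 := by
    simpa using hpq.inv_add_inv_eq_one
  have h1 : ∫⁻ y, K y * F y = ∫⁻ y, ((fun y => K y ^ (1 / p) * F y * powWeight (a / q) y) *
      fun y => K y ^ (1 / q) * powWeight (-a / q) y) y := by
    refine lintegral_congr_ae (ae_ne_zero.mono fun y hy => ?_)
    have h2 : powWeight (a / q) y * powWeight (-a / q) y = 1 := by
      rw [powWeight_mul _ _ hy, neg_div, add_neg_cancel, powWeight_zero]
    have h3 : K y ^ (1 / p) * K y ^ (1 / q) = K y := by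
      rw [← ENNReal.rpow_add_of_nonneg _ _ (by positivity) (by positivity), hqp, ENNReal.rpow_one]
    calc K y * F y = (K y ^ (1 / p) * K y ^ (1 / q)) * F y *
          (powWeight (a / q) y * powWeight (-a / q) y) := by rw [h2, h3, mul_one]
      _ = _ := by
        simp only [Pi.mul_apply]
        ring
  have h4 := ENNReal.lintegral_mul_le_Lp_mul_Lq volume hpq
    (f := fun y => K y ^ (1 / p) * F y * powWeight (a / q) y)
    (g := fun y => K y ^ (1 / q) * powWeight (-a / q) y) (by fun_prop) (by fun_prop)
  rw [← h1] at h4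
  have h5 : ∀ y, (K y ^ (1 / p) * F y * powWeight (a / q) y) ^ p =
      K y * (F y ^ p * powWeight (a * (p - 1)) y) := by
    intro y
    rw [ENNReal.mul_rpow_of_nonneg _ _ hp0.le, ENNReal.mul_rpow_of_nonneg _ _ hp0.le,
      ← ENNReal.rpow_mul, one_div_mul_cancel hp0.ne', ENNReal.rpow_one, powWeight_rpow _ hp0.le,
      mul_assoc, ← hpq']
    congr 3
    ring
  have h6 : ∀ y, (K y ^ (1 / q) * powWeight (-a / q) y) ^ q = K y * powWeight (-a) y := by
    intro y
    rw [ENNReal.mul_rpow_of_nonneg _ _ hq0.le, ← ENNReal.rpow_mul, one_div_mul_cancel hq0.ne',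
      ENNReal.rpow_one, powWeight_rpow _ hq0.le, div_mul_cancel₀ _ hq0.ne']
  simp_rw [h5, h6] at h4
  calc (∫⁻ y, K y * F y) ^ p ≤ _ := ENNReal.rpow_le_rpow h4 hp0.le
    _ = _ := by
      rw [ENNReal.mul_rpow_of_nonneg _ _ hp0.le, ← ENNReal.rpow_mul, ← ENNReal.rpow_mul,
        one_div_mul_cancel hp0.ne', ENNReal.rpow_one, mul_comm, one_div_mul_eq_div, hpq']

/-- Convolution with Schur kernels is bounded on `L^p(ℝ, |x| ^ γ)` for `-1 < γ < p - 1`, by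
the Schur test with the weights `|x| ^ (-a)` and `|x| ^ (-b)`, where `γ = a (p - 1) - b`. -/
theorem IsSchurKernel.exists_lintegral_rpow_le {p γ : ℝ} (hp : 1 < p) (hγ : -1 < γ)
    (hγ' : γ < p - 1) :
    ∃ C₀ : ℝ≥0, ∀ (C : ℝ≥0) (K F : ℝ → ℝ≥0∞), IsSchurKernel C K → Measurable F →
      ∫⁻ x, (∫⁻ y, K (x - y) * F y) ^ p ∂powerMeasure γ ≤
        (C₀ * C) ^ p * ∫⁻ x, F x ^ p ∂powerMeasure γ := by
  have hp0 : 0 < p := by linarith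
  obtain ⟨a, b, ha, ha', hb, hb', hab⟩ : ∃ a b : ℝ, 0 ≤ a ∧ a < 1 ∧ 0 ≤ b ∧ b < 1 ∧
      γ = a * (p - 1) - b := by
    rcases le_total 0 γ with h | h
    · refine ⟨γ / (p - 1), 0, div_nonneg h (by linarith), ?_, le_rfl, one_pos, ?_⟩
      · rw [div_lt_one (by linarith)]
        exact hγ'
      · rw [div_mul_cancel₀ _ (by linarith), sub_zero]
    · exact ⟨0, -γ, le_rfl, one_pos, by linarith, by linarith, by ring⟩
  obtain ⟨Ca, hCa⟩ := exists_lintegral_mul_powWeight_le ha ha'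
  obtain ⟨Cb, hCb⟩ := exists_lintegral_mul_powWeight_le hb hb'
  refine ⟨(Ca ^ (p - 1) * Cb) ^ (1 / p), fun C K F hK hF => ?_⟩
  have hKm : Measurable fun z : ℝ × ℝ => K (z.1 - z.2) :=
    hK.measurable.comp (measurable_fst.sub measurable_snd)
  have hFm : Measurable fun y => F y ^ p * powWeight (a * (p - 1)) y := by fun_prop
  have m1 : Measurable fun x => ∫⁻ y, K (x - y) * F y :=
    (hKm.mul (hF.comp measurable_snd)).lintegral_prod_right'
  rw [lintegral_powerMeasure (m1.pow_const p), lintegral_powerMeasure (hF.pow_const p)]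
  have step : ∀ x, x ≠ 0 → powWeight γ x * (∫⁻ y, K (x - y) * F y) ^ p ≤
      ((Ca * C : ℝ≥0) : ℝ≥0∞) ^ (p - 1) * ∫⁻ y, powWeight (-b) x *
        (K (x - y) * (F y ^ p * powWeight (a * (p - 1)) y)) := by
    intro x hx
    have h1 := rpow_lintegral_mul_le hp a (K := fun y => K (x - y))
      (hK.measurable.comp (measurable_const.sub measurable_id)) hF
    have h2 := hCa C K hK x hx
    rw [lintegral_const_mul' _ _ (powWeight_ne_top _ _)]
    calc powWeight γ x * (∫⁻ y, K (x - y) * F y) ^ p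
        ≤ powWeight γ x * ((Ca * C * powWeight (-a) x) ^ (p - 1) *
          ∫⁻ y, K (x - y) * (F y ^ p * powWeight (a * (p - 1)) y)) := by
          gcongr
          exact h1.trans (by gcongr)
      _ = _ := by
        rw [ENNReal.mul_rpow_of_nonneg _ _ (by linarith), powWeight_rpow _ (by linarith)]
        have h3 : powWeight γ x * powWeight (-a * (p - 1)) x = powWeight (-b) x := by
          rw [powWeight_mul _ _ hx]
          congr 1
          rw [hab]
          ring
        rw [← h3]
        push_cast
        ring
  calc ∫⁻ x, powWeight γ x * (∫⁻ y, K (x - y) * F y) ^ p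
      ≤ ∫⁻ x, ((Ca * C : ℝ≥0) : ℝ≥0∞) ^ (p - 1) * ∫⁻ y, powWeight (-b) x *
        (K (x - y) * (F y ^ p * powWeight (a * (p - 1)) y)) :=
        lintegral_mono_ae (ae_ne_zero.mono step)
    _ = ((Ca * C : ℝ≥0) : ℝ≥0∞) ^ (p - 1) * ∫⁻ y, ∫⁻ x, powWeight (-b) x *
        (K (x - y) * (F y ^ p * powWeight (a * (p - 1)) y)) := by
        rw [lintegral_const_mul' _ _ (ENNReal.rpow_ne_top_of_nonneg (by linarith)
          ENNReal.coe_ne_top), lintegral_lintegral_swap]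
        refine Measurable.aemeasurable ?_
        exact ((measurable_powWeight _).comp measurable_fst).mul
          (hKm.mul (hFm.comp measurable_snd))
    _ ≤ ((Ca * C : ℝ≥0) : ℝ≥0∞) ^ (p - 1) * ∫⁻ y, (Cb * C : ℝ≥0) *
          (powWeight γ y * F y ^ p) := by
        gcongr 1
        refine lintegral_mono_ae (ae_ne_zero.mono fun y hy => ?_)
        have h4 := hCb C _ hK.comp_neg y hy
        simp only [neg_sub] at h4
        calc ∫⁻ x, powWeight (-b) x * (K (x - y) * (F y ^ p * powWeight (a * (p - 1)) y))
            = (∫⁻ x, K (x - y) * powWeight (-b) x) *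
                (F y ^ p * powWeight (a * (p - 1)) y) := by
              rw [← lintegral_mul_const _ (by
                exact (hK.measurable.comp (measurable_id.sub_const y)).mul
                  (measurable_powWeight _))]
              refine lintegral_congr fun x => ?_
              ring
          _ ≤ (Cb * C * powWeight (-b) y) * (F y ^ p * powWeight (a * (p - 1)) y) := by gcongr
          _ = _ := by
            have h3 : powWeight γ y = powWeight (-b) y * powWeight (a * (p - 1)) y := by
              rw [powWeight_mul _ _ hy]
              congr 1
              rw [hab]
              ring
            rw [h3]
            push_cast
            ring
    _ = _ := by
        rw [lintegral_const_mul' _ _ ENNReal.coe_ne_top, ← mul_assoc]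
        congr 1
        rw [← ENNReal.coe_rpow_of_nonneg _ (by linarith), ← ENNReal.coe_mul, ← ENNReal.coe_mul,
          ← ENNReal.coe_rpow_of_nonneg _ hp0.le]
        congr 1
        rw [NNReal.mul_rpow, NNReal.mul_rpow, ← NNReal.rpow_mul, one_div_mul_cancel hp0.ne',
          NNReal.rpow_one]
        have : C ^ p = C ^ (p - 1) * C := by
          rw [← NNReal.rpow_add_one' (by linarith)]
          congr 1
          ring
        rw [this]
        ring

theorem IsSchurKernel.exists_eLpNorm_le {p γ : ℝ} (hp : 1 < p) (hγ : -1 < γ)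
    (hγ' : γ < p - 1) :
    ∃ C₀ : ℝ≥0, ∀ (C : ℝ≥0) (K G H : ℝ → ℝ≥0∞), IsSchurKernel C K → Measurable H →
      (∀ x, G x ≤ ∫⁻ y, K (x - y) * H y) →
      eLpNorm G (ENNReal.ofReal p) (powerMeasure γ) ≤
        C₀ * C * eLpNorm H (ENNReal.ofReal p) (powerMeasure γ) := by
  have hp0 : 0 < p := by linarith
  obtain ⟨C₀, h⟩ := IsSchurKernel.exists_lintegral_rpow_le hp hγ hγ'
  refine ⟨C₀, fun C K G H hK hH hG => ?_⟩
  rw [eLpNorm_eq_lintegral_rpow_enorm_toReal (by simpa using hp0) ENNReal.ofReal_ne_top,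
    eLpNorm_eq_lintegral_rpow_enorm_toReal (by simpa using hp0) ENNReal.ofReal_ne_top,
    ENNReal.toReal_ofReal hp0.le]
  simp only [enorm_eq_self]
  have h2 : ∫⁻ x, G x ^ p ∂powerMeasure γ ≤ (C₀ * C) ^ p * ∫⁻ x, H x ^ p ∂powerMeasure γ :=
    (lintegral_mono fun x => ENNReal.rpow_le_rpow (hG x) hp0.le).trans (h C K H hK hH)
  calc _ ≤ ((C₀ * C) ^ p * ∫⁻ x, H x ^ p ∂powerMeasure γ) ^ (1 / p) :=
        ENNReal.rpow_le_rpow h2 (by positivity)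
    _ = _ := by
      rw [ENNReal.mul_rpow_of_nonneg _ _ (by positivity), ← ENNReal.rpow_mul,
        mul_one_div_cancel hp0.ne', ENNReal.rpow_one]

/-- The `L¹`-normalised dilation `r⁻¹ |k(z / r)|` of a scalar kernel. -/
def dilation (k : ℝ → ℂ) (r z : ℝ) : ℝ≥0∞ := ‖r⁻¹‖ₑ * ‖k (r⁻¹ * z)‖ₑ

theorem measurable_dilation {k : ℝ → ℂ} (hk : Measurable k) :
    Measurable fun q : ℝ × ℝ => dilation k q.1 q.2 := by
  unfold dilation
  fun_prop

theorem exists_isSchurKernel_dilation (k : 𝓢(ℝ, ℂ)) :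
    ∃ C : ℝ≥0, ∀ r : ℝ, 0 < r → IsSchurKernel C (dilation k r) := by
  obtain ⟨M, hM⟩ : ∃ M : ℝ≥0, ∀ z, ‖z‖ₑ * ‖k z‖ₑ ≤ M := by
    refine ⟨(SchwartzMap.seminorm ℝ 1 0 k).toNNReal, fun z => ?_⟩
    have h := SchwartzMap.norm_pow_mul_le_seminorm ℝ k 1 z
    rw [pow_one] at h
    rw [← ofReal_norm, ← ofReal_norm, ← ENNReal.ofReal_mul (norm_nonneg _)]
    exact ENNReal.ofReal_le_ofReal h
  have hI : ∫⁻ z, ‖k z‖ₑ < ⊤ := (k.integrable (μ := volume)).2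
  refine ⟨max M (∫⁻ z, ‖k z‖ₑ).toNNReal, fun r hr => ⟨?_, ?_, fun z => ?_⟩⟩
  · exact (measurable_dilation k.continuous.measurable).comp (measurable_const.prodMk measurable_id)
  · have hk : Measurable k := k.continuous.measurable
    simp only [dilation]
    rw [lintegral_const_mul _ (by fun_prop), lintegral_comp_mul (f := fun z => ‖k z‖ₑ)
      (by fun_prop) (inv_pos.mpr hr), inv_inv, ← mul_assoc, ← ofReal_norm, Real.norm_eq_abs,
      abs_of_pos (inv_pos.mpr hr), ← ENNReal.ofReal_mul (inv_pos.mpr hr).le,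
      inv_mul_cancel₀ hr.ne', ENNReal.ofReal_one, one_mul]
    rw [ENNReal.coe_max, ENNReal.coe_toNNReal hI.ne]
    exact le_max_right _ _
  · rw [dilation, ← mul_assoc, mul_comm ‖z‖ₑ, ← enorm_mul]
    exact (hM _).trans (by simp)

/-- Averages of the dilations of a Schwartz function are Schur kernels. -/
theorem exists_isSchurKernel_lintegral_dilation (k : 𝓢(ℝ, ℂ)) :
    ∃ C : ℝ≥0, ∀ (A : ℝ≥0) (a : ℝ → ℝ≥0∞), Measurable a → ∫⁻ r in Set.Ioi 0, a r ≤ A →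
      IsSchurKernel (C * A) fun z => ∫⁻ r in Set.Ioi 0, a r * dilation k r z := by
  obtain ⟨C, hC⟩ := exists_isSchurKernel_dilation k
  have hk := measurable_dilation k.continuous.measurable
  refine ⟨C, fun A a ha hA => ⟨?_, ?_, fun z => ?_⟩⟩
  · exact ((ha.comp measurable_snd).mul (hk.comp measurable_swap)).lintegral_prod_right'
      (f := fun q : ℝ × ℝ => a q.2 * dilation k q.2 q.1)
  · rw [lintegral_lintegral_swap (by
      exact ((ha.comp measurable_snd).mul (hk.comp measurable_swap)).aemeasurable)]
    calc ∫⁻ r in Set.Ioi 0, ∫⁻ z, a r * dilation k r z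
        ≤ ∫⁻ r in Set.Ioi 0, C * a r := by
          refine setLIntegral_mono' measurableSet_Ioi fun r hr => ?_
          rw [lintegral_const_mul _ (hC r hr).measurable, mul_comm]
          gcongr
          exact (hC r hr).lintegral_le
      _ ≤ _ := by
          rw [lintegral_const_mul _ ha, ENNReal.coe_mul]
          gcongr
  · rw [← lintegral_const_mul' _ _ enorm_ne_top]
    calc ∫⁻ r in Set.Ioi 0, ‖z‖ₑ * (a r * dilation k r z)
        ≤ ∫⁻ r in Set.Ioi 0, C * a r := by
          refine setLIntegral_mono' measurableSet_Ioi fun r hr => ?_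
          rw [mul_left_comm, mul_comm _ (a r)]
          gcongr
          exact (hC r hr).decay z
      _ ≤ _ := by
          rw [lintegral_const_mul _ ha, ENNReal.coe_mul]
          gcongr

/-! ### The weighted measure and Schwartz functions -/

theorem isFiniteMeasureOnCompacts_powerMeasure {γ : ℝ} (hγ : -1 < γ) :
    IsFiniteMeasureOnCompacts (powerMeasure γ) := by
  refine ⟨fun K hK => ?_⟩
  obtain ⟨R, hR⟩ := hK.isBounded.subset_ball (0 : ℝ)
  have h1 : K ⊆ Set.Ioo (-max R 1) (max R 1) := by
    intro x hx
    have := hR hx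
    rw [mem_ball_zero_iff, Real.norm_eq_abs] at this
    exact abs_lt.mp (this.trans_le (le_max_left _ _))
  refine (measure_mono h1).trans_lt ?_
  rw [powerMeasure, withDensity_apply _ measurableSet_Ioo]
  change ∫⁻ x in _, powWeight γ x < ⊤
  rw [lintegral_powWeight_Ioo γ (by positivity)]
  exact ENNReal.mul_lt_top ENNReal.ofReal_lt_top (lintegral_powWeight_unit_lt_top hγ)

theorem hasTemperateGrowth_powerMeasure {γ : ℝ} (hγ : -1 < γ) :
    (powerMeasure γ).HasTemperateGrowth := by
  obtain ⟨n, hn⟩ := exists_nat_ge (|γ| + 2)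
  have hm : Measurable fun x : ℝ => (1 + ‖x‖) ^ (-(n : ℝ)) := by fun_prop
  refine ⟨⟨n, hm.aestronglyMeasurable, ?_⟩⟩
  rw [HasFiniteIntegral, lintegral_powerMeasure (by fun_prop)]
  have hI : ∫⁻ x : ℝ, ‖(1 + ‖x‖) ^ (-(2 : ℝ))‖ₑ < ⊤ :=
    (integrable_one_add_norm (μ := (volume : Measure ℝ)) (r := 2) (by simp)).2
  have h0 := lintegral_powWeight_unit_lt_top hγ
  rw [← lintegral_indicator measurableSet_Ioo] at h0
  refine lt_of_le_of_lt (lintegral_mono fun x => ?_)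
    ((lintegral_add_left ((measurable_powWeight γ).indicator measurableSet_Ioo) _).trans_lt
      (ENNReal.add_lt_top.mpr ⟨h0, hI⟩))
  have hx1 : 1 ≤ 1 + ‖x‖ := by simp
  by_cases hx : x ∈ Set.Ioo (-1 : ℝ) 1
  · refine le_add_of_le_of_nonneg ?_ zero_le
    rw [Set.indicator_of_mem hx]
    refine mul_le_of_le_one_right zero_le ?_
    rw [Real.enorm_eq_ofReal (by positivity)]
    refine ENNReal.ofReal_le_one.mpr (Real.rpow_le_one_of_one_le_of_nonpos hx1 (by simp))
  · refine le_add_of_nonneg_of_le zero_le ?_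
    have hx' : 1 ≤ |x| := by
      rw [Set.mem_Ioo, ← abs_lt] at hx
      exact not_lt.mp hx
    rw [Real.enorm_eq_ofReal (by positivity), Real.enorm_eq_ofReal (by positivity), powWeight,
      ← ENNReal.ofReal_mul (by positivity)]
    refine ENNReal.ofReal_le_ofReal ?_
    have h1 : |x| ^ γ ≤ (1 + ‖x‖) ^ |γ| :=
      (Real.rpow_le_rpow_of_exponent_le hx' (le_abs_self γ)).trans
        (Real.rpow_le_rpow (abs_nonneg _) (by simp) (abs_nonneg _))
    calc |x| ^ γ * (1 + ‖x‖) ^ (-(n : ℝ)) ≤ (1 + ‖x‖) ^ |γ| * (1 + ‖x‖) ^ (-(n : ℝ)) := by gcongr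
      _ = (1 + ‖x‖) ^ (|γ| - n) := by
        rw [← Real.rpow_add (by positivity), sub_eq_add_neg]
      _ ≤ _ := Real.rpow_le_rpow_of_exponent_le hx1 (by linarith)

/-- Hölder's inequality for `L^p(ℝ, |x| ^ γ)` against the dilations of a Schwartz function. -/
theorem exists_lintegral_dilation_mul_le {p γ : ℝ} (hp : 1 < p) (hγ' : γ < p - 1) (k : 𝓢(ℝ, ℂ)) :
    ∃ C : ℝ≥0, ∀ (r : ℝ) (G : ℝ → ℝ≥0∞), 0 < r → Measurable G →
      ∫⁻ y, dilation k r y * G y ≤ C * ENNReal.ofReal (r ^ (-((1 + γ) / p))) *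
        (∫⁻ y, G y ^ p ∂powerMeasure γ) ^ (1 / p) := by
  have hp0 : 0 < p := by linarith
  have hpq := Real.HolderConjugate.conjExponent hp
  set q := Real.conjExponent p with hq
  have hq0 : 0 < q := hpq.symm.pos
  have hqp : 1 / p + 1 / q = 1 := by
    simpa using hpq.inv_add_inv_eq_one
  have hpq' : q / p = 1 / (p - 1) := by
    have : p / q = p - 1 := hpq.div_conj_eq_sub_one
    rw [← this, one_div_div]
  have hb : -1 < -γ / p * q := by
    have : -γ / p * q = -(γ / (p - 1)) := by
      rw [div_mul_eq_mul_div, mul_div_assoc, hpq']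
      ring
    rw [this, neg_lt_neg_iff, div_lt_one (by linarith)]
    exact hγ'
  set I := ∫⁻ y, ‖k y‖ₑ ^ q * powWeight (-γ / p * q) y with hI
  have hI' : I ≠ ⊤ := by
    have := hasTemperateGrowth_powerMeasure hb
    have h := k.eLpNorm_lt_top (ENNReal.ofReal q) (powerMeasure (-γ / p * q))
    have h2 := lintegral_rpow_enorm_lt_top_of_eLpNorm_lt_top (by simpa using hq0)
      ENNReal.ofReal_ne_top h
    rw [ENNReal.toReal_ofReal hq0.le, lintegral_powerMeasure (by fun_prop)] at h2
    simp_rw [hI, mul_comm (‖k _‖ₑ ^ q)]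
    exact h2.ne
  refine ⟨(I ^ (1 / q)).toNNReal, fun r G hr hG => ?_⟩
  have hI2 : I ^ (1 / q) ≠ ⊤ := ENNReal.rpow_ne_top_of_nonneg (by positivity) hI'
  have hd : Measurable (dilation k r) :=
    (measurable_dilation k.continuous.measurable).comp (measurable_const.prodMk measurable_id)
  have h1 : ∫⁻ y, dilation k r y * G y =
      ∫⁻ y, ((fun y => powWeight (γ / p) y * G y) *
        fun y => dilation k r y * powWeight (-γ / p) y) y := by
    refine lintegral_congr_ae (ae_ne_zero.mono fun y hy => ?_)
    have h2 : powWeight (γ / p) y * powWeight (-γ / p) y = 1 := by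
      rw [powWeight_mul _ _ hy, neg_div, add_neg_cancel, powWeight_zero]
    calc dilation k r y * G y = (powWeight (γ / p) y * powWeight (-γ / p) y) *
        (dilation k r y * G y) := by rw [h2, one_mul]
      _ = _ := by
        simp only [Pi.mul_apply]
        ring
  have h4 := ENNReal.lintegral_mul_le_Lp_mul_Lq volume hpq
    (f := fun y => powWeight (γ / p) y * G y)
    (g := fun y => dilation k r y * powWeight (-γ / p) y) (by fun_prop) (by fun_prop)
  rw [← h1] at h4
  have h5 : ∫⁻ y, (powWeight (γ / p) y * G y) ^ p = ∫⁻ y, G y ^ p ∂powerMeasure γ := by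
    rw [lintegral_powerMeasure (by fun_prop)]
    refine lintegral_congr fun y => ?_
    rw [ENNReal.mul_rpow_of_nonneg _ _ hp0.le, powWeight_rpow _ hp0.le,
      div_mul_cancel₀ _ hp0.ne']
  have h6 : ∫⁻ y, (dilation k r y * powWeight (-γ / p) y) ^ q =
      ENNReal.ofReal (r ^ (-((1 + γ) / p) * q)) * I := by
    have e : ∀ y, (dilation k r y * powWeight (-γ / p) y) ^ q =
        ENNReal.ofReal (r⁻¹ ^ q * r ^ (-γ / p * q)) *
          (fun y => ‖k y‖ₑ ^ q * powWeight (-γ / p * q) y) (r⁻¹ * y) := by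
      intro y
      have e1 : powWeight (-γ / p * q) y =
          ENNReal.ofReal (r ^ (-γ / p * q)) * powWeight (-γ / p * q) (r⁻¹ * y) := by
        have := powWeight_comp_mul (-γ / p * q) r (r⁻¹ * y)
        rwa [mul_inv_cancel_left₀ hr.ne', abs_of_pos hr] at this
      rw [ENNReal.mul_rpow_of_nonneg _ _ hq0.le, powWeight_rpow _ hq0.le, e1, dilation,
        ENNReal.mul_rpow_of_nonneg _ _ hq0.le, ENNReal.ofReal_mul (by positivity),
        ← ENNReal.ofReal_rpow_of_nonneg (by positivity) hq0.le, ← ofReal_norm r⁻¹,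
        Real.norm_of_nonneg (inv_pos.mpr hr).le]
      ring
    simp_rw [e]
    rw [lintegral_const_mul' _ _ ENNReal.ofReal_ne_top,
      lintegral_comp_mul (f := fun y => ‖k y‖ₑ ^ q * powWeight (-γ / p * q) y) (by fun_prop)
        (inv_pos.mpr hr), ← mul_assoc, inv_inv, ← ENNReal.ofReal_mul (by positivity)]
    congr 2
    rw [← Real.rpow_neg_one, ← Real.rpow_mul hr.le, ← Real.rpow_add hr]
    nth_rewrite 2 [← Real.rpow_one r]
    rw [← Real.rpow_add hr]
    congr 1
    have : q * (1 / p + 1 / q) = q := by rw [hqp, mul_one]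
    field_simp at this ⊢
    linear_combination this
  calc _ ≤ _ := h4
    _ = _ := by
      rw [h5, h6, ENNReal.mul_rpow_of_nonneg _ _ (by positivity),
        ENNReal.ofReal_rpow_of_nonneg (by positivity) (by positivity), ← Real.rpow_mul hr.le,
        mul_assoc _ q, mul_one_div_cancel hq0.ne', mul_one, ENNReal.coe_toNNReal hI2]
      ring

section

variable {X : Type*} [NormedAddCommGroup X] [NormedSpace ℂ X]

/-! ### The Gaussian and its dilations as Fourier multipliers -/

theorem exists_abs_pow_mul_exp_neg_sq_le (n : ℕ) :
    ∃ C : ℝ, ∀ x : ℝ, |x| ^ n * Real.exp (-(x ^ 2 / 2)) ≤ C := by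
  refine ⟨1 + 2 ^ n * n.factorial, fun x => ?_⟩
  have h1 : |x| ^ n ≤ 1 + |x| ^ (2 * n) := by
    rcases le_total |x| 1 with h | h
    · have := pow_le_one₀ (n := n) (abs_nonneg x) h
      have : 0 ≤ |x| ^ (2 * n) := by positivity
      linarith
    · have := pow_le_pow_right₀ h (show n ≤ 2 * n by omega)
      linarith
  have h2 := Real.pow_div_factorial_le_exp (x ^ 2 / 2) (by positivity) n
  have h3 : |x| ^ (2 * n) ≤ 2 ^ n * n.factorial * Real.exp (x ^ 2 / 2) := by
    rw [pow_mul, sq_abs]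
    have h4 : (x ^ 2) ^ n = 2 ^ n * n.factorial * ((x ^ 2 / 2) ^ n / n.factorial) := by
      rw [div_pow]
      have : (n.factorial : ℝ) ≠ 0 := by positivity
      field_simp
    rw [h4]
    gcongr
  have h5 : Real.exp (x ^ 2 / 2) * Real.exp (-(x ^ 2 / 2)) = 1 := by
    rw [← Real.exp_add, add_neg_cancel, Real.exp_zero]
  have h6 : Real.exp (-(x ^ 2 / 2)) ≤ 1 := Real.exp_le_one_iff.mpr (by nlinarith [sq_nonneg x])
  calc |x| ^ n * Real.exp (-(x ^ 2 / 2))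
      ≤ (1 + 2 ^ n * n.factorial * Real.exp (x ^ 2 / 2)) * Real.exp (-(x ^ 2 / 2)) := by
        gcongr
        linarith
    _ = Real.exp (-(x ^ 2 / 2)) +
        2 ^ n * n.factorial * (Real.exp (x ^ 2 / 2) * Real.exp (-(x ^ 2 / 2))) := by ring
    _ ≤ _ := by
        rw [h5, mul_one]
        linarith

/-- The Gaussian `exp (- x ^ 2 / 2)` as a Schwartz function; its derivatives are given by the
Hermite polynomials. -/
def gaussian : 𝓢(ℝ, ℂ) where
  toFun x := (Real.exp (-(x ^ 2 / 2)) : ℂ)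
  smooth' := by
    have h : ContDiff ℝ ∞ fun y : ℝ => Real.exp (-(y ^ 2 / 2)) := by fun_prop
    exact Complex.ofRealCLM.contDiff.comp h
  decay' k n := by
    have hsm : ContDiff ℝ ∞ fun y : ℝ => Real.exp (-(y ^ 2 / 2)) := by fun_prop
    have hterm : ∀ i : ℕ, ∃ C : ℝ, ∀ x : ℝ, |x| ^ (k + i) * Real.exp (-(x ^ 2 / 2)) ≤ C :=
      fun i => exists_abs_pow_mul_exp_neg_sq_le (k + i)
    choose C hC using hterm
    refine ⟨∑ i ∈ Finset.range ((Polynomial.hermite n).natDegree + 1),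
      |(((Polynomial.hermite n).coeff i : ℤ) : ℝ)| * C i, fun x => ?_⟩
    have e1 : ‖iteratedFDeriv ℝ n (fun y : ℝ => (Real.exp (-(y ^ 2 / 2)) : ℂ)) x‖ =
        ‖iteratedFDeriv ℝ n (fun y : ℝ => Real.exp (-(y ^ 2 / 2))) x‖ :=
      Complex.ofRealLI.norm_iteratedFDeriv_comp_left
        (f := fun y : ℝ => Real.exp (-(y ^ 2 / 2))) hsm.contDiffAt (mod_cast le_top)
    rw [e1, norm_iteratedFDeriv_eq_norm_iteratedDeriv, iteratedDeriv_eq_iterate,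
      Polynomial.deriv_gaussian_eq_hermite_mul_gaussian, norm_mul, norm_mul, norm_pow, norm_neg,
      norm_one, one_pow, one_mul, Polynomial.aeval_eq_sum_range, Real.norm_of_nonneg
        (Real.exp_nonneg _), Real.norm_eq_abs]
    calc |x| ^ k * (‖∑ i ∈ Finset.range ((Polynomial.hermite n).natDegree + 1),
          (Polynomial.hermite n).coeff i • x ^ i‖ * Real.exp (-(x ^ 2 / 2)))
        ≤ |x| ^ k * ((∑ i ∈ Finset.range ((Polynomial.hermite n).natDegree + 1),
          |(((Polynomial.hermite n).coeff i : ℤ) : ℝ)| * |x| ^ i) * Real.exp (-(x ^ 2 / 2))) := by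
          gcongr
          refine (norm_sum_le _ _).trans (Finset.sum_le_sum fun i _ => ?_)
          rw [zsmul_eq_mul, norm_mul, norm_pow, Real.norm_eq_abs, Real.norm_eq_abs]
      _ = ∑ i ∈ Finset.range ((Polynomial.hermite n).natDegree + 1),
          |(((Polynomial.hermite n).coeff i : ℤ) : ℝ)| *
            (|x| ^ (k + i) * Real.exp (-(x ^ 2 / 2))) := by
          rw [Finset.sum_mul, Finset.mul_sum]
          refine Finset.sum_congr rfl fun i _ => ?_
          rw [pow_add]
          ring
      _ ≤ _ := by
          gcongr
          exact hC _ _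

theorem gaussian_apply (x : ℝ) : gaussian x = (Real.exp (-(x ^ 2 / 2)) : ℂ) := rfl

/-- Multiplication by a nonzero real number as a continuous linear automorphism of `ℝ`. -/
def mulEquiv {r : ℝ} (hr : r ≠ 0) : ℝ ≃L[ℝ] ℝ :=
  ContinuousLinearEquiv.unitsEquivAut ℝ (Units.mk0 r hr)

theorem mulEquiv_apply {r : ℝ} (hr : r ≠ 0) (x : ℝ) : mulEquiv hr x = r * x := by
  simp [mulEquiv, mul_comm]

/-- The function `k₀` with Fourier transform `exp (- (2 π ξ) ^ 2 / 2)`. -/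
def heatKernel : 𝓢(ℝ, ℂ) :=
  𝓕⁻ (SchwartzMap.compCLMOfContinuousLinearEquiv ℂ (mulEquiv Real.two_pi_pos.ne') gaussian)

theorem fourier_heatKernel (ξ : ℝ) :
    𝓕 heatKernel ξ = (Real.exp (-((2 * Real.pi * ξ) ^ 2 / 2)) : ℂ) := by
  rw [heatKernel, FourierTransform.fourier_fourierInv_eq]
  simp [gaussian_apply, mulEquiv_apply]

theorem hasTemperateGrowth_comp_mul {g : ℝ → ℂ} (hg : g.HasTemperateGrowth) (r : ℝ) :
    (fun ξ : ℝ => g (r * ξ)).HasTemperateGrowth :=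
  hg.comp (r • ContinuousLinearMap.id ℝ ℝ).hasTemperateGrowth

/-- Differentiation of vector valued Schwartz functions on `ℝ`. -/
abbrev schwartzDeriv (X : Type*) [NormedAddCommGroup X] [NormedSpace ℂ X] :
    𝓢(ℝ, X) →L[ℂ] 𝓢(ℝ, X) := SchwartzMap.derivCLM ℂ X

theorem fourier_schwartzDeriv (v : 𝓢(ℝ, X)) (ξ : ℝ) :
    𝓕 (schwartzDeriv X v) ξ = (2 * Real.pi * Complex.I * ξ : ℂ) • 𝓕 v ξ := by
  rw [SchwartzMap.fourier_coe, SchwartzMap.fourier_coe]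
  have h : (schwartzDeriv X v : ℝ → X) = deriv v := by
    ext x
    simp
  have h1 : Integrable (deriv v) := h ▸ (schwartzDeriv X v).integrable
  rw [h, Real.fourier_deriv v.integrable v.differentiable h1]

variable [CompleteSpace X]

theorem fourier_fourierMultiplierCLM {g : ℝ → ℂ} (hg : g.HasTemperateGrowth) (v : 𝓢(ℝ, X))
    (ξ : ℝ) : 𝓕 (SchwartzMap.fourierMultiplierCLM X g v) ξ = g ξ • 𝓕 v ξ := by
  rw [SchwartzMap.fourierMultiplierCLM_apply, FourierTransform.fourier_fourierInv_eq,
    SchwartzMap.smulLeftCLM_apply_apply hg]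

theorem ext_fourier {v w : 𝓢(ℝ, X)} (h : ∀ ξ, 𝓕 v ξ = 𝓕 w ξ) : v = w := by
  have h1 : 𝓕 v = 𝓕 w := by
    ext ξ
    exact h ξ
  have h2 : (𝓕⁻ (𝓕 v) : 𝓢(ℝ, X)) = 𝓕⁻ (𝓕 w) := by rw [h1]
  simpa using h2

theorem fourierMultiplierCLM_apply_eq_integral {g : ℝ → ℂ} (hg : g.HasTemperateGrowth)
    (v : 𝓢(ℝ, X)) (x : ℝ) :
    SchwartzMap.fourierMultiplierCLM X g v x =
      ∫ ξ : ℝ, Complex.exp (2 * Real.pi * (ξ * x) * Complex.I) • (g ξ • 𝓕 v ξ) := by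
  rw [SchwartzMap.fourierMultiplierCLM_apply, SchwartzMap.fourierInv_coe, Real.fourierInv_eq']
  refine integral_congr_ae (Filter.Eventually.of_forall fun ξ => ?_)
  simp only [SchwartzMap.smulLeftCLM_apply_apply hg]
  congr 2
  simp
  ring

/-- Convolution with the dilation `r⁻¹ k(· / r)`, written as the Fourier multiplier with symbol
`ξ ↦ 𝓕 k (r ξ)`. -/
def dilConv (X : Type*) [NormedAddCommGroup X] [NormedSpace ℂ X] (k : 𝓢(ℝ, ℂ)) (r : ℝ) :
    𝓢(ℝ, X) →L[ℂ] 𝓢(ℝ, X) :=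
  SchwartzMap.fourierMultiplierCLM X fun ξ => 𝓕 k (r * ξ)

theorem hasTemperateGrowth_fourier_comp_mul (k : 𝓢(ℝ, ℂ)) (r : ℝ) :
    (fun ξ : ℝ => 𝓕 k (r * ξ)).HasTemperateGrowth :=
  hasTemperateGrowth_comp_mul (𝓕 k).hasTemperateGrowth r

theorem dilConv_apply (k : 𝓢(ℝ, ℂ)) {r : ℝ} (hr : 0 < r) (v : 𝓢(ℝ, X)) (x : ℝ) :
    dilConv X k r v x = ∫ y, ((r⁻¹ : ℝ) * k (r⁻¹ * (x - y)) : ℂ) • v y := by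
  have hr' : r⁻¹ ≠ 0 := (inv_pos.mpr hr).ne'
  set K : 𝓢(ℝ, ℂ) := ((r⁻¹ : ℝ) : ℂ) •
    SchwartzMap.compCLMOfContinuousLinearEquiv ℂ (mulEquiv hr') k with hK
  have hKa : ∀ z, K z = (r⁻¹ : ℝ) * k (r⁻¹ * z) := by
    intro z
    simp [hK, mulEquiv_apply]
  have hF : ∀ ξ, 𝓕 K ξ = 𝓕 k (r * ξ) := by
    intro ξ
    rw [SchwartzMap.fourier_coe, SchwartzMap.fourier_coe, Real.fourier_real_eq_integral_exp_smul,
      Real.fourier_real_eq_integral_exp_smul]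
    have h := Measure.integral_comp_mul_left
      (fun z : ℝ => Complex.exp (↑(-2 * Real.pi * z * (r * ξ)) * Complex.I) • k z) r⁻¹
    rw [inv_inv, abs_of_pos hr] at h
    have h2 : ∫ z, Complex.exp (↑(-2 * Real.pi * z * (r * ξ)) * Complex.I) • k z =
        r⁻¹ • ∫ z, Complex.exp (↑(-2 * Real.pi * (r⁻¹ * z) * (r * ξ)) * Complex.I) •
          k (r⁻¹ * z) := by
      rw [h, smul_smul, inv_mul_cancel₀ hr.ne', one_smul]
    rw [h2, ← integral_smul]
    refine integral_congr_ae (Filter.Eventually.of_forall fun z => ?_)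
    simp only [hKa]
    have h3 : -2 * Real.pi * (r⁻¹ * z) * (r * ξ) = -2 * Real.pi * z * ξ := by
      field_simp
    rw [h3, ← Complex.coe_smul r⁻¹]
    simp only [smul_eq_mul]
    ring
  have h4 : dilConv X k r v = SchwartzMap.convolution (ContinuousLinearMap.lsmul ℂ ℂ) K v := by
    refine ext_fourier fun ξ => ?_
    rw [dilConv, fourier_fourierMultiplierCLM (hasTemperateGrowth_fourier_comp_mul k r),
      SchwartzMap.fourier_convolution, SchwartzMap.pairing_apply_apply, hF]
    rfl
  rw [h4, SchwartzMap.convolution_apply, convolution_eq_swap]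
  refine integral_congr_ae (Filter.Eventually.of_forall fun y => ?_)
  simp only [hKa]
  rfl

theorem enorm_dilConv_le (k : 𝓢(ℝ, ℂ)) {r : ℝ} (hr : 0 < r) (v : 𝓢(ℝ, X)) (x : ℝ) :
    ‖dilConv X k r v x‖ₑ ≤ ∫⁻ y, dilation k r (x - y) * ‖v y‖ₑ := by
  rw [dilConv_apply k hr]
  refine (enorm_integral_le_lintegral_enorm _).trans (lintegral_mono fun y => ?_)
  rw [enorm_smul, enorm_mul, dilation]
  gcongr
  simp [enorm_eq_nnnorm]

theorem schwartzDeriv_fourierMultiplierCLM {g : ℝ → ℂ} (hg : g.HasTemperateGrowth)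
    (v : 𝓢(ℝ, X)) : schwartzDeriv X (SchwartzMap.fourierMultiplierCLM X g v) =
      SchwartzMap.fourierMultiplierCLM X g (schwartzDeriv X v) := by
  refine ext_fourier fun ξ => ?_
  rw [fourier_schwartzDeriv, fourier_fourierMultiplierCLM hg, fourier_fourierMultiplierCLM hg,
    fourier_schwartzDeriv, smul_comm]

theorem iterate_schwartzDeriv_fourierMultiplierCLM {g : ℝ → ℂ} (hg : g.HasTemperateGrowth)
    (v : 𝓢(ℝ, X)) (j : ℕ) :
    (schwartzDeriv X)^[j] (SchwartzMap.fourierMultiplierCLM X g v) =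
      SchwartzMap.fourierMultiplierCLM X g ((schwartzDeriv X)^[j] v) := by
  induction j generalizing v with
  | zero => rfl
  | succ j ih =>
    rw [Function.iterate_succ_apply, schwartzDeriv_fourierMultiplierCLM hg, ih,
      Function.iterate_succ_apply]

theorem dilConv_schwartzDeriv (k : 𝓢(ℝ, ℂ)) {r : ℝ} (hr : 0 < r) (v : 𝓢(ℝ, X)) :
    dilConv X k r (schwartzDeriv X v) =
      ((r⁻¹ : ℝ) : ℂ) • dilConv X (schwartzDeriv ℂ k) r v := by
  refine ext_fourier fun ξ => ?_
  rw [FourierTransform.fourier_smul, smul_apply]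
  rw [dilConv, dilConv, fourier_fourierMultiplierCLM (hasTemperateGrowth_fourier_comp_mul _ r),
    fourier_fourierMultiplierCLM (hasTemperateGrowth_fourier_comp_mul _ r), fourier_schwartzDeriv,
    fourier_schwartzDeriv, smul_smul, smul_smul]
  congr 1
  have : (r : ℂ) ≠ 0 := by exact_mod_cast hr.ne'
  push_cast
  simp only [smul_eq_mul]
  field_simp

theorem dilConv_iterate_schwartzDeriv (k : 𝓢(ℝ, ℂ)) {r : ℝ} (hr : 0 < r) (v : 𝓢(ℝ, X)) (j : ℕ) :
    dilConv X k r ((schwartzDeriv X)^[j] v) =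
      ((r⁻¹ ^ j : ℝ) : ℂ) • dilConv X ((schwartzDeriv ℂ)^[j] k) r v := by
  induction j generalizing v k with
  | zero => simp
  | succ j ih =>
    rw [Function.iterate_succ_apply', dilConv_schwartzDeriv k hr, ih, smul_smul,
      ← Function.iterate_succ_apply]
    congr 1
    push_cast
    ring

end

section

variable {X : Type*} [NormedAddCommGroup X] [NormedSpace ℂ X]

/-! ### Bessel potentials of Schwartz functions -/

/-- The operator `(1 - Δ) ^ (s / 2)` on Schwartz functions. -/
def schwartzBessel (X : Type*) [NormedAddCommGroup X] [NormedSpace ℂ X] (s : ℝ) :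
    𝓢(ℝ, X) →L[ℂ] 𝓢(ℝ, X) :=
  SchwartzMap.fourierMultiplierCLM X (besselSymbol s)

/-- The normalising constant in the representation of `(1 - Δ) ^ (-σ / 2)` by Gaussian
convolutions. -/
def besselConst (σ : ℝ) : ℝ := (1 / 2) ^ (-σ / 2) * (1 / 2) * Real.Gamma (σ / 2)

theorem besselConst_pos {σ : ℝ} (hσ : 0 < σ) : 0 < besselConst σ := by
  have := Real.Gamma_pos_of_pos (half_pos hσ)
  unfold besselConst
  positivity

theorem integral_rpow_mul_exp_neg_sq {σ b : ℝ} (hσ : 0 < σ) (hb : 0 < b) :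
    ∫ r in Set.Ioi (0 : ℝ), r ^ (σ - 1) * Real.exp (-(r ^ 2 / 2) * b) =
      besselConst σ * b ^ (-σ / 2) := by
  have h := integral_rpow_mul_exp_neg_mul_rpow (p := 2) (q := σ - 1) (b := b / 2) (by norm_num)
    (by linarith) (by positivity)
  have e : ∀ r : ℝ, r ^ (σ - 1) * Real.exp (-(r ^ 2 / 2) * b) =
      r ^ (σ - 1) * Real.exp (-(b / 2) * r ^ (2 : ℝ)) := by
    intro r
    rw [Real.rpow_two]
    congr 2
    ring
  simp_rw [e, h, besselConst]
  rw [div_eq_mul_one_div b 2, Real.mul_rpow hb.le (by norm_num)]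
  have e1 : σ - 1 + 1 = σ := by ring
  rw [e1]
  ring

theorem integrableOn_rpow_mul_exp_neg_sq {σ : ℝ} (hσ : 0 < σ) :
    IntegrableOn (fun r : ℝ => r ^ (σ - 1) * Real.exp (-(r ^ 2 / 2))) (Set.Ioi 0) := by
  have h := integrableOn_rpow_mul_exp_neg_mul_sq (b := 1 / 2) (s := σ - 1) (by norm_num)
    (by linarith)
  refine h.congr_fun (fun r _ => ?_) measurableSet_Ioi
  dsimp only
  congr 2
  ring

variable [CompleteSpace X]

theorem schwartzBessel_schwartzBessel (s t : ℝ) (v : 𝓢(ℝ, X)) :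
    schwartzBessel X t (schwartzBessel X s v) = schwartzBessel X (s + t) v := by
  refine ext_fourier fun ξ => ?_
  simp only [schwartzBessel]
  rw [fourier_fourierMultiplierCLM (besselSymbol_hasTemperateGrowth t),
    fourier_fourierMultiplierCLM (besselSymbol_hasTemperateGrowth s),
    fourier_fourierMultiplierCLM (besselSymbol_hasTemperateGrowth (s + t)), smul_smul]
  congr 1
  simp only [besselSymbol]
  norm_cast
  rw [← Real.rpow_add (by positivity)]
  congr 1
  ring

theorem schwartzBessel_zero (v : 𝓢(ℝ, X)) : schwartzBessel X 0 v = v := by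
  refine ext_fourier fun ξ => ?_
  rw [schwartzBessel, fourier_fourierMultiplierCLM (besselSymbol_hasTemperateGrowth 0)]
  simp [besselSymbol]

theorem schwartzBessel_two (v : 𝓢(ℝ, X)) :
    schwartzBessel X 2 v = v - (schwartzDeriv X)^[2] v := by
  refine ext_fourier fun ξ => ?_
  have hsub : (𝓕 (v - (schwartzDeriv X)^[2] v) : 𝓢(ℝ, X)) =
      𝓕 v - 𝓕 ((schwartzDeriv X)^[2] v) :=
    map_sub (FourierTransform.fourierCLM ℂ 𝓢(ℝ, X)) _ _
  rw [schwartzBessel, fourier_fourierMultiplierCLM (besselSymbol_hasTemperateGrowth 2), hsub,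
    sub_apply, Function.iterate_succ_apply',
    Function.iterate_one, fourier_schwartzDeriv, fourier_schwartzDeriv, smul_smul]
  nth_rewrite 2 [← one_smul ℂ (𝓕 v ξ)]
  rw [← sub_smul]
  congr 1
  simp only [besselSymbol]
  norm_num
  linear_combination (4 : ℂ) * (Real.pi * ξ) ^ 2 * Complex.I_sq

theorem schwartzBessel_dilConv (s r : ℝ) (k : 𝓢(ℝ, ℂ)) (v : 𝓢(ℝ, X)) :
    schwartzBessel X s (dilConv X k r v) = dilConv X k r (schwartzBessel X s v) := by
  refine ext_fourier fun ξ => ?_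
  rw [schwartzBessel, dilConv, fourier_fourierMultiplierCLM (besselSymbol_hasTemperateGrowth s),
    fourier_fourierMultiplierCLM (hasTemperateGrowth_fourier_comp_mul k r),
    fourier_fourierMultiplierCLM (hasTemperateGrowth_fourier_comp_mul k r),
    fourier_fourierMultiplierCLM (besselSymbol_hasTemperateGrowth s), smul_comm]

/-- Subordination: `(1 - Δ) ^ (-σ / 2)` is an average of convolutions with dilated Gaussians. -/
theorem schwartzBessel_neg_apply {σ : ℝ} (hσ : 0 < σ) (v : 𝓢(ℝ, X)) (x : ℝ) :
    schwartzBessel X (-σ) v x = (((besselConst σ)⁻¹ : ℝ) : ℂ) • ∫ r in Set.Ioi (0 : ℝ),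
      ((r ^ (σ - 1) * Real.exp (-(r ^ 2 / 2)) : ℝ) : ℂ) • dilConv X heatKernel r v x := by
  set a : ℝ → ℝ := fun r => r ^ (σ - 1) * Real.exp (-(r ^ 2 / 2)) with ha
  set E : ℝ → ℂ := fun ξ => Complex.exp (2 * Real.pi * (ξ * x) * Complex.I) with hE
  have hEn : ∀ ξ, ‖E ξ‖ = 1 := by
    intro ξ
    have : (2 * Real.pi * (ξ * x) * Complex.I : ℂ) =
      ((2 * Real.pi * (ξ * x) : ℝ) : ℂ) * Complex.I := by push_cast; ring
    rw [hE]
    dsimp only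
    rw [this, Complex.norm_exp_ofReal_mul_I]
  have hsym : ∀ ξ : ℝ, besselSymbol (-σ) ξ = (((besselConst σ)⁻¹ : ℝ) : ℂ) *
      ∫ r in Set.Ioi (0 : ℝ), (a r : ℂ) * 𝓕 heatKernel (r * ξ) := by
    intro ξ
    have h := integral_rpow_mul_exp_neg_sq hσ (b := 1 + (2 * Real.pi * ξ) ^ 2) (by positivity)
    have e : ∀ r : ℝ, (a r : ℂ) * 𝓕 heatKernel (r * ξ) =
        ((r ^ (σ - 1) * Real.exp (-(r ^ 2 / 2) * (1 + (2 * Real.pi * ξ) ^ 2)) : ℝ) : ℂ) := by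
      intro r
      rw [fourier_heatKernel, ha, ← Complex.ofReal_mul, mul_assoc, ← Real.exp_add]
      congr 3
      ring
    simp_rw [e]
    rw [integral_complex_ofReal, h, ← Complex.ofReal_mul, inv_mul_cancel_left₀
      (besselConst_pos hσ).ne', besselSymbol]
  have hint : Integrable (Function.uncurry fun (ξ r : ℝ) =>
      (a r : ℂ) • (E ξ • (𝓕 heatKernel (r * ξ) • 𝓕 v ξ)))
      (volume.prod (volume.restrict (Set.Ioi 0))) := by
    have h1 : Integrable (fun q : ℝ × ℝ => ‖𝓕 v q.1‖ * a q.2)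
        (volume.prod (volume.restrict (Set.Ioi 0))) :=
      Integrable.mul_prod (𝓕 v).integrable.norm (integrableOn_rpow_mul_exp_neg_sq hσ)
    refine h1.mono' ?_ ?_
    · have c1 : Continuous fun q : ℝ × ℝ => E q.1 • (𝓕 heatKernel (q.2 * q.1) • 𝓕 v q.1) := by
        have := (𝓕 heatKernel).continuous
        have := (𝓕 v).continuous
        fun_prop
      have m1 : Measurable fun q : ℝ × ℝ => (a q.2 : ℂ) := by
        fun_prop
      exact m1.aestronglyMeasurable.smul c1.aestronglyMeasurable
    · have h2 : ∀ᵐ q : ℝ × ℝ ∂(volume.prod (volume.restrict (Set.Ioi 0))), 0 ≤ a q.2 := by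
        have : ∀ᵐ r : ℝ ∂(volume.restrict (Set.Ioi 0)), 0 ≤ a r := by
          filter_upwards [ae_restrict_mem measurableSet_Ioi] with r hr
          have : (0 : ℝ) < r := hr
          positivity
        exact Measure.quasiMeasurePreserving_snd.ae this
      filter_upwards [h2] with q hq
      have h3 : ‖𝓕 heatKernel (q.2 * q.1)‖ ≤ 1 := by
        rw [fourier_heatKernel, Complex.norm_real, Real.norm_of_nonneg (Real.exp_nonneg _)]
        exact Real.exp_le_one_iff.mpr (by
          have := sq_nonneg (2 * Real.pi * (q.2 * q.1))
          linarith)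
      simp only [Function.uncurry]
      rw [norm_smul, norm_smul, norm_smul, hEn, one_mul, Complex.norm_real,
        Real.norm_of_nonneg hq, mul_comm]
      gcongr
      exact mul_le_of_le_one_left (norm_nonneg _) h3
  rw [schwartzBessel, fourierMultiplierCLM_apply_eq_integral (besselSymbol_hasTemperateGrowth _)]
  have h5 : ∀ ξ : ℝ, Complex.exp (2 * Real.pi * (ξ * x) * Complex.I) •
      (besselSymbol (-σ) ξ • 𝓕 v ξ) = (((besselConst σ)⁻¹ : ℝ) : ℂ) •
      ∫ r in Set.Ioi (0 : ℝ), (a r : ℂ) • (E ξ • (𝓕 heatKernel (r * ξ) • 𝓕 v ξ)) := by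
    intro ξ
    have e : ∀ r : ℝ, (a r : ℂ) • (E ξ • (𝓕 heatKernel (r * ξ) • 𝓕 v ξ)) =
        ((a r : ℂ) * 𝓕 heatKernel (r * ξ)) • (E ξ • 𝓕 v ξ) := by
      intro r
      rw [mul_smul, smul_comm (E ξ)]
    simp_rw [e]
    rw [integral_smul_const, hsym]
    change E ξ • _ = _
    rw [smul_comm (E ξ), mul_smul]
  simp_rw [h5]
  rw [integral_smul, integral_integral_swap hint]
  congr 1
  refine integral_congr_ae (Filter.Eventually.of_forall fun r => ?_)
  dsimp only
  rw [integral_smul, dilConv,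
    fourierMultiplierCLM_apply_eq_integral (hasTemperateGrowth_fourier_comp_mul _ r)]

/-- The density on `(0, ∞)` in the Gaussian representation of `(1 - Δ) ^ (-σ / 2)`. -/
def besselDensity (σ r : ℝ) : ℝ≥0∞ :=
  ENNReal.ofReal ((besselConst σ)⁻¹ * (r ^ (σ - 1) * Real.exp (-(r ^ 2 / 2))))

@[fun_prop]
theorem measurable_besselDensity (σ : ℝ) : Measurable (besselDensity σ) := by
  unfold besselDensity
  fun_prop

theorem enorm_schwartzBessel_neg_le {σ : ℝ} (hσ : 0 < σ) (v : 𝓢(ℝ, X)) (x : ℝ) :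
    ‖schwartzBessel X (-σ) v x‖ₑ ≤
      ∫⁻ r in Set.Ioi 0, besselDensity σ r * ‖dilConv X heatKernel r v x‖ₑ := by
  rw [schwartzBessel_neg_apply hσ, ← integral_smul]
  refine (enorm_integral_le_lintegral_enorm _).trans
    (setLIntegral_mono' measurableSet_Ioi fun r hr => ?_)
  have h1 : (0 : ℝ) < r := hr
  have h2 := besselConst_pos hσ
  rw [smul_smul, enorm_smul, ← Complex.ofReal_mul, besselDensity, ← ofReal_norm (_ : ℂ),
    Complex.norm_real, Real.norm_of_nonneg (by positivity)]

theorem lintegral_besselDensity_lt_top {σ : ℝ} (hσ : 0 < σ) :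
    ∫⁻ r in Set.Ioi 0, besselDensity σ r < ⊤ :=
  ((integrableOn_rpow_mul_exp_neg_sq hσ).const_mul _).lintegral_lt_top

end

section

variable {X : Type*} [NormedAddCommGroup X] [NormedSpace ℂ X]

/-! ### Weighted estimates for Bessel potentials -/

/-- The superposition of the convolutions of `|v|` with the dilations of `|k|`, weighted by `a`. -/
def avgConv (k : 𝓢(ℝ, ℂ)) (a : ℝ → ℝ≥0∞) (v : 𝓢(ℝ, X)) (x : ℝ) : ℝ≥0∞ :=
  ∫⁻ r in Set.Ioi 0, a r * ∫⁻ y, dilation k r (x - y) * ‖v y‖ₑ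

theorem avgConv_eq (k : 𝓢(ℝ, ℂ)) {a : ℝ → ℝ≥0∞} (ha : Measurable a) (v : 𝓢(ℝ, X)) (x : ℝ) :
    avgConv k a v x = ∫⁻ y, (∫⁻ r in Set.Ioi 0, a r * dilation k r (x - y)) * ‖v y‖ₑ := by
  have hk := measurable_dilation k.continuous.measurable
  have hv : Measurable fun y => ‖v y‖ₑ := v.continuous.enorm.measurable
  have m1 : ∀ r, Measurable fun y => dilation k r (x - y) * ‖v y‖ₑ := fun r =>
    (hk.comp (measurable_const.prodMk (measurable_const.sub measurable_id))).mul hv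
  have m2 : Measurable fun q : ℝ × ℝ => a q.1 * (dilation k q.1 (x - q.2) * ‖v q.2‖ₑ) :=
    (ha.comp measurable_fst).mul ((hk.comp (measurable_fst.prodMk
      (measurable_const.sub measurable_snd))).mul (hv.comp measurable_snd))
  have m3 : ∀ y, Measurable fun r => a r * dilation k r (x - y) := fun y =>
    ha.mul (hk.comp (measurable_id.prodMk measurable_const))
  calc avgConv k a v x
      = ∫⁻ r in Set.Ioi 0, ∫⁻ y, a r * (dilation k r (x - y) * ‖v y‖ₑ) := by
        refine lintegral_congr fun r => ?_
        rw [lintegral_const_mul _ (m1 r)]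
    _ = ∫⁻ y, ∫⁻ r in Set.Ioi 0, a r * (dilation k r (x - y) * ‖v y‖ₑ) :=
        lintegral_lintegral_swap m2.aemeasurable
    _ = _ := by
        refine lintegral_congr fun y => ?_
        rw [← lintegral_mul_const _ (m3 y)]
        refine lintegral_congr fun r => ?_
        ring

theorem measurable_avgConv (k : 𝓢(ℝ, ℂ)) {a : ℝ → ℝ≥0∞} (ha : Measurable a) (v : 𝓢(ℝ, X)) :
    Measurable (avgConv k a v) := by
  have hk := measurable_dilation k.continuous.measurable
  have hv : Measurable fun y => ‖v y‖ₑ := v.continuous.enorm.measurable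
  have m1 : Measurable fun q : (ℝ × ℝ) × ℝ => dilation k q.1.2 (q.1.1 - q.2) * ‖v q.2‖ₑ :=
    (hk.comp ((measurable_snd.comp measurable_fst).prodMk
      ((measurable_fst.comp measurable_fst).sub measurable_snd))).mul (hv.comp measurable_snd)
  have m2 : Measurable fun q : ℝ × ℝ => a q.2 * ∫⁻ y, dilation k q.2 (q.1 - y) * ‖v y‖ₑ :=
    (ha.comp measurable_snd).mul m1.lintegral_prod_right'
  exact m2.lintegral_prod_right'

section Weighted

variable {p γ : ℝ}

theorem exists_eLpNorm_avgConv_le (hp : 1 < p) (hγ : -1 < γ) (hγ' : γ < p - 1) (k : 𝓢(ℝ, ℂ)) :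
    ∃ C : ℝ≥0, ∀ (A : ℝ≥0) (a : ℝ → ℝ≥0∞) (v : 𝓢(ℝ, X)), Measurable a →
      ∫⁻ r in Set.Ioi 0, a r ≤ A →
      eLpNorm (avgConv k a v) (ENNReal.ofReal p) (powerMeasure γ) ≤
        C * A * eLpNorm v (ENNReal.ofReal p) (powerMeasure γ) := by
  obtain ⟨C₀, h₀⟩ := IsSchurKernel.exists_eLpNorm_le hp hγ hγ'
  obtain ⟨C₁, h₁⟩ := exists_isSchurKernel_lintegral_dilation k
  refine ⟨C₀ * C₁, fun A a v ha hA => ?_⟩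
  have h := h₀ (C₁ * A) _ (avgConv k a v) (fun y => ‖v y‖ₑ) (h₁ A a ha hA)
    v.continuous.enorm.measurable (fun x => (avgConv_eq k ha v x).le)
  rw [eLpNorm_enorm] at h
  refine h.trans_eq ?_
  push_cast
  ring

variable [CompleteSpace X]

/-- Convolutions with the dilations of a Schwartz function are uniformly bounded. -/
theorem exists_eLpNorm_dilConv_le (hp : 1 < p) (hγ : -1 < γ) (hγ' : γ < p - 1) (k : 𝓢(ℝ, ℂ)) :
    ∃ C : ℝ≥0, ∀ (r : ℝ) (v : 𝓢(ℝ, X)), 0 < r →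
      eLpNorm (dilConv X k r v) (ENNReal.ofReal p) (powerMeasure γ) ≤
        C * eLpNorm v (ENNReal.ofReal p) (powerMeasure γ) := by
  obtain ⟨C₀, h₀⟩ := IsSchurKernel.exists_eLpNorm_le hp hγ hγ'
  obtain ⟨C₁, h₁⟩ := exists_isSchurKernel_dilation k
  refine ⟨C₀ * C₁, fun r v hr => ?_⟩
  have h := h₀ C₁ _ (fun x => ‖dilConv X k r v x‖ₑ) (fun y => ‖v y‖ₑ) (h₁ r hr)
    v.continuous.enorm.measurable (enorm_dilConv_le k hr v)
  rw [eLpNorm_enorm, eLpNorm_enorm] at h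
  exact_mod_cast h

theorem enorm_schwartzBessel_neg_le_avgConv {σ : ℝ} (hσ : 0 < σ) (v : 𝓢(ℝ, X)) (x : ℝ) :
    ‖schwartzBessel X (-σ) v x‖ₑ ≤ avgConv heatKernel (besselDensity σ) v x := by
  refine (enorm_schwartzBessel_neg_le hσ v x).trans
    (setLIntegral_mono' measurableSet_Ioi fun r hr => ?_)
  gcongr
  exact enorm_dilConv_le heatKernel hr v x

/-- The operators `(1 - Δ) ^ (-σ / 2)`, `σ ≥ 0`, are bounded on `L^p(ℝ, |x| ^ γ; X)`. -/
theorem exists_eLpNorm_schwartzBessel_neg_le (hp : 1 < p) (hγ : -1 < γ) (hγ' : γ < p - 1) {σ : ℝ}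
    (hσ : 0 ≤ σ) : ∃ C : ℝ≥0, ∀ v : 𝓢(ℝ, X),
      eLpNorm (schwartzBessel X (-σ) v) (ENNReal.ofReal p) (powerMeasure γ) ≤
        C * eLpNorm v (ENNReal.ofReal p) (powerMeasure γ) := by
  rcases hσ.eq_or_lt with rfl | hσ
  · refine ⟨1, fun v => ?_⟩
    rw [neg_zero, schwartzBessel_zero]
    simp
  obtain ⟨C, hC⟩ := exists_eLpNorm_avgConv_le (X := X) hp hγ hγ' heatKernel
  have hA := (lintegral_besselDensity_lt_top hσ).ne
  refine ⟨C * (∫⁻ r in Set.Ioi 0, besselDensity σ r).toNNReal, fun v => ?_⟩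
  have h := hC (∫⁻ r in Set.Ioi 0, besselDensity σ r).toNNReal (besselDensity σ) v
    (measurable_besselDensity σ) (by rw [ENNReal.coe_toNNReal hA])
  rw [ENNReal.coe_mul]
  exact (eLpNorm_mono_enorm fun x => enorm_schwartzBessel_neg_le_avgConv hσ v x).trans h

theorem lintegral_comp_neg_powerMeasure {F : ℝ → ℝ≥0∞} (hF : Measurable F) :
    ∫⁻ y, F (-y) ∂powerMeasure γ = ∫⁻ y, F y ∂powerMeasure γ := by
  rw [lintegral_powerMeasure hF,
    lintegral_powerMeasure (F := fun y => F (-y)) (hF.comp measurable_neg),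
    ← lintegral_neg_eq_self]
  simp [powWeight_neg]

/-- The `j`-th derivative at the origin is controlled by the norm of `H^{s,p}(ℝ, |x| ^ γ; X)`
when `s > j + (1 + γ) / p`: in the Gaussian representation, Hölder's inequality bounds the
contribution of the scale `r` by `r ^ (s - 1 - j - (1 + γ) / p)`. -/
theorem exists_enorm_iterate_schwartzDeriv_zero_le (hp : 1 < p) (hγ : -1 < γ)
    (hγ' : γ < p - 1) {s : ℝ} {j : ℕ} (hs : j + (1 + γ) / p < s) :
    ∃ C : ℝ≥0, ∀ v : 𝓢(ℝ, X), ‖(schwartzDeriv X)^[j] v 0‖ₑ ≤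
        C * eLpNorm (schwartzBessel X s v) (ENNReal.ofReal p) (powerMeasure γ) := by
  have hp0 : 0 < p := by linarith
  have hγp : 0 < (1 + γ) / p := div_pos (by linarith) hp0
  have hs0 : 0 < s := by
    have : (0 : ℝ) ≤ j := by positivity
    linarith
  set δ := s - j - (1 + γ) / p with hδ
  have hδ0 : 0 < δ := by linarith
  obtain ⟨C, hC⟩ := exists_lintegral_dilation_mul_le hp hγ' ((schwartzDeriv ℂ)^[j] heatKernel)
  set c := (besselConst s)⁻¹ with hc
  have hc0 : 0 < c := inv_pos.mpr (besselConst_pos hs0)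
  set I := ∫⁻ r in Set.Ioi 0, ENNReal.ofReal (c * (r ^ (δ - 1) * Real.exp (-(r ^ 2 / 2)))) with hI
  have hI' : I ≠ ⊤ := ((integrableOn_rpow_mul_exp_neg_sq hδ0).const_mul c).lintegral_lt_top.ne
  refine ⟨C * I.toNNReal, fun u => ?_⟩
  set v := schwartzBessel X s u with hv
  have hu : u = schwartzBessel X (-s) v := by
    rw [hv, schwartzBessel_schwartzBessel, add_neg_cancel, schwartzBessel_zero]
  have e1 : (schwartzDeriv X)^[j] u = schwartzBessel X (-s) ((schwartzDeriv X)^[j] v) := by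
    rw [hu]
    exact iterate_schwartzDeriv_fourierMultiplierCLM (besselSymbol_hasTemperateGrowth _) v j
  have hvm : Measurable fun y => ‖v y‖ₑ := v.continuous.enorm.measurable
  set Nv := eLpNorm v (ENNReal.ofReal p) (powerMeasure γ) with hN
  have hNv : Nv = (∫⁻ y, ‖v (-y)‖ₑ ^ p ∂powerMeasure γ) ^ (1 / p) := by
    rw [hN, eLpNorm_eq_lintegral_rpow_enorm_toReal (by simpa using hp0) ENNReal.ofReal_ne_top,
      ENNReal.toReal_ofReal hp0.le,
      lintegral_comp_neg_powerMeasure (F := fun y => ‖v y‖ₑ ^ p) (hvm.pow_const p)]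
  have e2 : ∀ r ∈ Set.Ioi (0 : ℝ), besselDensity s r *
      ‖dilConv X heatKernel r ((schwartzDeriv X)^[j] v) 0‖ₑ ≤
      ENNReal.ofReal (c * (r ^ (δ - 1) * Real.exp (-(r ^ 2 / 2)))) * (C * Nv) := by
    intro r hr
    have hr : 0 < r := hr
    have h1 : ‖dilConv X ((schwartzDeriv ℂ)^[j] heatKernel) r v 0‖ₑ ≤
        C * ENNReal.ofReal (r ^ (-((1 + γ) / p))) * Nv := by
      refine (enorm_dilConv_le _ hr v 0).trans ?_
      have h2 := hC r (fun y => ‖v (-y)‖ₑ) hr (hvm.comp measurable_neg)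
      rw [← hNv] at h2
      refine le_trans (le_of_eq ?_) h2
      rw [← lintegral_neg_eq_self]
      simp
    rw [dilConv_iterate_schwartzDeriv _ hr, smul_apply, enorm_smul, besselDensity,
      ← ofReal_norm (_ : ℂ), Complex.norm_real, Real.norm_of_nonneg (by positivity)]
    calc _ ≤ ENNReal.ofReal (c * (r ^ (s - 1) * Real.exp (-(r ^ 2 / 2)))) *
          (ENNReal.ofReal (r⁻¹ ^ j) * (C * ENNReal.ofReal (r ^ (-((1 + γ) / p))) * Nv)) := by
          gcongr
      _ = (ENNReal.ofReal (c * (r ^ (s - 1) * Real.exp (-(r ^ 2 / 2)))) *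
          ENNReal.ofReal (r⁻¹ ^ j) * ENNReal.ofReal (r ^ (-((1 + γ) / p)))) * (C * Nv) := by
          ring
      _ = _ := by
          rw [← ENNReal.ofReal_mul (by positivity), ← ENNReal.ofReal_mul (by positivity)]
          congr 2
          have e3 : r ^ (δ - 1) = r ^ (s - 1) * r⁻¹ ^ j * r ^ (-((1 + γ) / p)) := by
            rw [← Real.rpow_natCast, ← Real.rpow_neg_one, ← Real.rpow_mul hr.le,
              ← Real.rpow_add hr, ← Real.rpow_add hr]
            congr 1
            rw [hδ]
            ring
          rw [e3]
          ring
  rw [e1]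
  calc _ ≤ _ := enorm_schwartzBessel_neg_le hs0 _ _
    _ ≤ ∫⁻ r in Set.Ioi 0,
        ENNReal.ofReal (c * (r ^ (δ - 1) * Real.exp (-(r ^ 2 / 2)))) * (C * Nv) :=
      setLIntegral_mono' measurableSet_Ioi e2
    _ = _ := by
      rw [lintegral_mul_const _ (by fun_prop), ← hI, ENNReal.coe_mul, ENNReal.coe_toNNReal hI']
      ring

theorem setLIntegral_Ioi_indicator_Iio_rpow {σ τ : ℝ} (hσ : 0 < σ) (hτ : 0 < τ) :
    ∫⁻ r in Set.Ioi 0, (Set.Iio τ).indicator (fun r => ENNReal.ofReal (r ^ (σ - 1))) r =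
      ENNReal.ofReal (τ ^ σ / σ) := by
  rw [lintegral_indicator measurableSet_Iio, Measure.restrict_restrict measurableSet_Iio,
    Set.inter_comm, Set.Ioi_inter_Iio]
  have h := intervalIntegral.intervalIntegrable_rpow' (a := 0) (b := τ) (r := σ - 1) (by linarith)
  rw [restrict_Ioo_eq_restrict_Ioc, ← ofReal_integral_eq_lintegral_ofReal h.1,
    ← intervalIntegral.integral_of_le hτ.le, integral_rpow (Or.inl (by linarith))]
  · rw [sub_add_cancel, Real.zero_rpow hσ.ne', sub_zero]
  · filter_upwards [ae_restrict_mem measurableSet_Ioc] with r hr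
    exact Real.rpow_nonneg hr.1.le _

theorem setLIntegral_Ioi_indicator_Ici_rpow {σ τ : ℝ} (hσ : σ < 0) (hτ : 0 < τ) :
    ∫⁻ r in Set.Ioi 0, (Set.Ici τ).indicator (fun r => ENNReal.ofReal (r ^ (σ - 1))) r =
      ENNReal.ofReal (τ ^ σ / -σ) := by
  have hI : Set.Ici τ ∩ Set.Ioi 0 = Set.Ici τ :=
    Set.inter_eq_left.mpr fun x hx => hτ.trans_le hx
  rw [lintegral_indicator measurableSet_Ici, Measure.restrict_restrict measurableSet_Ici, hI,
    ← Measure.restrict_congr_set Ioi_ae_eq_Ici, ← ofReal_integral_eq_lintegral_ofReal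
      (integrableOn_Ioi_rpow_of_lt (by linarith) hτ), integral_Ioi_rpow_of_lt (by linarith) hτ]
  · rw [sub_add_cancel, neg_div, div_neg]
  · filter_upwards [ae_restrict_mem measurableSet_Ioi] with r hr
    exact Real.rpow_nonneg (hτ.trans hr).le _

/-- A moment inequality for `1 - Δ` in additive form: for `0 < σ < 2`, the norm of
`(1 - Δ) ^ (1 - σ / 2) v` is bounded by those of `(1 - Δ) v` and `v`. The Gaussian
representation is split at the scale `τ`; at larger scales the two derivatives are moved to
the Gaussian. -/
theorem exists_eLpNorm_schwartzBessel_two_sub_le (hp : 1 < p) (hγ : -1 < γ) (hγ' : γ < p - 1)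
    {σ : ℝ} (hσ : 0 < σ) (hσ' : σ < 2) : ∃ C : ℝ≥0, ∀ (v : 𝓢(ℝ, X)) (τ : ℝ), 0 < τ →
      eLpNorm (schwartzBessel X (2 - σ) v) (ENNReal.ofReal p) (powerMeasure γ) ≤
        C * (ENNReal.ofReal (τ ^ σ) *
            eLpNorm (schwartzBessel X 2 v) (ENNReal.ofReal p) (powerMeasure γ) +
          ENNReal.ofReal (τ ^ (σ - 2)) * eLpNorm v (ENNReal.ofReal p) (powerMeasure γ)) := by
  set k₂ := (schwartzDeriv ℂ)^[2] heatKernel with hk₂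
  obtain ⟨C₀, h₀⟩ := exists_eLpNorm_avgConv_le (X := X) hp hγ hγ' heatKernel
  obtain ⟨C₂, h₂⟩ := exists_eLpNorm_avgConv_le (X := X) hp hγ hγ' k₂
  set c := (besselConst σ)⁻¹ with hc
  have hc0 : 0 < c := inv_pos.mpr (besselConst_pos hσ)
  refine ⟨max (C₀ * (c / σ).toNNReal) ((C₀ + C₂) * (2 * c / (2 - σ)).toNNReal),
    fun v τ hτ => ?_⟩
  set a₁ : ℝ → ℝ≥0∞ := fun r => ENNReal.ofReal c *
    (Set.Iio τ).indicator (fun r => ENNReal.ofReal (r ^ (σ - 1))) r with ha₁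
  set a₂ : ℝ → ℝ≥0∞ := fun r => ENNReal.ofReal (2 * c) *
    (Set.Ici τ).indicator (fun r => ENNReal.ofReal (r ^ (σ - 2 - 1))) r with ha₂
  have m₁' : Measurable ((Set.Iio τ).indicator fun r : ℝ => ENNReal.ofReal (r ^ (σ - 1))) :=
    Measurable.indicator (by fun_prop) measurableSet_Iio
  have m₂' : Measurable ((Set.Ici τ).indicator fun r : ℝ => ENNReal.ofReal (r ^ (σ - 2 - 1))) :=
    Measurable.indicator (by fun_prop) measurableSet_Ici
  have m₁ : Measurable a₁ := m₁'.const_mul _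
  have m₂ : Measurable a₂ := m₂'.const_mul _
  have i₁ : ∫⁻ r in Set.Ioi 0, a₁ r = ((c / σ * τ ^ σ).toNNReal : ℝ≥0) := by
    rw [lintegral_const_mul _ m₁', setLIntegral_Ioi_indicator_Iio_rpow hσ hτ,
      ← ENNReal.ofReal_mul hc0.le, ENNReal.ofReal]
    congr 2
    ring
  have i₂ : ∫⁻ r in Set.Ioi 0, a₂ r = ((2 * c / (2 - σ) * τ ^ (σ - 2)).toNNReal : ℝ≥0) := by
    rw [lintegral_const_mul _ m₂', setLIntegral_Ioi_indicator_Ici_rpow (by linarith) hτ,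
      ← ENNReal.ofReal_mul (by positivity), ENNReal.ofReal]
    congr 2
    rw [neg_sub]
    ring
  set w := schwartzBessel X 2 v with hw
  have e1 : schwartzBessel X (2 - σ) v = schwartzBessel X (-σ) w := by
    rw [hw, schwartzBessel_schwartzBessel, sub_eq_add_neg]
  have hpt : ∀ x, ‖schwartzBessel X (2 - σ) v x‖ₑ ≤
      ‖(avgConv heatKernel a₁ w + (avgConv heatKernel a₂ v + avgConv k₂ a₂ v)) x‖ₑ := by
    intro x
    rw [e1, enorm_eq_self]
    refine (enorm_schwartzBessel_neg_le hσ w x).trans ?_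
    have hk := measurable_dilation heatKernel.continuous.measurable
    have hk' := measurable_dilation k₂.continuous.measurable
    have mm : ∀ (k : 𝓢(ℝ, ℂ)) (a : ℝ → ℝ≥0∞) (u : 𝓢(ℝ, X)), Measurable a →
        Measurable fun r => a r * ∫⁻ y, dilation k r (x - y) * ‖u y‖ₑ := by
      intro k a u ha
      have hk := measurable_dilation k.continuous.measurable
      have hu : Measurable fun y => ‖u y‖ₑ := u.continuous.enorm.measurable
      have m1 : Measurable fun q : ℝ × ℝ => dilation k q.1 (x - q.2) * ‖u q.2‖ₑ :=
        (hk.comp (measurable_fst.prodMk (measurable_const.sub measurable_snd))).mul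
          (hu.comp measurable_snd)
      exact ha.mul m1.lintegral_prod_right'
    simp only [Pi.add_apply, avgConv]
    rw [← lintegral_add_left (mm heatKernel a₂ v m₂), ← lintegral_add_left (mm heatKernel a₁ w m₁)]
    refine setLIntegral_mono' measurableSet_Ioi fun r hr => ?_
    have hr : 0 < r := hr
    have hexp : Real.exp (-(r ^ 2 / 2)) ≤ 1 := Real.exp_le_one_iff.mpr (by
      have := sq_nonneg r
      linarith)
    rcases lt_or_ge r τ with hrτ | hrτ
    · refine le_add_of_le_of_nonneg ?_ zero_le
      rw [ha₁]
      dsimp only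
      rw [Set.indicator_of_mem (show r ∈ Set.Iio τ from hrτ), ← ENNReal.ofReal_mul hc0.le]
      refine mul_le_mul' (ENNReal.ofReal_le_ofReal ?_) (enorm_dilConv_le heatKernel hr w x)
      gcongr
      exact mul_le_of_le_one_right (by positivity) hexp
    · refine le_add_of_nonneg_of_le zero_le ?_
      rw [← mul_add, ha₂]
      dsimp only
      rw [Set.indicator_of_mem (show r ∈ Set.Ici τ from hrτ), ← ENNReal.ofReal_mul (by positivity)]
      have hdec : dilConv X heatKernel r w x = dilConv X heatKernel r v x -
          ((r⁻¹ ^ 2 : ℝ) : ℂ) • dilConv X k₂ r v x := by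
        rw [hw, schwartzBessel_two, map_sub, dilConv_iterate_schwartzDeriv heatKernel hr]
        rfl
      -- the factor `exp (- r ^ 2 / 2)` is at most `2 / r ^ 2`, which makes both terms comparable
      have hexp2 : Real.exp (-(r ^ 2 / 2)) ≤ 2 * r⁻¹ ^ 2 := by
        have h1 := Real.add_one_le_exp (r ^ 2 / 2)
        rw [Real.exp_neg]
        have h2 : r ^ 2 / 2 ≤ Real.exp (r ^ 2 / 2) := by linarith
        calc (Real.exp (r ^ 2 / 2))⁻¹ ≤ (r ^ 2 / 2)⁻¹ := by gcongr
          _ = _ := by rw [inv_div, inv_pow]; ring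
      have hpow : r ^ (σ - 1) * r⁻¹ ^ 2 = r ^ (σ - 2 - 1) := by
        rw [← Real.rpow_natCast, ← Real.rpow_neg_one, ← Real.rpow_mul hr.le, ← Real.rpow_add hr]
        congr 1
        push_cast
        ring
      have hb1 : besselDensity σ r ≤ ENNReal.ofReal (2 * c * r ^ (σ - 2 - 1)) := by
        refine ENNReal.ofReal_le_ofReal ?_
        calc c * (r ^ (σ - 1) * Real.exp (-(r ^ 2 / 2)))
            ≤ c * (r ^ (σ - 1) * (2 * r⁻¹ ^ 2)) := by gcongr
          _ = 2 * c * (r ^ (σ - 1) * r⁻¹ ^ 2) := by ring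
          _ = _ := by rw [hpow]
      have hb2 : besselDensity σ r * ENNReal.ofReal (r⁻¹ ^ 2) ≤
          ENNReal.ofReal (2 * c * r ^ (σ - 2 - 1)) := by
        rw [besselDensity, ← ENNReal.ofReal_mul (by positivity)]
        refine ENNReal.ofReal_le_ofReal ?_
        calc c * (r ^ (σ - 1) * Real.exp (-(r ^ 2 / 2))) * r⁻¹ ^ 2
            ≤ c * (r ^ (σ - 1) * 1) * r⁻¹ ^ 2 := by gcongr
          _ = c * (r ^ (σ - 1) * r⁻¹ ^ 2) := by ring
          _ ≤ 2 * c * (r ^ (σ - 1) * r⁻¹ ^ 2) := by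
            have : 0 ≤ r ^ (σ - 1) * r⁻¹ ^ 2 := by positivity
            nlinarith
          _ = _ := by rw [hpow]
      calc besselDensity σ r * ‖dilConv X heatKernel r w x‖ₑ
          ≤ besselDensity σ r * (‖dilConv X heatKernel r v x‖ₑ +
            ENNReal.ofReal (r⁻¹ ^ 2) * ‖dilConv X k₂ r v x‖ₑ) := by
            gcongr
            rw [hdec]
            refine enorm_sub_le.trans ?_
            gcongr
            rw [enorm_smul, ← ofReal_norm (_ : ℂ), Complex.norm_real,
              Real.norm_of_nonneg (by positivity)]
        _ = besselDensity σ r * ‖dilConv X heatKernel r v x‖ₑ +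
            besselDensity σ r * ENNReal.ofReal (r⁻¹ ^ 2) * ‖dilConv X k₂ r v x‖ₑ := by ring
        _ ≤ _ := by
            rw [mul_add]
            gcongr
            · exact enorm_dilConv_le _ hr v x
            · exact enorm_dilConv_le _ hr v x
  have hp1 : 1 ≤ ENNReal.ofReal p := by simpa using hp.le
  have M₁ := (measurable_avgConv heatKernel m₁ w).aestronglyMeasurable (μ := powerMeasure γ)
  have M₂ := (measurable_avgConv heatKernel m₂ v).aestronglyMeasurable (μ := powerMeasure γ)
  have M₃ := (measurable_avgConv k₂ m₂ v).aestronglyMeasurable (μ := powerMeasure γ)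
  set Nw := eLpNorm w (ENNReal.ofReal p) (powerMeasure γ)
  set Nv := eLpNorm v (ENNReal.ofReal p) (powerMeasure γ)
  have eτ₁ : ((c / σ * τ ^ σ).toNNReal : ℝ≥0∞) =
      ((c / σ).toNNReal : ℝ≥0) * ENNReal.ofReal (τ ^ σ) := by
    rw [Real.toNNReal_mul (by positivity), ENNReal.coe_mul, ENNReal.ofReal]
  have eτ₂ : ((2 * c / (2 - σ) * τ ^ (σ - 2)).toNNReal : ℝ≥0∞) =
      ((2 * c / (2 - σ)).toNNReal : ℝ≥0) * ENNReal.ofReal (τ ^ (σ - 2)) := by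
    rw [Real.toNNReal_mul (div_nonneg (by positivity) (by linarith)), ENNReal.coe_mul,
      ENNReal.ofReal]
  calc eLpNorm (schwartzBessel X (2 - σ) v) (ENNReal.ofReal p) (powerMeasure γ)
      ≤ eLpNorm (avgConv heatKernel a₁ w + (avgConv heatKernel a₂ v + avgConv k₂ a₂ v))
          (ENNReal.ofReal p) (powerMeasure γ) := eLpNorm_mono_enorm hpt
    _ ≤ C₀ * ((c / σ * τ ^ σ).toNNReal : ℝ≥0) * Nw +
        (C₀ * ((2 * c / (2 - σ) * τ ^ (σ - 2)).toNNReal : ℝ≥0) * Nv +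
          C₂ * ((2 * c / (2 - σ) * τ ^ (σ - 2)).toNNReal : ℝ≥0) * Nv) := by
        refine (eLpNorm_add_le M₁ (M₂.add M₃) hp1).trans (add_le_add (h₀ _ a₁ w m₁ i₁.le) ?_)
        exact (eLpNorm_add_le M₂ M₃ hp1).trans
          (add_le_add (h₀ _ a₂ v m₂ i₂.le) (h₂ _ a₂ v m₂ i₂.le))
    _ = ((C₀ * (c / σ).toNNReal : ℝ≥0) : ℝ≥0∞) * (ENNReal.ofReal (τ ^ σ) * Nw) +
        (((C₀ + C₂) * (2 * c / (2 - σ)).toNNReal : ℝ≥0) : ℝ≥0∞) *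
          (ENNReal.ofReal (τ ^ (σ - 2)) * Nv) := by
        rw [eτ₁, eτ₂]
        push_cast
        ring
    _ ≤ _ := by
        rw [mul_add]
        gcongr
        · exact le_max_left _ _
        · exact le_max_right _ _

end Weighted

end

section

variable {X : Type*} [NormedAddCommGroup X] [NormedSpace ℂ X] [CompleteSpace X]

/-! ### Schwartz functions in the weighted Bessel potential spaces -/

theorem isInducedBy_schwartz (ψ : 𝓢(ℝ, X)) {g : ℝ → X} (hg : g =ᵐ[volume] ψ) :
    IsInducedBy (ψ : 𝓢'(ℝ, X)) g := by
  intro φ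
  have e : (fun x => φ x • g x) =ᵐ[volume] fun x => φ x • ψ x := by
    filter_upwards [hg] with x hx
    rw [hx]
  have h1 : Integrable fun x => φ x • ψ x :=
    (SchwartzMap.pairing (ContinuousLinearMap.lsmul ℂ ℂ : ℂ →L[ℂ] X →L[ℂ] X) φ ψ).integrable
  refine ⟨h1.congr e.symm, ?_⟩
  rw [integral_congr_ae e]
  exact SchwartzMap.toTemperedDistributionCLM_apply_apply volume ψ φ

theorem bessel_schwartz (s : ℝ) (φ : 𝓢(ℝ, X)) :
    bessel X s (φ : 𝓢'(ℝ, X)) = (schwartzBessel X s φ : 𝓢'(ℝ, X)) :=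
  fourierMultiplierCLM_toTemperedDistributionCLM_eq (besselSymbol_hasTemperateGrowth s) φ

section

variable {s p γ : ℝ} [hp : Fact (1 < p)] [hμ : (powerMeasure γ).HasTemperateGrowth]

variable (s p γ) in
theorem isInducedBy_bessel_schwartz (φ : 𝓢(ℝ, X)) :
    IsInducedBy (bessel X s (φ : 𝓢'(ℝ, X)))
      ((schwartzBessel X s φ).toLp (ENNReal.ofReal p) (powerMeasure γ)) := by
  rw [bessel_schwartz]
  exact isInducedBy_schwartz _ ((volume_absolutelyContinuous_powerMeasure γ).ae_le
    ((schwartzBessel X s φ).coeFn_toLp _ _))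

variable (X s p γ) in
/-- The inclusion of the Schwartz functions in `H^{s,p}(ℝ, w_γ; X)`. -/
def ofSchwartz : 𝓢(ℝ, X) →ₗ[ℂ] BesselSpace X s p γ where
  toFun φ := ⟨(φ : 𝓢'(ℝ, X)), _, isInducedBy_bessel_schwartz s p γ φ⟩
  map_add' φ ψ := BesselSpace.toTempered_injective
    (map_add (SchwartzMap.toTemperedDistributionCLM ℝ X volume) φ ψ)
  map_smul' c φ := BesselSpace.toTempered_injective
    (map_smul (SchwartzMap.toTemperedDistributionCLM ℝ X volume) c φ)

theorem toLp_ofSchwartz (φ : 𝓢(ℝ, X)) : (ofSchwartz X s p γ φ).toLp =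
    (schwartzBessel X s φ).toLp (ENNReal.ofReal p) (powerMeasure γ) :=
  BesselSpace.lp_unique (BesselSpace.toLp_spec _) (isInducedBy_bessel_schwartz s p γ φ)

theorem enorm_ofSchwartz (φ : 𝓢(ℝ, X)) : ‖ofSchwartz X s p γ φ‖ₑ =
    eLpNorm (schwartzBessel X s φ) (ENNReal.ofReal p) (powerMeasure γ) := by
  rw [← ofReal_norm, BesselSpace.norm_eq, toLp_ofSchwartz, SchwartzMap.norm_toLp,
    ENNReal.ofReal_toReal ((schwartzBessel X s φ).eLpNorm_lt_top _ _).ne]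

theorem norm_sub_eq_toLp (f g : BesselSpace X s p γ) : ‖f - g‖ = ‖f.toLp - g.toLp‖ := by
  rw [BesselSpace.norm_eq, map_sub]

theorem continuous_ofSchwartz : Continuous (ofSchwartz X s p γ) := by
  refine continuous_iff_continuousAt.mpr fun φ => ?_
  rw [ContinuousAt, tendsto_iff_norm_sub_tendsto_zero]
  have hc : Continuous fun ψ : 𝓢(ℝ, X) => SchwartzMap.toLpCLM ℂ X (ENNReal.ofReal p)
      (powerMeasure γ) (schwartzBessel X s ψ) :=
    (ContinuousLinearMap.continuous _).comp (ContinuousLinearMap.continuous _)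
  have h := (tendsto_iff_norm_sub_tendsto_zero.mp (hc.tendsto φ))
  refine h.congr fun ψ => ?_
  rw [norm_sub_eq_toLp, toLp_ofSchwartz, toLp_ofSchwartz]
  rfl

theorem denseRange_ofSchwartz [IsFiniteMeasureOnCompacts (powerMeasure γ)] :
    DenseRange (ofSchwartz X s p γ) := by
  intro f
  rw [Metric.mem_closure_range_iff]
  intro ε hε
  have hd := SchwartzMap.denseRange_toLpCLM (E := ℝ) (F := X) (p := ENNReal.ofReal p)
    ENNReal.ofReal_ne_top (μ := powerMeasure γ)
  obtain ⟨ψ, hψ⟩ := Metric.mem_closure_range_iff.mp (hd f.toLp) ε hε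
  refine ⟨schwartzBessel X (-s) ψ, ?_⟩
  rw [dist_eq_norm, norm_sub_eq_toLp, toLp_ofSchwartz, schwartzBessel_schwartzBessel,
    neg_add_cancel, schwartzBessel_zero, ← dist_eq_norm]
  exact hψ

/-- Evaluation at a fixed Schwartz function is bounded on `H^{s,p}(ℝ, w_γ; X)`. -/
theorem exists_norm_toTempered_apply_le (hγ' : γ < p - 1) (ψ : 𝓢(ℝ, ℂ)) :
    ∃ C : ℝ, ∀ f : BesselSpace X s p γ, ‖f.toTempered ψ‖ ≤ C * ‖f‖ := by
  have hp0 : 0 < p := by linarith [hp.out]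
  set ψ' : 𝓢(ℝ, ℂ) := 𝓕 (SchwartzMap.smulLeftCLM ℂ (besselSymbol (-s)) (𝓕⁻ ψ)) with hψ'
  obtain ⟨C, hC⟩ := exists_lintegral_dilation_mul_le hp.out hγ' ψ'
  refine ⟨C, fun f => ?_⟩
  have e1 : f.toTempered ψ = bessel X s f.toTempered ψ' := by
    have h : f.toTempered = bessel X (-s) (bessel X s f.toTempered) := by
      rw [bessel_bessel, add_neg_cancel, bessel_zero]
    conv_lhs => rw [h]
    rfl
  have hg : Measurable fun y => ‖f.toLp y‖ₑ := (Lp.stronglyMeasurable f.toLp).enorm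
  have h1 := hC 1 (fun y => ‖f.toLp y‖ₑ) one_pos hg
  have h2 : ‖f.toTempered ψ‖ₑ ≤ C * ‖f‖ₑ := by
    rw [e1, (f.toLp_spec ψ').2]
    refine (enorm_integral_le_lintegral_enorm _).trans ?_
    have e2 : ‖f‖ₑ = (∫⁻ y, ‖f.toLp y‖ₑ ^ p ∂powerMeasure γ) ^ (1 / p) := by
      have h3 := eLpNorm_eq_lintegral_rpow_enorm_toReal (f := f.toLp) (μ := powerMeasure γ)
        (p := ENNReal.ofReal p) (by simpa using hp0) ENNReal.ofReal_ne_top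
      rw [ENNReal.toReal_ofReal hp0.le] at h3
      rw [← h3, ← ofReal_norm, BesselSpace.norm_eq, Lp.norm_def,
        ENNReal.ofReal_toReal (Lp.eLpNorm_ne_top _)]
    rw [Real.one_rpow, ENNReal.ofReal_one, mul_one, ← e2] at h1
    refine le_trans (le_of_eq ?_) h1
    refine lintegral_congr fun y => ?_
    simp [enorm_smul, dilation]
  have h4 := ENNReal.toReal_mono (by finiteness) h2
  simpa using h4

theorem isLocallyInducedBy_ofSchwartz (φ : 𝓢(ℝ, X)) :
    IsLocallyInducedBy (ofSchwartz X s p γ φ).toTempered φ :=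
  ⟨φ.continuous.locallyIntegrable, fun ψ _ =>
    SchwartzMap.toTemperedDistributionCLM_apply_apply volume φ ψ⟩

end

/-! ### Traces -/

theorem iterate_schwartzDeriv_apply (φ : 𝓢(ℝ, X)) (j : ℕ) (x : ℝ) :
    (schwartzDeriv X)^[j] φ x = iteratedDeriv j φ x := by
  induction j generalizing φ with
  | zero => simp
  | succ j ih =>
    rw [Function.iterate_succ_apply, ih, iteratedDeriv_succ']
    congr 1

variable (X) in
/-- The map `φ ↦ (φ(0), φ'(0), …, φ^{(n-1)}(0))` on Schwartz functions. -/
def schwartzJet (n : ℕ) : 𝓢(ℝ, X) →ₗ[ℂ] (Fin n → X) where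
  toFun φ j := (schwartzDeriv X)^[j] φ 0
  map_add' φ ψ := by
    ext j
    rw [iterate_map_add]
    rfl
  map_smul' c φ := by
    ext j
    have h : ∀ i : ℕ, (schwartzDeriv X)^[i] (c • φ) = c • (schwartzDeriv X)^[i] φ := by
      intro i
      induction i with
      | zero => rfl
      | succ i ih => rw [Function.iterate_succ_apply', ih, map_smul, Function.iterate_succ_apply']
    rw [h]
    rfl

theorem schwartzJet_apply (n : ℕ) (φ : 𝓢(ℝ, X)) (j : Fin n) :
    schwartzJet X n φ j = (schwartzDeriv X)^[j] φ 0 := rfl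

section

variable {s p γ : ℝ} [hp : Fact (1 < p)] [hμ : (powerMeasure γ).HasTemperateGrowth]

theorem exists_norm_schwartzJet_le (hγ : -1 < γ) (hγ' : γ < p - 1) {n : ℕ}
    (hs : ∀ j < n, j + (1 + γ) / p < s) :
    ∃ C : ℝ, ∀ φ : 𝓢(ℝ, X), ‖schwartzJet X n φ‖ ≤ C * ‖ofSchwartz X s p γ φ‖ := by
  have h : ∀ j : Fin n, ∃ C : ℝ≥0, ∀ φ : 𝓢(ℝ, X),
      ‖(schwartzDeriv X)^[j] φ 0‖ ≤ C * ‖ofSchwartz X s p γ φ‖ := by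
    intro j
    obtain ⟨C, hC⟩ := exists_enorm_iterate_schwartzDeriv_zero_le (X := X) hp.out hγ hγ'
      (hs j j.2)
    refine ⟨C, fun φ => ?_⟩
    have h1 := hC φ
    rw [← enorm_ofSchwartz] at h1
    simpa using ENNReal.toReal_mono (by finiteness) h1
  choose C hC using h
  refine ⟨∑ j, (C j : ℝ), fun φ => ?_⟩
  refine (pi_norm_le_iff_of_nonneg (by positivity)).mpr fun j => ?_
  refine (hC j φ).trans ?_
  gcongr
  exact Finset.single_le_sum (f := fun j => (C j : ℝ)) (fun i _ => by positivity)
    (Finset.mem_univ j)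

variable (X s p γ) in
/-- The trace operator on `H^{s,p}(ℝ, w_γ; X)`: the continuous extension of `schwartzJet`. -/
def besselTrace (n : ℕ) : BesselSpace X s p γ →L[ℂ] (Fin n → X) :=
  (schwartzJet X n).extendOfNorm (ofSchwartz X s p γ)

theorem besselTrace_ofSchwartz [IsFiniteMeasureOnCompacts (powerMeasure γ)]
    (hγ : -1 < γ) (hγ' : γ < p - 1) {n : ℕ} (hs : ∀ j < n, j + (1 + γ) / p < s) (φ : 𝓢(ℝ, X)) :
    besselTrace X s p γ n (ofSchwartz X s p γ φ) = schwartzJet X n φ :=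
  LinearMap.extendOfNorm_eq (f := schwartzJet X n) (e := ofSchwartz X s p γ)
    (denseRange_ofSchwartz (X := X)) (exists_norm_schwartzJet_le (X := X) hγ hγ' hs) φ

end

/-! ### One-sided mollifiers -/

/-- A smooth bump function supported in `[1, 2]`. -/
def unitBump : ContDiffBump (3 / 2 : ℝ) := ⟨1 / 4, 1 / 2, by norm_num, by norm_num⟩

theorem hasCompactSupport_unitBump :
    HasCompactSupport fun x => ((unitBump.normed volume x : ℝ) : ℂ) :=
  unitBump.hasCompactSupport_normed.comp_left (g := Complex.ofReal) Complex.ofReal_zero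

/-- A nonnegative smooth function of integral one supported in `[1, 2]`. -/
def mollifier : 𝓢(ℝ, ℂ) :=
  hasCompactSupport_unitBump.toSchwartzMap
    (Complex.ofRealCLM.contDiff.comp unitBump.contDiff_normed)

theorem mollifier_apply (x : ℝ) : mollifier x = (unitBump.normed volume x : ℝ) := rfl

theorem integral_mollifier : ∫ x, mollifier x = 1 := by
  simp_rw [mollifier_apply]
  rw [integral_complex_ofReal, unitBump.integral_normed, Complex.ofReal_one]

theorem tsupport_mollifier_subset : tsupport mollifier ⊆ Set.Icc 1 2 := by
  have h1 : tsupport mollifier ⊆ tsupport (unitBump.normed volume) :=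
    tsupport_comp_subset Complex.ofReal_zero _
  refine h1.trans ?_
  rw [unitBump.tsupport_normed_eq, Real.closedBall_eq_Icc]
  exact Set.Icc_subset_Icc (by norm_num [unitBump]) (by norm_num [unitBump])

/-- The dilated mollifier `ε⁻¹ ρ(· / ε)`, supported in `[ε, 2 ε]`. -/
def dilMollifier {ε : ℝ} (hε : 0 < ε) : 𝓢(ℝ, ℂ) :=
  ((ε⁻¹ : ℝ) : ℂ) • SchwartzMap.compCLMOfContinuousLinearEquiv ℂ
    (mulEquiv (inv_pos.mpr hε).ne') mollifier

theorem dilMollifier_apply {ε : ℝ} (hε : 0 < ε) (x : ℝ) :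
    dilMollifier hε x = (ε⁻¹ : ℝ) * mollifier (ε⁻¹ * x) := by
  simp [dilMollifier, mulEquiv_apply]

theorem tsupport_iterate_dilMollifier_subset {ε : ℝ} (hε : 0 < ε) (j : ℕ) :
    tsupport ((schwartzDeriv ℂ)^[j] (dilMollifier hε)) ⊆ Set.Icc ε (2 * ε) := by
  induction j with
  | zero =>
    refine closure_minimal (fun x hx => ?_) isClosed_Icc
    have h1 : ε⁻¹ * x ∈ tsupport mollifier := by
      refine subset_tsupport _ fun h => hx ?_
      rw [Function.iterate_zero_apply, dilMollifier_apply, h, mul_zero]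
    obtain ⟨h2, h3⟩ := tsupport_mollifier_subset h1
    rw [inv_mul_eq_div] at h2 h3
    exact ⟨by rwa [le_div_iff₀ hε, one_mul] at h2, by rwa [div_le_iff₀ hε] at h3⟩
  | succ j ih =>
    rw [Function.iterate_succ_apply']
    exact (SchwartzMap.tsupport_derivCLM_subset ℂ _).trans ih

theorem hasCompactSupport_iterate_dilMollifier {ε : ℝ} (hε : 0 < ε) (j : ℕ) :
    HasCompactSupport ((schwartzDeriv ℂ)^[j] (dilMollifier hε)) :=
  isCompact_Icc.of_isClosed_subset (isClosed_tsupport _)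
    (tsupport_iterate_dilMollifier_subset hε j)

/-- Repeated integration by parts against a compactly supported smooth function. -/
theorem integral_iterate_schwartzDeriv_smul {ψ : 𝓢(ℝ, ℂ)}
    (hψ : ∀ j, HasCompactSupport ((schwartzDeriv ℂ)^[j] ψ)) (j : ℕ) {u : ℝ → X}
    (hu : ContDiff ℝ j u) :
    ∫ x, (schwartzDeriv ℂ)^[j] ψ x • u x = (-1 : ℂ) ^ j • ∫ x, ψ x • iteratedDeriv j u x := by
  induction j generalizing u with
  | zero => simp
  | succ j ih =>
    have hu1 : ContDiff ℝ 1 u := hu.of_le (by norm_cast; omega)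
    have hu' : ContDiff ℝ j (deriv u) := by
      have h : ContDiff ℝ ((j : WithTop ℕ∞) + 1) u := by exact_mod_cast hu
      exact (contDiff_succ_iff_deriv.mp h).2.2
    have hd : Continuous (deriv u) := hu'.continuous
    set χ := (schwartzDeriv ℂ)^[j] ψ with hχ
    have h1 : ∀ x, HasDerivAt χ (schwartzDeriv ℂ χ x) x := fun x => by
      simpa using χ.hasDerivAt x
    have h2 : ∀ x, HasDerivAt u (deriv u x) x := fun x =>
      (hu1.differentiable one_ne_zero x).hasDerivAt
    have hχ' : HasCompactSupport (schwartzDeriv ℂ χ) := by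
      have := hψ (j + 1)
      rwa [Function.iterate_succ_apply'] at this
    have h3 := integral_bilinear_hasDerivAt_right_eq_neg_left_of_integrable
      (L := ContinuousLinearMap.lsmul ℝ ℂ) (u := χ) (u' := schwartzDeriv ℂ χ) (v := u)
      (v' := deriv u) (fun x _ => h1 x) (fun x _ => h2 x)
      ((χ.continuous.smul hd).integrable_of_hasCompactSupport (hψ j).smul_right)
      (((schwartzDeriv ℂ χ).continuous.smul hu1.continuous).integrable_of_hasCompactSupport
        hχ'.smul_right)
      ((χ.continuous.smul hu1.continuous).integrable_of_hasCompactSupport (hψ j).smul_right)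
    have h4 := ih hu'
    simp only [ContinuousLinearMap.lsmul_apply] at h3
    rw [Function.iterate_succ_apply', ← hχ, ← neg_eq_iff_eq_neg.mpr h3, h4, iteratedDeriv_succ',
      pow_succ, mul_neg_one, neg_smul]

theorem integral_dilMollifier_smul {ε : ℝ} (hε : 0 < ε) (h : ℝ → X) :
    ∫ x, dilMollifier hε x • h x = ∫ z, mollifier z • h (ε * z) := by
  have h1 := Measure.integral_comp_mul_left (fun x => mollifier (ε⁻¹ * x) • h x) ε
  rw [abs_of_pos (inv_pos.mpr hε)] at h1
  simp only [inv_mul_cancel_left₀ hε.ne'] at h1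
  rw [h1, ← integral_smul]
  refine integral_congr_ae (Eventually.of_forall fun x => ?_)
  dsimp only
  rw [dilMollifier_apply, mul_smul, Complex.coe_smul]

theorem continuous_integral_mollifier_smul {h : ℝ → X} (hh : Continuous h) :
    Continuous fun ε : ℝ => ∫ z, mollifier z • h (ε * z) := by
  have h1 := continuous_parametric_integral_of_continuous (μ := volume)
    (f := fun (ε z : ℝ) => mollifier z • h (ε * z)) (by
      have := mollifier.continuous
      unfold Function.uncurry
      fun_prop) (isCompact_Icc (a := (1 : ℝ)) (b := 2))
  refine h1.congr fun ε => ?_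
  refine setIntegral_eq_integral_of_forall_compl_eq_zero fun z hz => ?_
  rw [image_eq_zero_of_notMem_tsupport fun h => hz (tsupport_mollifier_subset h), zero_smul]

theorem integral_mollifier_smul_zero (h : ℝ → X) : ∫ z, mollifier z • h (0 * z) = h 0 := by
  simp only [zero_mul]
  rw [integral_smul_const, integral_mollifier, one_smul]

/-- The mollified evaluation `f ↦ (-1) ^ j f(ρ_ε^{(j)})` of the `j`-th derivative at the origin. -/
def mollEval {ε : ℝ} (hε : 0 < ε) (j : ℕ) (f : 𝓢'(ℝ, X)) : X :=
  (-1 : ℂ) ^ j • f ((schwartzDeriv ℂ)^[j] (dilMollifier hε))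

theorem mollEval_eq_of_isLocallyInducedBy {ε : ℝ} (hε : 0 < ε) {j : ℕ} {f : 𝓢'(ℝ, X)} {u : ℝ → X}
    (hu : ContDiff ℝ j u) (hf : IsLocallyInducedBy f u) :
    mollEval hε j f = ∫ z, mollifier z • iteratedDeriv j u (ε * z) := by
  rw [mollEval, hf.2 _ (hasCompactSupport_iterate_dilMollifier hε j),
    integral_iterate_schwartzDeriv_smul (hasCompactSupport_iterate_dilMollifier hε) j hu,
    smul_smul, ← mul_pow, neg_one_mul, neg_neg, one_pow, one_smul, integral_dilMollifier_smul]

section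

variable {s p γ : ℝ} [hp : Fact (1 < p)] [hμ : (powerMeasure γ).HasTemperateGrowth]
  [IsFiniteMeasureOnCompacts (powerMeasure γ)]

/-- The mollified evaluations are bounded uniformly in `ε`: on Schwartz functions they evaluate the
`j`-th derivative of a mollification at the origin. -/
theorem exists_norm_mollEval_le (hγ : -1 < γ) (hγ' : γ < p - 1) {j : ℕ}
    (hs : j + (1 + γ) / p < s) : ∃ C : ℝ, ∀ (ε : ℝ) (hε : 0 < ε) (f : BesselSpace X s p γ),
      ‖mollEval hε j f.toTempered‖ ≤ C * ‖f‖ := by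
  -- convolution with the reflected mollifiers commutes with `(1 - Δ) ^ (s / 2)`
  set k : 𝓢(ℝ, ℂ) := SchwartzMap.compCLMOfContinuousLinearEquiv ℂ
    (mulEquiv (neg_ne_zero.mpr one_ne_zero)) mollifier with hk
  have hka : ∀ z, k z = mollifier (-z) := fun z => by simp [hk, mulEquiv_apply]
  obtain ⟨C₁, h₁⟩ := exists_eLpNorm_dilConv_le (X := X) hp.out hγ hγ' k
  obtain ⟨C₂, h₂⟩ := exists_enorm_iterate_schwartzDeriv_zero_le (X := X) hp.out hγ hγ' hs
  refine ⟨C₂ * C₁, fun ε hε f => ?_⟩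
  obtain ⟨Cψ, hψ⟩ := exists_norm_toTempered_apply_le (X := X) (s := s) (p := p) (γ := γ) hγ'
    ((schwartzDeriv ℂ)^[j] (dilMollifier hε))
  let ℓ : BesselSpace X s p γ →ₗ[ℂ] X :=
    { toFun := fun f => mollEval hε j f.toTempered
      map_add' := fun f g => by
        rw [mollEval, map_add]
        exact smul_add _ _ _
      map_smul' := fun c f => by
        rw [mollEval, map_smul]
        exact smul_comm _ _ _ }
  have hℓ : Continuous ℓ := by
    refine AddMonoidHomClass.continuous_of_bound ℓ Cψ fun f => ?_
    have e : ℓ f = (-1 : ℂ) ^ j • f.toTempered ((schwartzDeriv ℂ)^[j] (dilMollifier hε)) := rfl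
    rw [e, norm_smul, norm_pow, norm_neg, norm_one, one_pow, one_mul]
    exact hψ f
  change ‖ℓ f‖ ≤ _
  refine (denseRange_ofSchwartz (X := X) (s := s) (p := p) (γ := γ)).induction_on
    (p := fun f => ‖ℓ f‖ ≤ C₂ * C₁ * ‖f‖) f
    (isClosed_le hℓ.norm (continuous_const.mul continuous_norm)) fun φ => ?_
  have e : ℓ (ofSchwartz X s p γ φ) = (schwartzDeriv X)^[j] (dilConv X k ε φ) 0 := by
    change mollEval hε j _ = _
    rw [mollEval_eq_of_isLocallyInducedBy hε ((φ.smooth ⊤).of_le (mod_cast le_top))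
      (isLocallyInducedBy_ofSchwartz φ), ← integral_dilMollifier_smul hε, dilConv,
      iterate_schwartzDeriv_fourierMultiplierCLM (hasTemperateGrowth_fourier_comp_mul _ _),
      ← dilConv, dilConv_apply k hε]
    refine integral_congr_ae (Eventually.of_forall fun y => ?_)
    dsimp only
    rw [dilMollifier_apply, hka, iterate_schwartzDeriv_apply]
    congr 3
    ring
  have h3 := h₂ (dilConv X k ε φ)
  rw [schwartzBessel_dilConv] at h3
  have h4 := h₁ ε (schwartzBessel X s φ) hε
  rw [← enorm_ofSchwartz] at h4
  have h5 : ‖ℓ (ofSchwartz X s p γ φ)‖ₑ ≤ C₂ * (C₁ * ‖ofSchwartz X s p γ φ‖ₑ) := by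
    rw [e]
    exact h3.trans (by gcongr)
  have h6 := ENNReal.toReal_mono (by finiteness) h5
  simpa [mul_assoc] using h6

/-- The traces are limits of mollified evaluations, by uniform boundedness and density. -/
theorem exists_norm_mollEval_sub_besselTrace_lt (hγ : -1 < γ) (hγ' : γ < p - 1) {n : ℕ}
    (hs : ∀ j < n, j + (1 + γ) / p < s) (j : Fin n) (f : BesselSpace X s p γ) {η : ℝ}
    (hη : 0 < η) : ∃ ε₀ > 0, ∀ (ε : ℝ) (hε : 0 < ε), ε < ε₀ →
      ‖mollEval hε j f.toTempered - besselTrace X s p γ n f j‖ < η := by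
  obtain ⟨C, hC⟩ := exists_norm_mollEval_le (X := X) (s := s) hγ hγ' (hs j j.2)
  set T := besselTrace X s p γ n with hT
  set M := |C| + ‖T‖ + 1 with hM
  have hM0 : 0 < M := by positivity
  obtain ⟨φ, hφ⟩ := Metric.mem_closure_range_iff.mp
    (denseRange_ofSchwartz (X := X) (s := s) (p := p) (γ := γ) f) (η / (2 * M)) (by positivity)
  rw [dist_eq_norm] at hφ
  set g := ofSchwartz X s p γ φ with hg
  have hφs : ContDiff ℝ ((j : ℕ) + 1 : ℕ) φ := (φ.smooth ⊤).of_le (mod_cast le_top)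
  have hcont := continuous_integral_mollifier_smul
    (hφs.continuous_iteratedDeriv j (by exact_mod_cast Nat.le_succ _))
  have htend := hcont.tendsto 0
  rw [integral_mollifier_smul_zero, Metric.tendsto_nhds_nhds] at htend
  obtain ⟨ε₀, hε₀, H⟩ := htend (η / 2) (by positivity)
  refine ⟨ε₀, hε₀, fun ε hε hlt => ?_⟩
  have h1 : ‖mollEval hε j g.toTempered - T g j‖ < η / 2 := by
    have h2 := H (x := ε) (by simpa [abs_of_pos hε] using hlt)
    rw [hg, hT, besselTrace_ofSchwartz hγ hγ' hs, schwartzJet_apply, iterate_schwartzDeriv_apply,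
      mollEval_eq_of_isLocallyInducedBy hε (hφs.of_le (by exact_mod_cast Nat.le_succ _))
      (isLocallyInducedBy_ofSchwartz φ), ← dist_eq_norm]
    exact h2
  have h3 : mollEval hε j f.toTempered - T f j = mollEval hε j (f - g).toTempered +
      (mollEval hε j g.toTempered - T g j) - T (f - g) j := by
    have e1 : mollEval hε j (f - g).toTempered =
        mollEval hε j f.toTempered - mollEval hε j g.toTempered := by
      rw [mollEval, map_sub]
      exact smul_sub _ _ _
    rw [e1, map_sub, Pi.sub_apply]
    abel
  have h4 : ‖mollEval hε j (f - g).toTempered‖ ≤ |C| * ‖f - g‖ :=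
    (hC ε hε _).trans (by gcongr; exact le_abs_self C)
  have h5 : ‖T (f - g) j‖ ≤ ‖T‖ * ‖f - g‖ :=
    (norm_le_pi_norm (T (f - g)) j).trans (T.le_opNorm _)
  rw [h3]
  calc _ ≤ ‖mollEval hε j (f - g).toTempered + (mollEval hε j g.toTempered - T g j)‖ +
        ‖T (f - g) j‖ := norm_sub_le _ _
    _ ≤ ‖mollEval hε j (f - g).toTempered‖ + ‖mollEval hε j g.toTempered - T g j‖ +
        ‖T (f - g) j‖ := by
        gcongr
        exact norm_add_le _ _
    _ < |C| * ‖f - g‖ + η / 2 + ‖T‖ * ‖f - g‖ := by linarith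
    _ ≤ M * ‖f - g‖ + η / 2 := by
        have := norm_nonneg (f - g)
        rw [hM]
        linarith
    _ ≤ M * (η / (2 * M)) + η / 2 := by gcongr
    _ = η := by
        field_simp
        norm_num

/-- The trace of an element of `H^{s,p}(ℝ, w_γ; X)` that is a `C^m` function is given by its
derivatives at the origin. -/
theorem besselTrace_apply_of_isLocallyInducedBy (hγ : -1 < γ) (hγ' : γ < p - 1) {n : ℕ}
    (hs : ∀ j < n, j + (1 + γ) / p < s) (j : Fin n) (f : BesselSpace X s p γ) {u : ℝ → X}
    (hu : ContDiff ℝ (j : ℕ) u) (hf : IsLocallyInducedBy f.toTempered u) :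
    besselTrace X s p γ n f j = iteratedDeriv j u 0 := by
  have htend :=
    (continuous_integral_mollifier_smul (hu.continuous_iteratedDeriv j le_rfl)).tendsto 0
  rw [integral_mollifier_smul_zero, Metric.tendsto_nhds_nhds] at htend
  refine eq_of_forall_dist_le fun η hη => ?_
  obtain ⟨ε₁, hε₁, H₁⟩ := htend (η / 2) (by positivity)
  obtain ⟨ε₂, hε₂, H₂⟩ := exists_norm_mollEval_sub_besselTrace_lt hγ hγ' hs j f
    (show 0 < η / 2 by positivity)
  have hε : 0 < min ε₁ ε₂ / 2 := by positivity
  have hlt : min ε₁ ε₂ / 2 < min ε₁ ε₂ := half_lt_self (by positivity)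
  have h1 := H₁ (x := min ε₁ ε₂ / 2) (by
    rw [Real.dist_eq, sub_zero, abs_of_pos hε]
    exact hlt.trans_le (min_le_left _ _))
  have h2 := H₂ _ hε (hlt.trans_le (min_le_right _ _))
  rw [mollEval_eq_of_isLocallyInducedBy hε hu hf, ← dist_eq_norm] at h2
  calc _ ≤ _ := dist_triangle_left _ _ (∫ z, mollifier z • iteratedDeriv j u (min ε₁ ε₂ / 2 * z))
    _ ≤ η / 2 + η / 2 := add_le_add h2.le h1.le
    _ = η := add_halves η

/-- A tempered distribution that vanishes on `ℝ₊` is annihilated by all complex valued test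
functions supported there. -/
theorem apply_eq_zero_of_restrictTo_eq_zero {f : 𝓢'(ℝ, X)} (hf : restrictTo X halfLine f = 0)
    {ψ : 𝓢(ℝ, ℂ)} (hψ : HasCompactSupport ψ) (hψ' : tsupport ψ ⊆ Set.Ioi 0) : f ψ = 0 := by
  have hre : tsupport (fun x => (ψ x).re) ⊆ tsupport ψ :=
    tsupport_comp_subset (g := Complex.re) Complex.zero_re ψ
  have him : tsupport (fun x => (ψ x).im) ⊆ tsupport ψ :=
    tsupport_comp_subset (g := Complex.im) Complex.zero_im ψ
  let φ₁ : 𝓓(halfLine, ℝ) := ⟨fun x => (ψ x).re,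
    Complex.reCLM.contDiff.comp (ψ.smooth ⊤), hψ.comp_left (g := Complex.re) Complex.zero_re,
    hre.trans hψ'⟩
  let φ₂ : 𝓓(halfLine, ℝ) := ⟨fun x => (ψ x).im,
    Complex.imCLM.contDiff.comp (ψ.smooth ⊤), hψ.comp_left (g := Complex.im) Complex.zero_im,
    him.trans hψ'⟩
  have e : ψ = extendTest halfLine φ₁ + Complex.I • extendTest halfLine φ₂ := by
    ext x
    change ψ x = ((ψ x).re : ℂ) + Complex.I * ((ψ x).im : ℂ)
    rw [mul_comm, Complex.re_add_im]
  have h1 : f (extendTest halfLine φ₁) = 0 := by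
    rw [← restrictTo_apply, hf]
    rfl
  have h2 : f (extendTest halfLine φ₂) = 0 := by
    rw [← restrictTo_apply, hf]
    rfl
  rw [e, map_add, map_smul, h1, h2, smul_zero, add_zero]

/-- The mollifiers being supported in `ℝ₊`, the trace only depends on the restriction to `ℝ₊`. -/
theorem besselTrace_eq_zero_of_restrict_eq_zero (hγ : -1 < γ) (hγ' : γ < p - 1) {n : ℕ}
    (hs : ∀ j < n, j + (1 + γ) / p < s) {f : BesselSpace X s p γ}
    (hf : restrictHalfLine X s p γ f = 0) : besselTrace X s p γ n f = 0 := by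
  funext j
  refine eq_of_forall_dist_le fun η hη => ?_
  obtain ⟨ε₀, hε₀, H⟩ := exists_norm_mollEval_sub_besselTrace_lt hγ hγ' hs j f hη
  have hε : 0 < ε₀ / 2 := by positivity
  have h := H _ hε (half_lt_self hε₀)
  have h0 : mollEval hε j f.toTempered = 0 := by
    rw [mollEval, apply_eq_zero_of_restrictTo_eq_zero hf
      (hasCompactSupport_iterate_dilMollifier hε j)
      ((tsupport_iterate_dilMollifier_subset hε j).trans fun x hx => hε.trans_le hx.1), smul_zero]
  rw [h0, ← dist_eq_norm, dist_comm] at h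
  exact h.le

end

/-! ### Cutting off near the origin -/

theorem iterate_schwartzDeriv_smul (j : ℕ) (c : ℂ) (φ : 𝓢(ℝ, X)) :
    (schwartzDeriv X)^[j] (c • φ) = c • (schwartzDeriv X)^[j] φ := by
  induction j with
  | zero => rfl
  | succ j ih => rw [Function.iterate_succ_apply', ih, map_smul, Function.iterate_succ_apply']

theorem hasDerivAt_schwartz (φ : 𝓢(ℝ, X)) (x : ℝ) : HasDerivAt φ (schwartzDeriv X φ x) x := by
  simpa using φ.hasDerivAt x

/-- A Schwartz function whose derivatives of order `< e` vanish at the origin is `O(|x| ^ e)`. -/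
theorem exists_norm_le_mul_abs_pow (e : ℕ) (φ : 𝓢(ℝ, X))
    (h : ∀ j < e, (schwartzDeriv X)^[j] φ 0 = 0) :
    ∃ C : ℝ, 0 ≤ C ∧ ∀ x, ‖φ x‖ ≤ C * |x| ^ e := by
  induction e generalizing φ with
  | zero =>
    exact ⟨SchwartzMap.seminorm ℝ 0 0 φ, apply_nonneg _ _, fun x => by
      simpa using φ.norm_le_seminorm ℝ x⟩
  | succ e ih =>
    obtain ⟨C, hC0, hC⟩ := ih (schwartzDeriv X φ) fun j hj => by
      rw [← Function.iterate_succ_apply]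
      exact h (j + 1) (by omega)
    refine ⟨C, hC0, fun x => ?_⟩
    have h1 := (convex_closedBall (0 : ℝ) |x|).norm_image_sub_le_of_norm_hasDerivWithin_le
      (f := φ) (f' := schwartzDeriv X φ) (C := C * |x| ^ e) (x := 0) (y := x)
      (fun y _ => (hasDerivAt_schwartz φ y).hasDerivWithinAt) (fun y hy => by
        exact (hC y).trans (mul_le_mul_of_nonneg_left
          (pow_le_pow_left₀ (abs_nonneg y) (mem_closedBall_zero_iff.mp hy) e) hC0))
      (by simp) (by simp)
    have h0 : φ 0 = 0 := h 0 (by omega)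
    rw [h0, sub_zero, sub_zero, Real.norm_eq_abs, mul_assoc, ← pow_succ] at h1
    exact h1

variable (X) in
/-- Multiplication of Schwartz functions by the dilated cutoff function `χ(R ·)`. -/
def cutoffMul (χ : 𝓢(ℝ, ℂ)) (R : ℝ) : 𝓢(ℝ, X) →L[ℂ] 𝓢(ℝ, X) :=
  SchwartzMap.smulLeftCLM X fun x => χ (R * x)

theorem cutoffMul_apply (χ : 𝓢(ℝ, ℂ)) (R : ℝ) (φ : 𝓢(ℝ, X)) (x : ℝ) :
    cutoffMul X χ R φ x = χ (R * x) • φ x :=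
  SchwartzMap.smulLeftCLM_apply_apply (hasTemperateGrowth_comp_mul χ.hasTemperateGrowth R) φ x

theorem schwartzDeriv_cutoffMul (χ : 𝓢(ℝ, ℂ)) (R : ℝ) (φ : 𝓢(ℝ, X)) :
    schwartzDeriv X (cutoffMul X χ R φ) =
      (R : ℂ) • cutoffMul X (schwartzDeriv ℂ χ) R φ + cutoffMul X χ R (schwartzDeriv X φ) := by
  ext x
  have h1 : HasDerivAt (fun x => χ (R * x)) (R • schwartzDeriv ℂ χ (R * x)) x := by
    have h := (hasDerivAt_schwartz χ (R * x)).scomp x ((hasDerivAt_id x).const_mul R)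
    rw [mul_one] at h
    exact h
  have h2 := h1.smul (hasDerivAt_schwartz φ x)
  have h3 : (cutoffMul X χ R φ : ℝ → X) = fun x => χ (R * x) • φ x :=
    funext fun x => cutoffMul_apply χ R φ x
  have h4 := hasDerivAt_schwartz (cutoffMul X χ R φ) x
  rw [h3] at h4
  rw [h4.unique h2, add_apply, smul_apply, cutoffMul_apply,
    cutoffMul_apply, add_comm, smul_smul, Complex.real_smul]

theorem iterate_succ_cutoffMul (χ : 𝓢(ℝ, ℂ)) (R : ℝ) (φ : 𝓢(ℝ, X)) (i : ℕ) (x : ℝ) :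
    (schwartzDeriv X)^[i + 1] (cutoffMul X χ R φ) x =
      (R : ℂ) • (schwartzDeriv X)^[i] (cutoffMul X (schwartzDeriv ℂ χ) R φ) x +
        (schwartzDeriv X)^[i] (cutoffMul X χ R (schwartzDeriv X φ)) x := by
  rw [Function.iterate_succ_apply, schwartzDeriv_cutoffMul, iterate_map_add,
    iterate_schwartzDeriv_smul]
  rfl

/-- A family of Schwartz functions with `u R` supported in `[-1 / R, 1 / R]` and with the size of
`R ^ (-a) η(R ·)`, including all derivatives, for a fixed smooth function `η`. -/
structure IsConcentrating (a : ℝ) (u : ℝ → 𝓢(ℝ, X)) : Prop where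
  eq_zero : ∀ R, 1 ≤ R → ∀ x, R⁻¹ < |x| → u R x = 0
  bound : ∀ i : ℕ, ∃ C : ℝ, 0 ≤ C ∧ ∀ R, 1 ≤ R → ∀ x,
    ‖(schwartzDeriv X)^[i] (u R) x‖ ≤ C * R ^ (i - a)

/-- Each derivative falling on the cutoff function costs a factor `R`, each one falling on `φ` lowers
its order of vanishing by one. -/
theorem isConcentrating_cutoffMul {χ : 𝓢(ℝ, ℂ)} (hχ : tsupport χ ⊆ Set.Icc (-1) 1) {e : ℕ}
    {φ : 𝓢(ℝ, X)} (h : ∀ j < e, (schwartzDeriv X)^[j] φ 0 = 0) :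
    IsConcentrating e fun R => cutoffMul X χ R φ := by
  have hzero : ∀ χ : 𝓢(ℝ, ℂ), tsupport χ ⊆ Set.Icc (-1) 1 → ∀ R, 1 ≤ R → ∀ x, R⁻¹ < |x| →
      χ (R * x) = 0 := by
    intro χ hχ R hR x hx
    refine image_eq_zero_of_notMem_tsupport fun hm => ?_
    have h1 := abs_le.mpr (hχ hm)
    have hR0 : 0 < R := by linarith
    rw [abs_mul, abs_of_pos hR0] at h1
    rw [inv_lt_iff_one_lt_mul₀ hR0] at hx
    linarith [mul_comm R |x|]
  refine ⟨fun R hR x hx => by rw [cutoffMul_apply, hzero χ hχ R hR x hx, zero_smul], fun i => ?_⟩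
  induction i generalizing χ φ e with
  | zero =>
    obtain ⟨C, hC0, hC⟩ := exists_norm_le_mul_abs_pow e φ h
    refine ⟨SchwartzMap.seminorm ℝ 0 0 χ * C, mul_nonneg (apply_nonneg _ _) hC0,
      fun R hR x => ?_⟩
    have hR0 : 0 < R := by linarith
    rw [Function.iterate_zero_apply, cutoffMul_apply, norm_smul]
    rcases lt_or_ge R⁻¹ |x| with hx | hx
    · rw [hzero χ hχ R hR x hx, norm_zero, zero_mul]
      exact mul_nonneg (mul_nonneg (apply_nonneg _ _) hC0) (by positivity)
    · rw [mul_assoc, Nat.cast_zero, zero_sub, Real.rpow_neg hR0.le, Real.rpow_natCast, ← inv_pow]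
      gcongr
      · exact χ.norm_le_seminorm ℝ _
      · exact (hC x).trans (by gcongr)
  | succ i ih =>
    obtain ⟨C₁, h₁, H₁⟩ := ih ((SchwartzMap.tsupport_derivCLM_subset ℂ χ).trans hχ) h
    obtain ⟨C₂, h₂, H₂⟩ := ih (e := e - 1) (φ := schwartzDeriv X φ) hχ fun j hj => by
      rw [← Function.iterate_succ_apply]
      exact h (j + 1) (by omega)
    refine ⟨C₁ + C₂, by positivity, fun R hR x => ?_⟩
    have hR0 : 0 < R := by linarith
    rw [iterate_succ_cutoffMul, add_mul]
    refine (norm_add_le _ _).trans (add_le_add ?_ ((H₂ R hR x).trans ?_))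
    · have e1 : R ^ (((i + 1 : ℕ) : ℝ) - e) = R * R ^ ((i : ℝ) - e) := by
        rw [show ((i + 1 : ℕ) : ℝ) - e = 1 + (i - e) by push_cast; ring, Real.rpow_add hR0,
          Real.rpow_one]
      rw [norm_smul, Complex.norm_real, Real.norm_eq_abs, abs_of_pos hR0, e1, mul_left_comm]
      gcongr
      exact H₁ R hR x
    · have : (e : ℝ) ≤ (e - 1 : ℕ) + 1 := by
        exact_mod_cast (show e ≤ e - 1 + 1 by omega)
      refine mul_le_mul_of_nonneg_left (Real.rpow_le_rpow_of_exponent_le hR ?_) h₂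
      push_cast
      linarith

theorem IsConcentrating.schwartzBessel_two {a : ℝ} {u : ℝ → 𝓢(ℝ, X)} (hu : IsConcentrating a u) :
    IsConcentrating (a - 2) fun R => schwartzBessel X 2 (u R) := by
  refine ⟨fun R hR x hx => ?_, fun i => ?_⟩
  · have h1 : (u R : ℝ → X) =ᶠ[𝓝 x] fun _ => 0 := by
      filter_upwards [(isOpen_lt continuous_const continuous_abs).mem_nhds hx] with y hy
      exact hu.eq_zero R hR y hy
    have h2 : (schwartzDeriv X)^[2] (u R) x = 0 := by
      rw [iterate_schwartzDeriv_apply, h1.iteratedDeriv_eq]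
      simp
    rw [WeightedBessel.schwartzBessel_two, sub_apply, h2, hu.eq_zero R hR x hx,
      sub_zero]
  · obtain ⟨C₁, h₁, H₁⟩ := hu.bound i
    obtain ⟨C₂, h₂, H₂⟩ := hu.bound (i + 2)
    refine ⟨C₁ + C₂, by positivity, fun R hR x => ?_⟩
    rw [WeightedBessel.schwartzBessel_two, iterate_map_sub, ← Function.iterate_add_apply,
      sub_apply, add_mul]
    refine (norm_sub_le _ _).trans (add_le_add ((H₁ R hR x).trans ?_) ((H₂ R hR x).trans ?_))
    · exact mul_le_mul_of_nonneg_left (Real.rpow_le_rpow_of_exponent_le hR (by linarith)) h₁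
    · refine mul_le_mul_of_nonneg_left (Real.rpow_le_rpow_of_exponent_le hR ?_) h₂
      push_cast
      linarith

theorem IsConcentrating.schwartzBessel_two_mul {a : ℝ} {u : ℝ → 𝓢(ℝ, X)}
    (hu : IsConcentrating a u) (m : ℕ) :
    IsConcentrating (a - 2 * m) fun R => schwartzBessel X (2 * m) (u R) := by
  induction m with
  | zero => simpa [schwartzBessel_zero] using hu
  | succ m ih =>
    have h := ih.schwartzBessel_two
    simp only [schwartzBessel_schwartzBessel] at h
    have e1 : a - 2 * m - 2 = a - 2 * (m + 1 : ℕ) := by push_cast; ring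
    have e2 : (2 * m + 2 : ℝ) = 2 * (m + 1 : ℕ) := by push_cast; ring
    rwa [e1, e2] at h

theorem IsConcentrating.exists_eLpNorm_le {a : ℝ} {u : ℝ → 𝓢(ℝ, X)} (hu : IsConcentrating a u)
    {p γ : ℝ} (hp : 1 < p) (hγ : -1 < γ) : ∃ C : ℝ≥0, ∀ R, 1 ≤ R →
      eLpNorm (u R) (ENNReal.ofReal p) (powerMeasure γ) ≤
        C * ENNReal.ofReal (R ^ (-a - (1 + γ) / p)) := by
  obtain ⟨C, hC0, hC⟩ := hu.bound 0
  have hp0 : 0 < p := by linarith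
  set K := (∫⁻ x in Set.Ioo (-1 : ℝ) 1, powWeight γ x) ^ (1 / p) with hK
  have hKt : K ≠ ⊤ := (ENNReal.rpow_lt_top_of_nonneg (by positivity)
    (lintegral_powWeight_unit_lt_top hγ).ne).ne
  refine ⟨(ENNReal.ofReal (C * 2 ^ ((1 + γ) / p)) * K).toNNReal, fun R hR => ?_⟩
  rw [ENNReal.coe_toNNReal (by finiteness)]
  have hR0 : 0 < R := by linarith
  set S := Set.Ioo (-(2 * R⁻¹)) (2 * R⁻¹) with hS
  have h2R : 0 < 2 * R⁻¹ := by positivity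
  have h1 : eLpNorm (u R) (ENNReal.ofReal p) (powerMeasure γ) ≤
      eLpNorm (S.indicator fun _ => C * R ^ (-a)) (ENNReal.ofReal p) (powerMeasure γ) := by
    refine eLpNorm_mono fun x => ?_
    by_cases hx : x ∈ S
    · rw [Set.indicator_of_mem hx, Real.norm_of_nonneg (by positivity)]
      simpa using hC R hR x
    · rw [hu.eq_zero R hR x, norm_zero]
      · exact norm_nonneg _
      · have h : ¬ |x| < 2 * R⁻¹ := fun h => hx (abs_lt.mp h)
        linarith [inv_pos.mpr hR0]
  have h2 : powerMeasure γ S = ENNReal.ofReal ((2 * R⁻¹) ^ (γ + 1)) *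
      ∫⁻ x in Set.Ioo (-1 : ℝ) 1, powWeight γ x := by
    rw [← lintegral_powWeight_Ioo γ h2R]
    exact withDensity_apply _ measurableSet_Ioo
  rw [eLpNorm_indicator_const measurableSet_Ioo (by simpa using hp0) ENNReal.ofReal_ne_top,
    ENNReal.toReal_ofReal hp0.le, h2, ENNReal.mul_rpow_of_nonneg _ _ (by positivity), ← hK,
    ENNReal.ofReal_rpow_of_nonneg (by positivity) (by positivity),
    Real.enorm_eq_ofReal (by positivity)] at h1
  refine h1.trans (le_of_eq ?_)
  rw [← mul_assoc, ← ENNReal.ofReal_mul (by positivity), mul_right_comm _ K,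
    ← ENNReal.ofReal_mul (by positivity)]
  congr 2
  rw [← Real.rpow_mul h2R.le, mul_one_div, add_comm γ 1, Real.mul_rpow two_pos.le (by positivity),
    Real.inv_rpow hR0.le, ← Real.rpow_neg hR0.le, sub_eq_add_neg, Real.rpow_add hR0]
  ring

/-- Below the critical smoothness `a + (1 + γ) / p`, concentrating families tend to zero. The
norms of the even orders `2 m` and `2 m + 2` are estimated directly, and those of the orders in
between by the moment inequality. -/
theorem IsConcentrating.tendsto_eLpNorm {a : ℝ} (ha : 0 ≤ a) {u : ℝ → 𝓢(ℝ, X)}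
    (hu : IsConcentrating a u) {s p γ : ℝ} (hp : 1 < p) (hγ : -1 < γ) (hγ' : γ < p - 1)
    (hs : s < a + (1 + γ) / p) :
    Tendsto (fun R => eLpNorm (schwartzBessel X s (u R)) (ENNReal.ofReal p) (powerMeasure γ))
      atTop (𝓝 0) := by
  set b := (1 + γ) / p with hb
  have hb0 : 0 < b := div_pos (by linarith) (by linarith)
  set m := ⌊max s 0 / 2⌋₊ with hm
  have hm1 : (2 * m : ℝ) ≤ max s 0 := by
    have := Nat.floor_le (show 0 ≤ max s 0 / 2 by positivity)
    linarith
  have hm2 : max s 0 < 2 * m + 2 := by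
    have := Nat.lt_floor_add_one (max s 0 / 2)
    linarith
  -- an order `t ≥ s` strictly between `2 m` and `2 m + 2` and still below the critical one
  obtain ⟨t, ht1, ht2⟩ := exists_between
    (show max s 0 < min (a + b) (2 * m + 2) from lt_min (max_lt hs (by linarith)) hm2)
  have ht3 := ht2.trans_le (min_le_left _ _)
  have ht4 := ht2.trans_le (min_le_right _ _)
  have hst : s ≤ t := (le_max_left _ _).trans ht1.le
  obtain ⟨C₀, h₀⟩ := exists_eLpNorm_schwartzBessel_neg_le (X := X) hp hγ hγ'
    (show 0 ≤ t - s by linarith)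
  obtain ⟨C, hC⟩ := exists_eLpNorm_schwartzBessel_two_sub_le (X := X) hp hγ hγ'
    (show 0 < 2 * m + 2 - t by linarith) (by linarith)
  obtain ⟨C₁, h₁⟩ := (hu.schwartzBessel_two_mul m).schwartzBessel_two.exists_eLpNorm_le hp hγ
  obtain ⟨C₂, h₂⟩ := (hu.schwartzBessel_two_mul m).exists_eLpNorm_le hp hγ
  have key : ∀ R, 1 ≤ R →
      eLpNorm (schwartzBessel X s (u R)) (ENNReal.ofReal p) (powerMeasure γ) ≤
        (C₀ * (C * (C₁ + C₂)) : ℝ≥0) * ENNReal.ofReal (R ^ (-(a + b - t))) := by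
    intro R hR
    have hR0 : 0 < R := by linarith
    have e0 : schwartzBessel X s (u R) =
        schwartzBessel X (-(t - s)) (schwartzBessel X t (u R)) := by
      rw [schwartzBessel_schwartzBessel]
      congr 2
      ring
    have e1 : schwartzBessel X (2 - (2 * m + 2 - t)) (schwartzBessel X (2 * m) (u R)) =
        schwartzBessel X t (u R) := by
      rw [schwartzBessel_schwartzBessel]
      congr 2
      ring
    have h3 := hC (schwartzBessel X (2 * m) (u R)) R⁻¹ (inv_pos.mpr hR0)
    rw [e1] at h3
    rw [e0]
    refine (h₀ _).trans ?_
    push_cast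
    rw [mul_assoc, mul_assoc]
    gcongr
    refine h3.trans ?_
    gcongr
    rw [add_mul]
    refine add_le_add ?_ ?_
    · refine (mul_le_mul_right (h₁ R hR) _).trans (le_of_eq ?_)
      rw [mul_left_comm, ← ENNReal.ofReal_mul (by positivity), Real.inv_rpow hR0.le,
        ← Real.rpow_neg hR0.le, ← Real.rpow_add hR0]
      congr 3
      ring
    · refine (mul_le_mul_right (h₂ R hR) _).trans (le_of_eq ?_)
      rw [mul_left_comm, ← ENNReal.ofReal_mul (by positivity), Real.inv_rpow hR0.le,
        ← Real.rpow_neg hR0.le, ← Real.rpow_add hR0]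
      congr 3
      ring
  have hlim : Tendsto (fun R : ℝ => ((C₀ * (C * (C₁ + C₂)) : ℝ≥0) : ℝ≥0∞) *
      ENNReal.ofReal (R ^ (-(a + b - t)))) atTop (𝓝 0) := by
    have h := ENNReal.tendsto_ofReal (tendsto_rpow_neg_atTop (show 0 < a + b - t by linarith))
    rw [ENNReal.ofReal_zero] at h
    have h' := ENNReal.Tendsto.const_mul h
      (Or.inr (ENNReal.coe_ne_top (r := C₀ * (C * (C₁ + C₂)))))
    rwa [mul_zero] at h'
  refine tendsto_of_tendsto_of_tendsto_of_le_of_le' tendsto_const_nhds hlim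
    (Eventually.of_forall fun _ => zero_le) ?_
  filter_upwards [eventually_ge_atTop 1] with R hR using key R hR

/-! ### Cutting off near infinity -/

theorem exists_pow_mul_norm_iterate_cutoffMul_le (k i : ℕ) (χ : 𝓢(ℝ, ℂ)) (φ : 𝓢(ℝ, X)) :
    ∃ C : ℝ, 0 ≤ C ∧ ∀ r, 0 ≤ r → r ≤ 1 → ∀ x,
      |x| ^ k * ‖(schwartzDeriv X)^[i] (cutoffMul X χ r φ) x‖ ≤ C := by
  induction i generalizing χ φ with
  | zero =>
    refine ⟨SchwartzMap.seminorm ℝ 0 0 χ * SchwartzMap.seminorm ℝ k 0 φ,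
      mul_nonneg (apply_nonneg _ _) (apply_nonneg _ _), fun r _ _ x => ?_⟩
    rw [Function.iterate_zero_apply, cutoffMul_apply, norm_smul, mul_left_comm]
    have h := φ.norm_pow_mul_le_seminorm ℝ k x
    rw [Real.norm_eq_abs] at h
    exact mul_le_mul (χ.norm_le_seminorm ℝ _) h (by positivity) (apply_nonneg _ _)
  | succ i ih =>
    obtain ⟨C₁, h₁, H₁⟩ := ih (schwartzDeriv ℂ χ) φ
    obtain ⟨C₂, h₂, H₂⟩ := ih χ (schwartzDeriv X φ)
    refine ⟨C₁ + C₂, by positivity, fun r hr hr' x => ?_⟩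
    rw [iterate_succ_cutoffMul]
    refine (mul_le_mul_of_nonneg_left (norm_add_le _ _) (by positivity)).trans ?_
    rw [mul_add, norm_smul, Complex.norm_real, Real.norm_of_nonneg hr, mul_left_comm]
    exact add_le_add ((mul_le_of_le_one_left (by positivity) hr').trans (H₁ r hr hr' x))
      (H₂ r hr hr' x)

theorem exists_pow_mul_norm_iterate_sub_cutoffMul_le {χ : 𝓢(ℝ, ℂ)}
    (hχ : ∀ x, |x| ≤ 1 / 2 → χ x = 1) (k i : ℕ) (φ : 𝓢(ℝ, X)) :
    ∃ C : ℝ, 0 ≤ C ∧ ∀ r, 0 ≤ r → r ≤ 1 → ∀ x,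
      |x| ^ k * ‖(schwartzDeriv X)^[i] (φ - cutoffMul X χ r φ) x‖ ≤ C * r := by
  induction i generalizing φ with
  | zero =>
    set M := SchwartzMap.seminorm ℝ 0 0 χ with hM
    have hM0 : 0 ≤ M := apply_nonneg _ _
    set N := SchwartzMap.seminorm ℝ (k + 1) 0 φ with hN
    have hN0 : 0 ≤ N := apply_nonneg _ _
    refine ⟨(1 + M) * (2 * N), by positivity, fun r hr _ x => ?_⟩
    rw [Function.iterate_zero_apply, sub_apply, cutoffMul_apply]
    rcases le_or_gt |r * x| (1 / 2) with hx | hx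
    · rw [hχ _ hx, one_smul, sub_self, norm_zero, mul_zero]
      positivity
    · -- here `1 < 2 r |x|`, which is traded for a factor `|x|`
      have h1 : ‖φ x - χ (r * x) • φ x‖ ≤ (1 + M) * ‖φ x‖ := by
        refine (norm_sub_le _ _).trans ?_
        rw [norm_smul, add_mul, one_mul]
        gcongr
        exact χ.norm_le_seminorm ℝ _
      have h2 := φ.norm_pow_mul_le_seminorm ℝ (k + 1) x
      rw [Real.norm_eq_abs, ← hN] at h2
      rw [abs_mul, abs_of_nonneg hr] at hx
      calc _ ≤ |x| ^ k * ((1 + M) * ‖φ x‖) := by gcongr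
        _ = (1 + M) * (1 * (|x| ^ k * ‖φ x‖)) := by ring
        _ ≤ (1 + M) * ((2 * (r * |x|)) * (|x| ^ k * ‖φ x‖)) := by
          gcongr
          linarith
        _ = (1 + M) * (2 * (|x| ^ (k + 1) * ‖φ x‖)) * r := by ring
        _ ≤ _ := by gcongr
  | succ i ih =>
    obtain ⟨C₁, h₁, H₁⟩ := exists_pow_mul_norm_iterate_cutoffMul_le k i (schwartzDeriv ℂ χ) φ
    obtain ⟨C₂, h₂, H₂⟩ := ih (schwartzDeriv X φ)
    refine ⟨C₁ + C₂, by positivity, fun r hr hr' x => ?_⟩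
    have e : (schwartzDeriv X)^[i + 1] (φ - cutoffMul X χ r φ) x =
        (schwartzDeriv X)^[i] (schwartzDeriv X φ - cutoffMul X χ r (schwartzDeriv X φ)) x -
          (r : ℂ) • (schwartzDeriv X)^[i] (cutoffMul X (schwartzDeriv ℂ χ) r φ) x := by
      rw [iterate_map_sub, sub_apply, iterate_succ_cutoffMul, iterate_map_sub, sub_apply,
        Function.iterate_succ_apply]
      abel
    rw [e]
    refine (mul_le_mul_of_nonneg_left (norm_sub_le _ _) (by positivity)).trans ?_
    rw [mul_add, norm_smul, Complex.norm_real, Real.norm_of_nonneg hr, mul_left_comm, add_comm,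
      add_mul, mul_comm C₁]
    exact add_le_add (mul_le_mul_of_nonneg_left (H₁ r hr hr' x) hr) (H₂ r hr hr' x)

theorem tendsto_cutoffMul {χ : 𝓢(ℝ, ℂ)} (hχ : ∀ x, |x| ≤ 1 / 2 → χ x = 1) (φ : 𝓢(ℝ, X)) :
    Tendsto (fun r => cutoffMul X χ r φ) (𝓝[>] 0) (𝓝 φ) := by
  rw [(schwartz_withSeminorms ℝ ℝ X).tendsto_nhds]
  rintro ⟨k, i⟩ ε hε
  obtain ⟨C, hC0, hC⟩ := exists_pow_mul_norm_iterate_sub_cutoffMul_le hχ k i φ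
  have h1 : ∀ᶠ r : ℝ in 𝓝[>] 0, r < min 1 (ε / (C + 1)) :=
    nhdsWithin_le_nhds (gt_mem_nhds (by positivity))
  filter_upwards [h1, self_mem_nhdsWithin] with r hr hr0
  have hr0' : 0 < r := hr0
  have h2 : SchwartzMap.seminorm ℝ k i (cutoffMul X χ r φ - φ) ≤ C * r := by
    refine SchwartzMap.seminorm_le_bound' ℝ k i _ (by positivity) fun x => ?_
    rw [← iterate_schwartzDeriv_apply, ← neg_sub φ, iterate_map_neg, neg_apply, norm_neg]
    exact hC r hr0'.le (hr.le.trans (min_le_left _ _)) x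
  refine h2.trans_lt ?_
  have h3 : r * (C + 1) < ε := (lt_div_iff₀ (by positivity)).mp (hr.trans_le (min_le_right _ _))
  linarith

/-! ### Cutoff functions and monomials -/

/-- A smooth bump function that is `1` on `[-1/2, 1/2]` and supported in `[-1, 1]`. -/
def centeredBump : ContDiffBump (0 : ℝ) := ⟨1 / 2, 1, by norm_num, by norm_num⟩

/-- The bump function `centeredBump` as a complex valued Schwartz function. -/
def cutoff : 𝓢(ℝ, ℂ) :=
  (show HasCompactSupport (fun x => (centeredBump x : ℂ)) from
    centeredBump.hasCompactSupport.comp_left (g := Complex.ofReal)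
      Complex.ofReal_zero).toSchwartzMap (Complex.ofRealCLM.contDiff.comp centeredBump.contDiff)

theorem cutoff_apply (x : ℝ) : cutoff x = (centeredBump x : ℂ) := rfl

theorem centeredBump_eq_one {x : ℝ} (hx : |x| ≤ 1 / 2) : centeredBump x = 1 :=
  centeredBump.one_of_mem_closedBall (by simpa [centeredBump] using hx)

theorem cutoff_eq_one {x : ℝ} (hx : |x| ≤ 1 / 2) : cutoff x = 1 := by
  rw [cutoff_apply, centeredBump_eq_one hx, Complex.ofReal_one]

theorem tsupport_cutoff_subset : tsupport cutoff ⊆ Set.Icc (-1) 1 := by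
  have h1 : tsupport cutoff ⊆ tsupport centeredBump := tsupport_comp_subset Complex.ofReal_zero _
  refine h1.trans ?_
  rw [centeredBump.tsupport_eq, Real.closedBall_eq_Icc]
  simp [centeredBump]

theorem hasCompactSupport_cutoffMul {r : ℝ} (hr : 0 < r) (φ : 𝓢(ℝ, X)) :
    HasCompactSupport (cutoffMul X cutoff r φ) := by
  refine HasCompactSupport.intro (isCompact_Icc (a := -r⁻¹) (b := r⁻¹)) fun x hx => ?_
  have h0 : cutoff (r * x) = 0 := image_eq_zero_of_notMem_tsupport fun h => ?_
  · rw [cutoffMul_apply, h0, zero_smul]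
  have h1 := abs_le.mpr (tsupport_cutoff_subset h)
  rw [abs_mul, abs_of_pos hr] at h1
  exact hx (abs_le.mp ((le_inv_mul_iff₀ hr).mpr h1 |>.trans (by rw [mul_one])))

/-- The test function `x ^ j / j!` near the origin. -/
def monomialBump (j : ℕ) : 𝓢(ℝ, ℝ) :=
  (centeredBump.hasCompactSupport.mul_left (f := fun x : ℝ => x ^ j / j.factorial)).toSchwartzMap
    (((contDiff_id.pow j).div_const _).mul centeredBump.contDiff)

theorem iteratedDeriv_monomialBump_zero (i j : ℕ) :
    iteratedDeriv i (monomialBump j) 0 = if i = j then 1 else 0 := by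
  have h1 : (monomialBump j : ℝ → ℝ) =ᶠ[𝓝 0] fun x => x ^ j / j.factorial := by
    filter_upwards [Metric.closedBall_mem_nhds (0 : ℝ) one_half_pos] with x hx
    change x ^ j / j.factorial * centeredBump x = _
    rw [centeredBump_eq_one (mem_closedBall_zero_iff.mp hx), mul_one]
  rw [h1.iteratedDeriv_eq, iteratedDeriv_div_const, iteratedDeriv_fun_pow_zero]
  split_ifs with h
  · exact div_self (Nat.cast_ne_zero.mpr j.factorial_ne_zero)
  · simp

/-- The Schwartz function `g ⊗ c : x ↦ g(x) c`. -/
def tensor (g : 𝓢(ℝ, ℝ)) (c : X) : 𝓢(ℝ, X) :=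
  SchwartzMap.postcompCLM (ContinuousLinearMap.toSpanSingleton ℝ c) g

theorem tensor_apply (g : 𝓢(ℝ, ℝ)) (c : X) (x : ℝ) : tensor g c x = g x • c := rfl

theorem iterate_schwartzDeriv_tensor (g : 𝓢(ℝ, ℝ)) (c : X) (i : ℕ) (x : ℝ) :
    (schwartzDeriv X)^[i] (tensor g c) x = iteratedDeriv i g x • c := by
  induction i generalizing g with
  | zero => simp [tensor_apply]
  | succ i ih =>
    have h : schwartzDeriv X (tensor g c) = tensor (SchwartzMap.derivCLM ℝ ℝ g) c := by
      ext y
      have h1 : HasDerivAt (tensor g c) (deriv g y • c) y := (g.hasDerivAt y).smul_const c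
      exact (hasDerivAt_schwartz _ y).unique h1
    rw [Function.iterate_succ_apply, h, ih, iteratedDeriv_succ']
    rfl

theorem continuous_tensor (g : 𝓢(ℝ, ℝ)) : Continuous (tensor g : X → 𝓢(ℝ, X)) := by
  let T : X →ₗ[ℝ] 𝓢(ℝ, X) :=
    { toFun := tensor g
      map_add' := fun c d => by
        ext x
        simp [tensor_apply]
      map_smul' := fun a c => by
        ext x
        simp [tensor_apply, smul_comm a] }
  refine WithSeminorms.continuous_normedSpace_dom (𝕝 := ℝ) X (schwartz_withSeminorms ℝ ℝ X) T ?_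
  rintro ⟨k, i⟩
  refine ⟨⟨SchwartzMap.seminorm ℝ k i g, apply_nonneg _ _⟩, fun c => ?_⟩
  refine SchwartzMap.seminorm_le_bound' ℝ k i _ (mul_nonneg (apply_nonneg _ _) (norm_nonneg _))
    fun x => ?_
  change _ * ‖iteratedDeriv i (tensor g c) x‖ ≤ SchwartzMap.seminorm ℝ k i g * ‖c‖
  rw [← iterate_schwartzDeriv_apply, iterate_schwartzDeriv_tensor, norm_smul, ← mul_assoc]
  gcongr
  exact g.le_seminorm' ℝ k i x

variable (X) in
/-- A right inverse of `schwartzJet`: the truncated Taylor polynomial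
`(c₀, …, c_{n-1}) ↦ ∑ cⱼ xʲ / j!`, cut off away from the origin. -/
def jetLift (n : ℕ) (c : Fin n → X) : 𝓢(ℝ, X) := ∑ j : Fin n, tensor (monomialBump j) (c j)

theorem continuous_jetLift (n : ℕ) : Continuous (jetLift X n) :=
  continuous_finsetSum _ fun j _ => (continuous_tensor _).comp (continuous_apply j)

theorem jetLift_zero (n : ℕ) : jetLift X n 0 = 0 := by
  ext x
  simp [jetLift, tensor_apply]

theorem schwartzJet_jetLift (n : ℕ) (c : Fin n → X) : schwartzJet X n (jetLift X n c) = c := by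
  ext i
  rw [jetLift, map_sum, Finset.sum_apply, Finset.sum_eq_single i]
  · rw [schwartzJet_apply, iterate_schwartzDeriv_tensor, iteratedDeriv_monomialBump_zero,
      if_pos rfl, one_smul]
  · intro j _ hj
    rw [schwartzJet_apply, iterate_schwartzDeriv_tensor, iteratedDeriv_monomialBump_zero,
      if_neg fun h => hj (Fin.ext h.symm), zero_smul]
  · simp

/-! ### Density of the test functions in the kernel of the trace -/

section

variable {s p γ : ℝ} [hp : Fact (1 < p)] [hμ : (powerMeasure γ).HasTemperateGrowth]

/-- Schwartz functions that vanish near the origin are limits of test functions on `ℝ ∖ {0}`. -/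
theorem ofSchwartz_mem_besselZero_of_eq_zero {ψ : 𝓢(ℝ, X)} {δ : ℝ} (hδ : 0 < δ)
    (hψ : ∀ x, |x| ≤ δ → ψ x = 0) : ofSchwartz X s p γ ψ ∈ besselZero X s p γ := by
  have h := (continuous_ofSchwartz (s := s) (p := p) (γ := γ)).continuousAt.tendsto.comp
    (tendsto_cutoffMul (fun x hx => cutoff_eq_one hx) ψ)
  refine mem_closure_of_tendsto h ?_
  filter_upwards [self_mem_nhdsWithin] with r hr
  refine ⟨cutoffMul X cutoff r ψ, hasCompactSupport_cutoffMul hr ψ, ?_, rfl⟩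
  rw [Set.subset_compl_singleton_iff, notMem_tsupport_iff_eventuallyEq]
  filter_upwards [Metric.closedBall_mem_nhds (0 : ℝ) hδ] with x hx
  rw [cutoffMul_apply, hψ x (mem_closedBall_zero_iff.mp hx), smul_zero]
  rfl

/-- A Schwartz function with vanishing jet is the limit of its products with `1 - χ(R ·)`. -/
theorem ofSchwartz_mem_besselZero (hγ : -1 < γ) (hγ' : γ < p - 1) {n : ℕ}
    (hs' : s < n + (1 + γ) / p) {φ : 𝓢(ℝ, X)} (hφ : schwartzJet X n φ = 0) :
    ofSchwartz X s p γ φ ∈ besselZero X s p γ := by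
  have hu := isConcentrating_cutoffMul tsupport_cutoff_subset (φ := φ) (e := n)
    fun j hj => congrFun hφ ⟨j, hj⟩
  have h1 := hu.tendsto_eLpNorm (Nat.cast_nonneg n) hp.out hγ hγ' hs'
  simp_rw [← enorm_ofSchwartz] at h1
  have h2 : Tendsto (fun R => ofSchwartz X s p γ (φ - cutoffMul X cutoff R φ)) atTop
      (𝓝 (ofSchwartz X s p γ φ)) := by
    have h3 := (tendsto_zero_iff_enorm_tendsto_zero).mpr h1
    have h4 := (tendsto_const_nhds (x := ofSchwartz X s p γ φ)).sub h3
    rw [sub_zero] at h4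
    simpa only [map_sub] using h4
  refine isClosed_closure.mem_of_tendsto h2 ?_
  filter_upwards [eventually_gt_atTop 0] with R hR
  refine ofSchwartz_mem_besselZero_of_eq_zero (δ := (2 * R)⁻¹) (by positivity) fun x hx => ?_
  rw [sub_apply, cutoffMul_apply, cutoff_eq_one, one_smul, sub_self]
  rw [abs_mul, abs_of_pos hR]
  calc R * |x| ≤ R * (2 * R)⁻¹ := by gcongr
    _ = 1 / 2 := by field_simp

theorem besselZero_eq_ker_besselTrace [IsFiniteMeasureOnCompacts (powerMeasure γ)] (hγ : -1 < γ)
    (hγ' : γ < p - 1) {n : ℕ} (hs : ∀ j < n, j + (1 + γ) / p < s) (hs' : s < n + (1 + γ) / p) :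
    besselZero X s p γ = {f | besselTrace X s p γ n f = 0} := by
  refine Set.Subset.antisymm (closure_minimal ?_
    (isClosed_eq (besselTrace X s p γ n).continuous continuous_const)) fun f hf => ?_
  · rintro f ⟨φ, -, hφ, h⟩
    have h1 : f = ofSchwartz X s p γ φ := BesselSpace.toTempered_injective h
    change besselTrace X s p γ n f = 0
    rw [h1, besselTrace_ofSchwartz hγ hγ' hs]
    funext j
    rw [schwartzJet_apply, iterate_schwartzDeriv_apply]
    have h2 : (φ : ℝ → X) =ᶠ[𝓝 0] fun _ => 0 := by
      rw [← Pi.zero_def, ← notMem_tsupport_iff_eventuallyEq]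
      exact fun h0 => hφ h0 rfl
    rw [h2.iteratedDeriv_eq]
    simp
  · -- `f ↦ f - jetLift (Tr f)` maps the dense subspace of Schwartz functions to `besselZero`
    have hc : Continuous fun g : BesselSpace X s p γ =>
        g - ofSchwartz X s p γ (jetLift X n (besselTrace X s p γ n g)) :=
      continuous_id.sub (continuous_ofSchwartz.comp
        ((continuous_jetLift n).comp (besselTrace X s p γ n).continuous))
    have h1 := (denseRange_ofSchwartz (X := X) (s := s) (p := p) (γ := γ)).induction_on
      (p := fun g => g - ofSchwartz X s p γ (jetLift X n (besselTrace X s p γ n g)) ∈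
        besselZero X s p γ) f (isClosed_closure.preimage hc) fun φ => by
      rw [besselTrace_ofSchwartz hγ hγ' hs, ← map_sub]
      refine ofSchwartz_mem_besselZero hγ hγ' hs' ?_
      rw [map_sub, schwartzJet_jetLift, sub_self]
    have h2 : besselTrace X s p γ n f = 0 := hf
    rwa [h2, jetLift_zero, map_zero, sub_zero] at h1

end

/-! ### The half line -/

section

variable {s p γ : ℝ} [hp : Fact (1 < p)]

theorem norm_restrict_le (g : BesselSpace X s p γ) : ‖BesselSpaceHalf.restrict g‖ ≤ ‖g‖ := by
  rw [BesselSpaceHalf.norm_eq]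
  exact csInf_le ⟨0, by rintro _ ⟨h, -, rfl⟩; exact norm_nonneg h⟩ ⟨g, rfl, rfl⟩

theorem continuous_restrict :
    Continuous (BesselSpaceHalf.restrict : BesselSpace X s p γ →ₗ[ℂ] BesselSpaceHalf X s p γ) :=
  AddMonoidHomClass.continuous_of_bound _ 1 fun g => by
    rw [one_mul]
    exact norm_restrict_le g

/-- A bounded operator that vanishes on the kernel of the restriction to `ℝ₊` factors through
`H^{s,p}(ℝ₊, w_γ; X)`. -/
theorem exists_factor_restrict {E : Type*} [NormedAddCommGroup E] [NormedSpace ℂ E]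
    (T : BesselSpace X s p γ →L[ℂ] E) (hT : ∀ g, restrictHalfLine X s p γ g = 0 → T g = 0) :
    ∃ T' : BesselSpaceHalf X s p γ →L[ℂ] E, ∀ g, T' (BesselSpaceHalf.restrict g) = T g := by
  have hsurj := BesselSpaceHalf.restrict_surjective (X := X) (s := s) (p := p) (γ := γ)
  have hT' : ∀ g h : BesselSpace X s p γ,
      BesselSpaceHalf.restrict g = BesselSpaceHalf.restrict h → T g = T h := by
    intro g h hgh
    rw [← sub_eq_zero, ← map_sub]
    refine hT _ ?_
    rw [map_sub, sub_eq_zero]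
    exact congrArg Subtype.val hgh
  have hinv : ∀ f : BesselSpaceHalf X s p γ,
      BesselSpaceHalf.restrict (Function.surjInv hsurj f) = f := Function.surjInv_eq hsurj
  let L : BesselSpaceHalf X s p γ →ₗ[ℂ] E :=
    { toFun := fun f => T (Function.surjInv hsurj f)
      map_add' := fun f g => by
        rw [← map_add]
        exact hT' _ _ (by rw [map_add, hinv, hinv, hinv])
      map_smul' := fun c f => by
        rw [RingHom.id_apply, ← map_smul]
        exact hT' _ _ (by rw [map_smul, hinv, hinv]) }
  refine ⟨L.mkContinuous ‖T‖ fun f => le_of_forall_pos_le_add fun ε hε => ?_,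
    fun g => hT' _ _ (hinv _)⟩
  have hη : 0 < ε / (‖T‖ + 1) := by positivity
  obtain ⟨_, ⟨g, hg, rfl⟩, hlt⟩ := exists_lt_of_csInf_lt
    (s := (fun g : BesselSpace X s p γ => ‖g‖) '' {g | BesselSpaceHalf.restrict g = f})
    ⟨_, _, hinv f, rfl⟩ (b := ‖f‖ + ε / (‖T‖ + 1)) (by
      rw [← BesselSpaceHalf.norm_eq]
      linarith)
  have h1 : L f = T g := hT' _ _ ((hinv f).trans (Eq.symm hg))
  have h2 : ‖T‖ * (ε / (‖T‖ + 1)) ≤ ε := by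
    rw [mul_div_left_comm]
    exact mul_le_of_le_one_right hε.le ((div_le_one (by positivity)).mpr (by linarith))
  rw [h1]
  calc ‖T g‖ ≤ ‖T‖ * ‖g‖ := T.le_opNorm g
    _ ≤ ‖T‖ * (‖f‖ + ε / (‖T‖ + 1)) := by
      gcongr
    _ ≤ ‖T‖ * ‖f‖ + ε := by
      rw [mul_add]
      exact add_le_add_right h2 _

end

/-- The part of a test function on `ℝ ∖ {0}` that lives on `ℝ₊` is a test function on `ℝ₊`, and has
the same restriction to `ℝ₊`. -/
theorem exists_test_halfLine {φ : 𝓢(ℝ, X)} (hφ : HasCompactSupport φ) (hφ' : tsupport φ ⊆ {0}ᶜ) :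
    ∃ φ' : 𝓢(ℝ, X), HasCompactSupport φ' ∧ tsupport φ' ⊆ Set.Ioi 0 ∧
      restrictTo X halfLine (φ : 𝓢'(ℝ, X)) = restrictTo X halfLine (φ' : 𝓢'(ℝ, X)) := by
  set g : ℝ → X := (Set.Ioi 0).indicator φ with hg
  have hsub : Function.support g ⊆ tsupport φ ∩ Set.Ici 0 := by
    intro x hx
    rw [hg, Set.support_indicator] at hx
    exact ⟨subset_tsupport _ hx.2, (show 0 < x from hx.1).le⟩
  have hsub' : tsupport g ⊆ tsupport φ ∩ Set.Ici 0 :=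
    closure_minimal hsub ((isClosed_tsupport _).inter isClosed_Ici)
  have hpos : tsupport g ⊆ Set.Ioi 0 := fun x hx =>
    lt_of_le_of_ne (hsub' hx).2 fun h => hφ' (hsub' hx).1 h.symm
  have hcomp : HasCompactSupport g :=
    hφ.of_isClosed_subset (isClosed_tsupport _) (hsub'.trans Set.inter_subset_left)
  have hsmooth : ContDiff ℝ ∞ g := by
    refine contDiff_iff_contDiffAt.mpr fun x => ?_
    by_cases hx : x ∈ tsupport g
    · refine ((φ.smooth ⊤).contDiffAt).congr_of_eventuallyEq ?_
      filter_upwards [isOpen_Ioi.mem_nhds (hpos hx)] with y hy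
      exact Set.indicator_of_mem hy _
    · exact contDiffAt_const.congr_of_eventuallyEq (notMem_tsupport_iff_eventuallyEq.mp hx)
  refine ⟨hcomp.toSchwartzMap hsmooth, hcomp, hpos, ?_⟩
  ext ψ
  rw [restrictTo_apply, restrictTo_apply]
  have h1 := SchwartzMap.toTemperedDistributionCLM_apply_apply volume φ (extendTest halfLine ψ)
  have h2 := SchwartzMap.toTemperedDistributionCLM_apply_apply volume
    (hcomp.toSchwartzMap hsmooth) (extendTest halfLine ψ)
  refine h1.trans (Eq.trans (integral_congr_ae (Eventually.of_forall fun x => ?_)) h2.symm)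
  change ((ψ x : ℝ) : ℂ) • φ x = ((ψ x : ℝ) : ℂ) • g x
  by_cases hx : x ∈ Set.Ioi (0 : ℝ)
  · rw [hg, Set.indicator_of_mem hx]
  · have h0 : ψ x = 0 := image_eq_zero_of_notMem_tsupport fun h => hx (ψ.tsupport_subset h)
    rw [h0, Complex.ofReal_zero, zero_smul, zero_smul]

section

variable {s p γ : ℝ} [hp : Fact (1 < p)] [hμ : (powerMeasure γ).HasTemperateGrowth]

/-- The description of `H^{s,p}_0` as a kernel passes from `ℝ` to `ℝ₊`. -/
theorem besselZeroHalf_eq_ker {E : Type*} [NormedAddCommGroup E] [NormedSpace ℂ E]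
    {T : BesselSpace X s p γ →L[ℂ] E} {T' : BesselSpaceHalf X s p γ →L[ℂ] E}
    (hT' : ∀ g, T' (BesselSpaceHalf.restrict g) = T g)
    (hT : besselZero X s p γ = {f | T f = 0}) :
    besselZeroHalf X s p γ = {f | T' f = 0} := by
  refine Set.Subset.antisymm (closure_minimal ?_ (isClosed_eq T'.continuous continuous_const))
    fun f hf => ?_
  · rintro f ⟨φ, hφ, hφ', h⟩
    have h1 : f = BesselSpaceHalf.restrict (ofSchwartz X s p γ φ) := Subtype.ext h
    have h2 : ofSchwartz X s p γ φ ∈ besselZero X s p γ :=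
      subset_closure ⟨φ, hφ, fun x hx => (hφ' hx).ne', rfl⟩
    rw [hT] at h2
    change T' f = 0
    rw [h1, hT']
    exact h2
  · obtain ⟨g, rfl⟩ := BesselSpaceHalf.restrict_surjective f
    have h1 : g ∈ besselZero X s p γ := by
      rw [hT]
      exact (hT' g).symm.trans hf
    refine closure_mono ?_ (image_closure_subset_closure_image continuous_restrict
      (Set.mem_image_of_mem _ h1))
    rintro _ ⟨h, ⟨φ, hφ, hφ', hh⟩, rfl⟩
    obtain ⟨φ', h2, h3, h4⟩ := exists_test_halfLine hφ hφ'
    refine ⟨φ', h2, h3, ?_⟩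
    rw [← h4, ← hh]
    rfl

end

/-! ### The characterisation of the closures of the test functions -/

section

variable {s p γ : ℝ} [hp : Fact (1 < p)] [hμ : (powerMeasure γ).HasTemperateGrowth]
  [IsFiniteMeasureOnCompacts (powerMeasure γ)]

theorem isTrace_besselTrace (hγ : -1 < γ) (hγ' : γ < p - 1) {k : ℤ}
    (hs : ∀ j < (k + 1).toNat, j + (1 + γ) / p < s) :
    IsTrace k (besselTrace X s p γ (k + 1).toNat) := by
  intro f u hu hf j
  refine besselTrace_apply_of_isLocallyInducedBy hγ hγ' hs j f (hu.of_le ?_) hf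
  have := j.2
  exact_mod_cast (show (j : ℕ) ≤ k.toNat by omega)

theorem IsTrace.unique {k : ℤ} {T₁ T₂ : BesselSpace X s p γ →L[ℂ] (Fin (k + 1).toNat → X)}
    (h₁ : IsTrace k T₁) (h₂ : IsTrace k T₂) : T₁ = T₂ := by
  refine DFunLike.coe_injective ((denseRange_ofSchwartz (X := X)).equalizer T₁.continuous
    T₂.continuous (funext fun φ => funext fun j => ?_))
  have hφ : ContDiff ℝ k.toNat φ := (φ.smooth ⊤).of_le (mod_cast le_top)
  exact (h₁ _ φ hφ (isLocallyInducedBy_ofSchwartz φ) j).trans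
    (h₂ _ φ hφ (isLocallyInducedBy_ofSchwartz φ) j).symm

end

end

end WeightedBessel
end

theorem mainTheorem7 {X : Type*} [NormedAddCommGroup X] [NormedSpace ℂ X] [CompleteSpace X]
    (p : ℝ) [hp : Fact (1 < p)] (γ : ℝ) (hγ : -1 < γ) (hγ' : γ < p - 1)
    (s : ℝ) (k : ℤ) (hk : -1 ≤ k)
    (hs : k + (1 + γ) / p < s) (hs' : s < k + 1 + (1 + γ) / p) :
    ∃ Tr : WeightedBessel.BesselSpace X s p γ →L[ℂ] (Fin (k + 1).toNat → X),
      (WeightedBessel.IsTrace k Tr ∧ ∀ T, WeightedBessel.IsTrace k T → T = Tr) ∧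
      WeightedBessel.besselZero X s p γ = {f | Tr f = 0} ∧
      ∃ TrPlus : WeightedBessel.BesselSpaceHalf X s p γ →L[ℂ] (Fin (k + 1).toNat → X),
        WeightedBessel.IsHalfLineTrace Tr TrPlus ∧
        WeightedBessel.besselZeroHalf X s p γ = {f | TrPlus f = 0} := by
  have := WeightedBessel.hasTemperateGrowth_powerMeasure hγ
  have := WeightedBessel.isFiniteMeasureOnCompacts_powerMeasure hγ
  have hn : (((k + 1).toNat : ℕ) : ℝ) = k + 1 := by
    have h : (((k + 1).toNat : ℕ) : ℤ) = k + 1 := Int.toNat_of_nonneg (by omega)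
    exact_mod_cast congrArg (Int.cast : ℤ → ℝ) h
  have hlow : ∀ j < (k + 1).toNat, (j : ℝ) + (1 + γ) / p < s := by
    intro j hj
    have h : (j : ℝ) + 1 ≤ k + 1 := by
      rw [← hn]
      exact_mod_cast hj
    linarith
  rw [← hn] at hs'
  have htr := WeightedBessel.isTrace_besselTrace (X := X) hγ hγ' hlow
  have hker := WeightedBessel.besselZero_eq_ker_besselTrace (X := X) hγ hγ' hlow hs'
  obtain ⟨T', hT'⟩ := WeightedBessel.exists_factor_restrict
    (WeightedBessel.besselTrace X s p γ (k + 1).toNat)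
    fun g hg => WeightedBessel.besselTrace_eq_zero_of_restrict_eq_zero hγ hγ' hlow hg
  refine ⟨_, ⟨htr, fun T hT => hT.unique htr⟩, hker, T', ?_,
    WeightedBessel.besselZeroHalf_eq_ker hT' hker⟩
  rintro _ g rfl
  exact hT' g
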